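/- **Setting.** Let $X^\star\in\mathbb R^{d\times d}$ be symmetric positive semidefinite of rank $r$ with spectral norm $1$, and let $\kappa=1/\sigma_r(X^\star)$, where $\sigma_r$ is the $r$-th largest singular value. Let $A_1,\dots,A_m\in\mathbb R^{d\times d}$, $y_i=\langle A_i,X^\star\rangle$ with $\langle A,B\rangle=\operatorname{tr}(A^\top B)$, and $$f(U)=\frac1{2m}\sum_{i=1}^m\bigl(y_i-\langle A_i,UU^\top\rangle\bigr)^2 ,\qquad U\in\mathbb R^{d\times d}.$$ Gradient descent is $U_0=\alpha B$ with $B$ any $d\times d$ orthogonal matrix, and $U_{t+1}=U_t-\eta\nabla f(U_t)$. The measurements satisfy $(k,\delta)$-RIP if $(1-\delta)\|X\|_F^2\le\frac1m\sum_{i}\langle A_i,X\rangle^2\le(1+\delta)\|X\|_F^2$ for every symmetric $X\in\mathbb R^{d\times d}$ of rank at most $k$. **Theorem.** There are absolute constants $c>0$, $K\ge1$ and $C>0$ such that the following holds for all $d,r,m$ and all data as above. Assume $0<\alpha<c/d$ and $\alpha\le c\,\delta\sqrt r\,\kappa$, that $A_1,\dots,A_m$ satisfy $(\max\{r,2\},\delta)$-RIP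 with $$\delta\le\frac{c}{\kappa^3\sqrt r\,\log^2(d/\alpha)},$$ and that $0<\eta\le c\,\delta$. Put $$T_0=\max\Bigl\{\frac{\kappa\log(d/\alpha)}{\eta},\ \frac1{\eta\sqrt{d\kappa\alpha}}\Bigr\}.$$ 1. For every integer $0\le t\le 2K\,T_0$, $$\|U_tU_t^\top-X^\star\|_F^2\le r\Bigl(1-\frac{\eta}{8\kappa}\Bigr)^{t-T_0}+C\,\frac{\alpha\sqrt d}{\kappa^2}.$$ 2. For every integer $T_1$ with $K\,\dfrac{\kappa\log(d/\alpha)}{\eta}\le T_1\le 2K\,T_0$, $$\|U_{T_1}U_{T_1}^\top-X^\star\|_F^2\le C\,\frac{\alpha\sqrt d}{\kappa^2}.$$ In particular this holds for every integer $T_1$ between $K\kappa\log(d/\alpha)/\eta$ and $2K\kappa\log(d/\alpha)/\eta$, i.e. already at some $T_1=\Theta(\kappa\log(d/\alpha)/\eta)$. -/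

import Mathlib

open scoped Matrix

noncomputable section

namespace MatrixSensing

/-- The inner product `⟨A, B⟩ = tr(Aᵀ B)` of two square matrices. -/
def frobInner {d : ℕ} (A B : Matrix (Fin d) (Fin d) ℝ) : ℝ := (Aᵀ * B).trace

/-- The squared Frobenius norm. -/
def frobSq {d : ℕ} (A : Matrix (Fin d) (Fin d) ℝ) : ℝ := frobInner A A

/-- The spectral norm: the operator norm for the Euclidean norm. -/
def spectralNorm {d : ℕ} (X : Matrix (Fin d) (Fin d) ℝ) : ℝ :=
  ‖Matrix.toEuclideanCLM (n := Fin d) (𝕜 := ℝ) X‖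

/-- The condition number `1 / σ_r(X)` of a matrix `X` of rank `r ≥ 1` and spectral norm one.
Mathlib's singular values are in decreasing order and indexed from `0`, so that the `r`-th one
has index `r - 1`. -/
def condNumber {d : ℕ} (X : Matrix (Fin d) (Fin d) ℝ) (r : ℕ) : ℝ :=
  1 / (Matrix.toEuclideanLin X).singularValues (r - 1)

/-- The `(k, δ)`-restricted isometry property of the measurements `A₁, …, A_m`, required on
symmetric matrices of rank at most `k`. -/
def RIP {d m : ℕ} (A : Fin m → Matrix (Fin d) (Fin d) ℝ) (k : ℕ) (δ : ℝ) : Prop :=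
  ∀ X : Matrix (Fin d) (Fin d) ℝ, X.IsSymm → X.rank ≤ k →
    (1 - δ) * frobSq X ≤ 1 / (m : ℝ) * ∑ i, frobInner (A i) X ^ 2 ∧
      1 / (m : ℝ) * ∑ i, frobInner (A i) X ^ 2 ≤ (1 + δ) * frobSq X

/-- The loss `f(U) = (1 / (2m)) ∑ᵢ (yᵢ - ⟨Aᵢ, U Uᵀ⟩)²`. -/
def loss {d m : ℕ} (A : Fin m → Matrix (Fin d) (Fin d) ℝ) (y : Fin m → ℝ)
    (U : Matrix (Fin d) (Fin d) ℝ) : ℝ :=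
  1 / (2 * (m : ℝ)) * ∑ i, (y i - frobInner (A i) (U * Uᵀ)) ^ 2

/-- The gradient of a function of a matrix: the matrix of its partial derivatives with respect to
the entries. -/
def grad {d : ℕ} (f : Matrix (Fin d) (Fin d) ℝ → ℝ) (U : Matrix (Fin d) (Fin d) ℝ) :
    Matrix (Fin d) (Fin d) ℝ :=
  Matrix.of fun i j => lineDeriv ℝ f U (Matrix.single i j 1)

/-- Gradient descent on the loss with labels `yᵢ = ⟨Aᵢ, X⟩` and step size `η`, started at `U₀`. -/
def gdIter {d m : ℕ} (A : Fin m → Matrix (Fin d) (Fin d) ℝ) (X : Matrix (Fin d) (Fin d) ℝ)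
    (η : ℝ) (U₀ : Matrix (Fin d) (Fin d) ℝ) : ℕ → Matrix (Fin d) (Fin d) ℝ
  | 0 => U₀
  | t + 1 => gdIter A X η U₀ t -
      η • grad (loss A fun i => frobInner (A i) X) (gdIter A X η U₀ t)

/-- `T₀ = max {κ log(d/α) / η, 1 / (η √(d κ α))}`. -/
def timeT0 (d : ℕ) (κ α η : ℝ) : ℝ :=
  max (κ * Real.log (d / α) / η) (1 / (η * √(d * κ * α)))

end MatrixSensing

end

namespace MatrixSensing

/-! ### Operator inequalities for one step: size of the iterate and the noise subspace. -/

section InnerProduct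

variable {E : Type*} [NormedAddCommGroup E] [InnerProductSpace ℝ E]

open scoped RealInnerProductSpace

/-! Let R = UUᵀ − X⋆, Δ = `ripErr A R`, M = R + Δ, h = 2η, σ = 1/κ, q = δ√r, L = log(d/α), and let P
project onto the range of X⋆. By `grad_loss` a step is U ↦ (1 − hM)U with M symmetric, so U₊ᵀz =
Uᵀ(z − hMz). Besides ‖U‖ ≤ √2, which `norm_adjoint_step_le` preserves, three quantities are
followed.

Noise. A subspace S of dimension d − r, initially ker P, is pulled back by 1 − hM at each step. If x
= z − hMz lies in the old S, then U₊ᵀz = Uᵀx, so the noise on S grows at most by ‖x‖/‖z‖. Moreover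
(1 + hX⋆)Pz = Px + small, so pulling back damps the P-component: S stays within angle ρ of ker P,
and ‖x‖ ≤ (1 + h(ρ² + ζ))‖z‖, where ζ bounds the perturbations and ρσ = 4ζ. Hence the noise remains
O(α) during the L/(ση) steps that matter (`noise_subspace_step`, `NoiseBound.step`).

Signal. For x in the range of P, the vector x − hMx equals (1 − hUUᵀ)(y + hw) with y in the range of
P and w in S. Passing from x to y gains almost 1 + hσ, and applying Uᵀ(1 − hUUᵀ) costs at most about
0.312hσ while the lower bound s on the signal is at most √σ/2. So s grows geometrically until it
reaches √σ/2 (`signal_step`).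

Residual. ‖R‖² (Frobenius) drops by 2h‖RU‖² up to the isometry error (`fro_sq_residual_step`). The
subspace S yields U = PU + ΘPU + e with Θ and e small, whence ‖R‖ is essentially controlled by ‖PR‖,
and ‖RU‖ ≥ (√σ/2)‖PR‖ up to a small multiple of ‖R‖. The isometry error is at most δ(6‖R‖ + tiny),
so ‖R‖² contracts geometrically down to the floor ασ². From then on ‖M‖ ≤ 4√α σ, which keeps the
noise bounded until 2K·T₀; this is what the second term in T₀ is for.

The isometry is only assumed at rank max(r, 2). Apart from eeᵀ the residual has rank at most 3r; its
spectrum is cut into six pieces, each tested against a rank one matrix, while eeᵀ is a sum of rank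
one matrices (`norm_ripErr_residual_le`). `Invariant.step` runs the three estimates simultaneously.
-/

theorem norm_apply_le_of_adjoint {U W : E →L[ℝ] E} {b : ℝ}
    (hUW : ∀ x y, ⟪U x, y⟫ = ⟪x, W y⟫) (hW : ∀ x, ‖W x‖ ≤ b * ‖x‖) (x : E) :
    ‖U x‖ ≤ b * ‖x‖ := by
  have h1 : ‖U x‖ ^ 2 ≤ ‖x‖ * (b * ‖U x‖) := by
    rw [← real_inner_self_eq_norm_sq, hUW]
    exact (real_inner_le_norm _ _).trans (by gcongr; exact hW _)
  rcases (norm_nonneg (U x)).eq_or_lt with h | h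
  · rw [← h]
    exact (norm_nonneg _).trans (hW x)
  · nlinarith

/-- Expand the square: the cross term is −2h‖Uu‖², and ‖W‖² ≤ 2 bounds the quadratic term by
2h²‖Uu‖². -/
theorem norm_sub_smul_gram_sq_le {U W : E →L[ℝ] E} {h : ℝ} (hUW : ∀ x y, ⟪U x, y⟫ = ⟪x, W y⟫)
    (hW : ∀ x, ‖W x‖ ≤ √2 * ‖x‖) (u : E) :
    ‖u - h • W (U u)‖ ^ 2 ≤ ‖u‖ ^ 2 - (2 * h - 2 * h ^ 2) * ‖U u‖ ^ 2 := by
  have h1 : ⟪u, W (U u)⟫ = ‖U u‖ ^ 2 := by rw [← hUW, real_inner_self_eq_norm_sq]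
  have h2 : ‖W (U u)‖ ^ 2 ≤ 2 * ‖U u‖ ^ 2 := by
    have := pow_le_pow_left₀ (norm_nonneg _) (hW (U u)) 2
    rwa [mul_pow, Real.sq_sqrt (by norm_num)] at this
  rw [norm_sub_sq_real, inner_smul_right, h1, norm_smul, mul_pow, Real.norm_eq_abs, sq_abs]
  nlinarith [sq_nonneg h]

/-- One gradient step preserves the bound `‖Uᵀ‖ ≤ √2`. -/
theorem norm_adjoint_step_le {U W N : E →L[ℝ] E} {h : ℝ}
    (hUW : ∀ x y, ⟪U x, y⟫ = ⟪x, W y⟫) (h0 : 0 ≤ h) (h1 : h ≤ 1 / 100)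
    (hN : ∀ x, ‖N x‖ ≤ 11 / 10 * ‖x‖) (hW : ∀ x, ‖W x‖ ≤ √2 * ‖x‖) (x : E) :
    ‖W (x - h • (U (W x) - N x))‖ ≤ √2 * ‖x‖ := by
  have e1 : W (x - h • (U (W x) - N x)) = (W x - h • W (U (W x))) + h • W (N x) := by
    simp only [map_sub, map_smul]; module
  have hs : √2 ^ 2 = 2 := Real.sq_sqrt (by norm_num)
  have hs0 : 0 ≤ √2 := Real.sqrt_nonneg _
  have k1 := norm_sub_smul_gram_sq_le (h := h) hUW hW (W x)
  have k2 : ‖W x‖ ^ 2 ≤ ‖U (W x)‖ * ‖x‖ := by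
    rw [← real_inner_self_eq_norm_sq, ← hUW]; exact real_inner_le_norm _ _
  have k3 : ‖W x‖ ^ 2 ≤ 2 * ‖x‖ ^ 2 := by
    have := pow_le_pow_left₀ (norm_nonneg _) (hW x) 2
    rwa [mul_pow, hs] at this
  -- Tangent line of the square at 2‖x‖, the extremal value of ‖UUᵀx‖. It makes the cubic term
  -- strong enough, near singular value √2, to beat the growth 11/10 coming from N.
  have k4 : 4 * ‖W x‖ ^ 2 - 4 * ‖x‖ ^ 2 ≤ ‖U (W x)‖ ^ 2 := by
    nlinarith [sq_nonneg (‖U (W x)‖ - 2 * ‖x‖)]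
  have k5 : ‖W x - h • W (U (W x))‖ ≤ √2 * ‖x‖ * (1 - 11 / 10 * h) := by
    refine abs_le_of_sq_le_sq' ?_ (by have := norm_nonneg x; have : 0 ≤ 1 - 11 / 10 * h := by linarith
                                      positivity) |>.2
    have hx : 0 ≤ ‖x‖ ^ 2 := by positivity
    have : (√2 * ‖x‖ * (1 - 11 / 10 * h)) ^ 2 = 2 * ‖x‖ ^ 2 * (1 - 11 / 10 * h) ^ 2 := by
      rw [mul_pow, mul_pow, hs]
    rw [this]
    have a1 : (2 * h - 2 * h ^ 2) * (4 * ‖W x‖ ^ 2 - 4 * ‖x‖ ^ 2) ≤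
        (2 * h - 2 * h ^ 2) * ‖U (W x)‖ ^ 2 :=
      mul_le_mul_of_nonneg_left k4 (by nlinarith)
    have a2 : (1 - 8 * h + 8 * h ^ 2) * ‖W x‖ ^ 2 ≤ (1 - 8 * h + 8 * h ^ 2) * (2 * ‖x‖ ^ 2) :=
      mul_le_mul_of_nonneg_left k3 (by nlinarith)
    nlinarith [mul_nonneg h0 hx, mul_nonneg (mul_nonneg h0 h0) hx,
      mul_nonneg (mul_nonneg h0 (sub_nonneg.2 h1)) hx]
  have k6 : ‖h • W (N x)‖ ≤ h * (√2 * (11 / 10 * ‖x‖)) := by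
    rw [norm_smul, Real.norm_of_nonneg h0]
    gcongr
    exact (hW _).trans (by gcongr; exact hN x)
  rw [e1]
  refine (norm_add_le _ _).trans ((add_le_add k5 k6).trans (le_of_eq ?_))
  ring

theorem exists_sub_apply_eq [FiniteDimensional ℝ E] (f : E →L[ℝ] E)
    (hf : ∀ x, ‖f x‖ ≤ 1 / 2 * ‖x‖) (y : E) : ∃ x, x - f x = y := by
  have hinj : Function.Injective ((LinearMap.id : E →ₗ[ℝ] E) - f.toLinearMap) := by
    rw [← LinearMap.ker_eq_bot, LinearMap.ker_eq_bot']
    intro x hx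
    have h1 : x = f x := by simpa [sub_eq_zero] using hx
    have h2 := hf x
    rw [← h1] at h2
    exact norm_eq_zero.1 (by linarith [norm_nonneg x])
  obtain ⟨x, hx⟩ := (LinearMap.injective_iff_surjective.1 hinj) y
  exact ⟨x, by simpa using hx⟩

/-- The recursion is implicit, since s also enters the growth factor on the right. Bootstrap: s² ≤ 1
gives the crude s ≤ 2ρ, hence s² ≤ σ/4; then the gain hσs dominates ρh(s² + ζ) ≤ ρhσ/2 and hζ =
hρσ/4. -/
theorem le_of_angle_recursion {s ρ σ ζ h : ℝ} (hs1 : s ≤ 1) (hs0 : 0 ≤ s) (h0 : 0 ≤ h)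
    (h1 : h ≤ 1 / 100) (hσ0 : 0 < σ) (hσ : σ ≤ 1) (hρ0 : 0 ≤ ρ) (hρ1 : ρ ≤ 1)
    (hρσ : ρ * σ = 4 * ζ) (hρ : ρ ^ 2 ≤ σ / 16)
    (hrec : (1 + h * σ) * s ≤ ρ * (1 + h * (s ^ 2 + ζ)) + h * ζ) : s ≤ ρ := by
  have hζ : ζ ≤ ρ / 4 := by nlinarith
  have hζσ : ζ ≤ σ / 4 := by nlinarith
  have hζ0 : 0 ≤ ζ := by nlinarith
  have a1 : s ^ 2 ≤ 1 := by nlinarith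
  have a0 : h * σ * s ≥ 0 := by positivity
  have c1 : h * (s ^ 2 + ζ) ≤ 1 / 2 := by nlinarith
  have c2 : ρ * (h * (s ^ 2 + ζ)) ≤ ρ * (1 / 2) := mul_le_mul_of_nonneg_left c1 hρ0
  have c3 : h * ζ ≤ ρ / 4 := by nlinarith
  have a2 : s ≤ 2 * ρ := by nlinarith
  have a3 : s ^ 2 ≤ σ / 4 := by nlinarith
  have c4 : h * (s ^ 2 + ζ) ≤ h * (σ / 2) := mul_le_mul_of_nonneg_left (by linarith) h0
  have c5 : ρ * (h * (s ^ 2 + ζ)) ≤ ρ * (h * (σ / 2)) := mul_le_mul_of_nonneg_left c4 hρ0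
  have c6 : h * ζ = h * (ρ * σ) / 4 := by rw [hρσ]; ring
  have a4 : (1 + h * σ) * s ≤ (1 + h * σ) * ρ := by
    have : 0 ≤ h * (ρ * σ) := by positivity
    nlinarith
  exact le_of_mul_le_mul_left a4 (by positivity)

theorem norm_sq_eq_proj {P : E →L[ℝ] E} (hPP : ∀ x, P (P x) = P x)
    (hPs : ∀ x y, ⟪P x, y⟫ = ⟪x, P y⟫) (x : E) :
    ‖x‖ ^ 2 = ‖P x‖ ^ 2 + ‖x - P x‖ ^ 2 := by
  have h1 : ⟪P x, x - P x⟫ = 0 := by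
    rw [hPs, map_sub, hPP, sub_self, inner_zero_right]
  have h2 : x = P x + (x - P x) := by abel
  conv_lhs => rw [h2]
  rw [norm_add_sq_real, h1]; ring

theorem norm_proj_le {P : E →L[ℝ] E} (hPP : ∀ x, P (P x) = P x)
    (hPs : ∀ x y, ⟪P x, y⟫ = ⟪x, P y⟫) (x : E) : ‖P x‖ ≤ ‖x‖ := by
  have := norm_sq_eq_proj hPP hPs x
  nlinarith [norm_nonneg x, norm_nonneg (P x), sq_nonneg ‖x - P x‖]

set_option maxHeartbeats 1000000 in
/-- The angle between the noise subspace and the orthogonal complement of the signal space stays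
small under one gradient step, and vectors of the noise subspace hardly shrink. -/
theorem noise_subspace_step {U W X Δ P : E →L[ℝ] E} {h σ ε ρ D ζ : ℝ} {x z : E}
    (hUW : ∀ x y, ⟪U x, y⟫ = ⟪x, W y⟫) (hW : ∀ x, ‖W x‖ ≤ √2 * ‖x‖)
    (hPP : ∀ x, P (P x) = P x) (hPs : ∀ x y, ⟪P x, y⟫ = ⟪x, P y⟫)
    (hXP : ∀ x, X (P x) = X x) (hPX : ∀ x, P (X x) = X x) (hX1 : ∀ x, ‖X x‖ ≤ ‖x‖)
    (hXσ : ∀ x, σ * ‖P x‖ ^ 2 ≤ ⟪P x, X (P x)⟫) (hΔ : ∀ x, ‖Δ x‖ ≤ D * ‖x‖)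
    (h0 : 0 < h) (h1 : h ≤ 1 / 100) (hσ0 : 0 < σ) (hσ : σ ≤ 1) (hρ0 : 0 ≤ ρ) (hρ1 : ρ ≤ 1)
    (hρσ : ρ * σ = 4 * ζ) (hρ : ρ ^ 2 ≤ σ / 16) (hε0 : 0 ≤ ε) (hD0 : 0 ≤ D) (hD1 : D ≤ 1 / 2)
    (hζ : 3 * ε + 9 * h + D ≤ ζ) (hxz : x = z - h • (U (W z) - X z + Δ z))
    (hx : ‖W x‖ ≤ ε * ‖x‖) (hPx : ‖P x‖ ≤ ρ * ‖x‖) :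
    ‖P z‖ ≤ ρ * ‖z‖ ∧ ‖x‖ ≤ (1 + h * (ρ ^ 2 + ζ)) * ‖z‖ := by
  have hs : √2 ≤ 3 / 2 := by rw [Real.sqrt_le_left (by norm_num)]; norm_num
  have hW' : ∀ x, ‖W x‖ ≤ 3 / 2 * ‖x‖ := fun x => (hW x).trans (by gcongr)
  have hU' : ∀ x, ‖U x‖ ≤ 3 / 2 * ‖x‖ := norm_apply_le_of_adjoint hUW hW'
  have hPle := norm_proj_le hPP hPs
  rcases eq_or_ne z 0 with rfl | hz
  · simp_all
  have hn : 0 < ‖z‖ := norm_pos_iff.2 hz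
  set Mz := U (W z) - X z + Δ z with hMz
  have hM : ‖Mz‖ ≤ 4 * ‖z‖ := by
    have a1 : ‖U (W z)‖ ≤ 3 / 2 * (3 / 2 * ‖z‖) := (hU' _).trans (by gcongr; exact hW' z)
    have a2 := norm_add_le (U (W z) - X z) (Δ z)
    have a3 := norm_sub_le (U (W z)) (X z)
    nlinarith [hX1 z, hΔ z]
  -- Only X can make the quadratic form of M negative, and X sees only Pz. So the first-order growth
  -- of ‖x‖ is quadratic in the angle.
  have hinner : -(‖P z‖ ^ 2 + D * ‖z‖ ^ 2) ≤ ⟪z, Mz⟫ := by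
    have a1 : ⟪z, U (W z)⟫ = ‖W z‖ ^ 2 := by
      rw [real_inner_comm, hUW, real_inner_self_eq_norm_sq]
    have a2 : ⟪z, X z⟫ ≤ ‖P z‖ ^ 2 := by
      rw [← hPX, ← hPs, ← hXP, sq]
      exact (real_inner_le_norm _ _).trans (by gcongr; exact hX1 _)
    have a3 : -(D * ‖z‖ ^ 2) ≤ ⟪z, Δ z⟫ := by
      have := (abs_le.1 (abs_real_inner_le_norm z (Δ z))).1
      nlinarith [hΔ z]
    rw [hMz, inner_add_right, inner_sub_right, a1]
    nlinarith [sq_nonneg ‖W z‖]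
  have hxsq : ‖x‖ ^ 2 ≤ ‖z‖ ^ 2 + 2 * h * (‖P z‖ ^ 2 + (D + 8 * h) * ‖z‖ ^ 2) := by
    rw [hxz, norm_sub_sq_real, inner_smul_right, norm_smul, mul_pow, Real.norm_eq_abs, sq_abs]
    have : ‖Mz‖ ^ 2 ≤ 16 * ‖z‖ ^ 2 := by nlinarith [norm_nonneg Mz]
    nlinarith [sq_nonneg h]
  set s := ‖P z‖ / ‖z‖ with hsdef
  have hPz : ‖P z‖ = s * ‖z‖ := by rw [hsdef, div_mul_cancel₀ _ hn.ne']
  have hs0 : 0 ≤ s := by positivity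
  have hs1 : s ≤ 1 := by rw [hsdef, div_le_one hn]; exact hPle z
  have hζ0 : 0 ≤ ζ := by nlinarith
  have hxs : ‖x‖ ≤ (1 + h * (s ^ 2 + ζ)) * ‖z‖ := by
    refine abs_le_of_sq_le_sq' ?_ (by positivity) |>.2
    rw [hPz] at hxsq
    have : h * (D + 8 * h) ≤ h * ζ := by gcongr; linarith
    have : h * (D + 8 * h) * ‖z‖ ^ 2 ≤ h * ζ * ‖z‖ ^ 2 := by gcongr
    linarith [sq_nonneg (h * (s ^ 2 + ζ) * ‖z‖)]
  have hζσ : ζ ≤ 1 / 4 := by nlinarith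
  have hx2 : ‖x‖ ≤ 2 * ‖z‖ := by
    refine hxs.trans ?_
    gcongr
    nlinarith
  have hWz : ‖W z‖ ≤ (2 * ε + 6 * h) * ‖z‖ := by
    have a1 : W z = W x + h • W Mz := by rw [hxz]; simp
    have a2 : ‖h • W Mz‖ ≤ h * (3 / 2 * (4 * ‖z‖)) := by
      rw [norm_smul, Real.norm_of_nonneg h0.le]
      gcongr
      exact (hW' _).trans (by gcongr)
    rw [a1]
    refine (norm_add_le _ _).trans ?_
    have a3 : ε * ‖x‖ ≤ ε * (2 * ‖z‖) := by gcongr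
    linarith
  have hmain : (1 + h * σ) * ‖P z‖ ≤ ρ * ‖x‖ + h * ζ * ‖z‖ := by
    -- The X-term is moved to the side of z, where 1 + hX expands the range of P by at least 1 + hσ.
    -- What remains on the right is small because Wz is.
    have b1 : P z + h • X (P z) = P x + h • (P (U (W z)) + P (Δ z)) := by
      rw [hxz, hMz, hXP]
      simp only [map_sub, map_add, map_smul, hPX]; module
    have b2 : (1 + h * σ) * ‖P z‖ ≤ ‖P z + h • X (P z)‖ := by
      rcases (norm_nonneg (P z)).eq_or_lt with h | hp
      · rw [← h]; simp
      refine le_of_mul_le_mul_left ?_ hp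
      refine le_trans ?_ (real_inner_le_norm (P z) (P z + h • X (P z)))
      rw [inner_add_right, inner_smul_right, real_inner_self_eq_norm_sq]
      nlinarith [hXσ z]
    have b3 : ‖P (U (W z)) + P (Δ z)‖ ≤ ζ * ‖z‖ := by
      have c1 := norm_add_le (P (U (W z))) (P (Δ z))
      have c2 := (hPle (U (W z))).trans (hU' (W z))
      have c3 := (hPle (Δ z)).trans (hΔ z)
      have c4 : (3 * ε + 9 * h + D) * ‖z‖ ≤ ζ * ‖z‖ := by gcongr
      linarith
    refine b2.trans ?_
    rw [b1]
    refine (norm_add_le _ _).trans ?_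
    rw [norm_smul, Real.norm_of_nonneg h0.le]
    have b4 : h * ‖P (U (W z)) + P (Δ z)‖ ≤ h * (ζ * ‖z‖) := by gcongr
    linarith
  have hrec : (1 + h * σ) * s ≤ ρ * (1 + h * (s ^ 2 + ζ)) + h * ζ := by
    refine le_of_mul_le_mul_right ?_ hn
    have : ρ * ‖x‖ ≤ ρ * ((1 + h * (s ^ 2 + ζ)) * ‖z‖) := by gcongr
    rw [hPz] at hmain
    linarith
  have hfin := le_of_angle_recursion hs1 hs0 h0.le h1 hσ0 hσ hρ0 hρ1 hρσ hρ hrec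
  refine ⟨by rw [hPz]; gcongr, hxs.trans (by gcongr)⟩

end InnerProduct

end MatrixSensing

/-! ### Growth of the signal part in one step. -/

namespace MatrixSensing

section InnerProduct

variable {E : Type*} [NormedAddCommGroup E] [InnerProductSpace ℝ E]

open scoped RealInnerProductSpace

theorem norm_sub_smul_gram_le {U W : E →L[ℝ] E} {h : ℝ} (hUW : ∀ x y, ⟪U x, y⟫ = ⟪x, W y⟫)
    (hW : ∀ x, ‖W x‖ ≤ √2 * ‖x‖) (h0 : 0 ≤ h) (h1 : h ≤ 1) (u : E) :
    ‖u - h • W (U u)‖ ≤ ‖u‖ := by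
  have := norm_sub_smul_gram_sq_le (h := h) hUW hW u
  have a : 0 ≤ (2 * h - 2 * h ^ 2) * ‖U u‖ ^ 2 := mul_nonneg (by nlinarith) (by positivity)
  exact abs_le_of_sq_le_sq' (by linarith) (norm_nonneg _) |>.2

/-- If the compression `P U Uᵀ P` is at least `l`, then `‖P U Uᵀ y‖²` is controlled by its
quadratic form. -/
theorem norm_sq_compression_le {U W P : E →L[ℝ] E} {l : ℝ} {y : E}
    (hUW : ∀ x y, ⟪U x, y⟫ = ⟪x, W y⟫) (hW : ∀ x, ‖W x‖ ≤ √2 * ‖x‖)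
    (hPP : ∀ x, P (P x) = P x) (hPs : ∀ x y, ⟪P x, y⟫ = ⟪x, P y⟫) (hl : 0 ≤ l)
    (hlow : ∀ x, l * ‖P x‖ ^ 2 ≤ ‖W (P x)‖ ^ 2) (hy : P y = y) :
    ‖P (U (W y))‖ ^ 2 ≤ (2 + 2 * l) * (‖W y‖ ^ 2 - l * ‖y‖ ^ 2) + l ^ 2 * ‖y‖ ^ 2 := by
  set T := P (U (W y)) - l • y with hT
  have hPT : P T = T := by rw [hT, map_sub, map_smul, hPP, hy]
  have e0 : P (U (W y)) = T + l • y := by rw [hT]; abel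
  have e1 : ⟪T, y⟫ = ‖W y‖ ^ 2 - l * ‖y‖ ^ 2 := by
    rw [hT, inner_sub_left, hPs, hy, hUW, inner_smul_left, real_inner_self_eq_norm_sq,
      real_inner_self_eq_norm_sq]
    simp
  have e2 : ⟪W y, W T⟫ = ‖T‖ ^ 2 + l * ⟪T, y⟫ := by
    rw [← hUW, ← hPT, ← hPs, e0, hPT, inner_add_left, inner_smul_left,
      real_inner_self_eq_norm_sq, real_inner_comm]
    simp
  have e3 : ‖W T‖ ^ 2 ≤ 2 * ‖T‖ ^ 2 := by
    have := pow_le_pow_left₀ (norm_nonneg _) (hW T) 2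
    rwa [mul_pow, Real.sq_sqrt (by norm_num)] at this
  -- With G = PUUᵀP − l on the range of P, 0 ≤ G ≤ 2 and T = Gy. Positivity of G at y − T/2 gives
  -- ‖Gy‖² ≤ 2⟨Gy, y⟩ without square roots of operators.
  have e4 := hlow (y - (1 / 2 : ℝ) • T)
  rw [map_sub, map_smul, hPT, hy, map_sub, map_smul, norm_sub_sq_real, norm_sub_sq_real,
    inner_smul_right, inner_smul_right, e2, norm_smul, norm_smul, mul_pow, mul_pow,
    real_inner_comm] at e4
  norm_num at e4
  have e5 : ‖T‖ ^ 2 ≤ 2 * ⟪T, y⟫ := by nlinarith [sq_nonneg ‖T‖]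
  rw [e0, norm_add_sq_real, inner_smul_right, norm_smul, mul_pow, Real.norm_eq_abs, sq_abs, ← e1]
  linarith

/-- For v = (1 − P)UWy one has ‖v‖² = ⟨Wv, Wy⟩. Lifting v to w in the noise subspace, Wv = Ww − WPw
is small: the first term by the noise bound, the second by the angle. -/
theorem norm_compl_compression_le {U W P : E →L[ℝ] E} {ρ ε : ℝ} {y : E}
    (hρ0 : 0 ≤ ρ) (hε0 : 0 ≤ ε)
    (hUW : ∀ x y, ⟪U x, y⟫ = ⟪x, W y⟫) (hW : ∀ x, ‖W x‖ ≤ √2 * ‖x‖)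
    (hPP : ∀ x, P (P x) = P x) (hPs : ∀ x y, ⟪P x, y⟫ = ⟪x, P y⟫)
    (hS : ∀ v, P v = 0 → ∃ w, w - P w = v ∧ ‖P w‖ ≤ 2 * ρ * ‖v‖ ∧ ‖W w‖ ≤ 2 * ε * ‖v‖) :
    ‖U (W y) - P (U (W y))‖ ≤ (2 * ε + 3 * ρ) * ‖W y‖ := by
  have hs : √2 ≤ 3 / 2 := by rw [Real.sqrt_le_left (by norm_num)]; norm_num
  set v := U (W y) - P (U (W y)) with hv
  have hPv : P v = 0 := by rw [hv, map_sub, hPP, sub_self]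
  obtain ⟨w, hw, hw1, hw2⟩ := hS v hPv
  have e1 : ‖v‖ ^ 2 = ⟪W v, W y⟫ := by
    have : ⟪v, P (U (W y))⟫ = 0 := by rw [← hPs, hPv, inner_zero_left]
    rw [← real_inner_self_eq_norm_sq]
    nth_rewrite 2 [hv]
    rw [inner_sub_right, this, sub_zero, real_inner_comm, hUW, real_inner_comm]
  have e2 : W v = W w - W (P w) := by rw [← hw, map_sub]
  have e3 : ‖W v‖ ≤ (2 * ε + 3 * ρ) * ‖v‖ := by
    rw [e2]
    refine (norm_sub_le _ _).trans ?_
    have : ‖W (P w)‖ ≤ 3 / 2 * (2 * ρ * ‖v‖) := (hW _).trans (by gcongr)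
    linarith
  rcases (norm_nonneg v).eq_or_lt with h | h
  · rw [← h] at e3
    rw [← h]
    positivity
  · have := real_inner_le_norm (W v) (W y)
    have h3 : ‖W v‖ * ‖W y‖ ≤ (2 * ε + 3 * ρ) * ‖v‖ * ‖W y‖ := by gcongr
    refine le_of_mul_le_mul_left ?_ h
    nlinarith

/-- To first order the loss is 2h‖UWy‖². Its part outside the range of P is at most ν‖Wy‖²; inside,
`norm_sq_compression_le` bounds it by l²‖y‖² plus a multiple of the excess τ = ‖Wy‖² − l‖y‖². A
vector losing more than the rate l = s² therefore starts with an excess that pays for it. -/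
theorem norm_gram_contraction_ge {U W P : E →L[ℝ] E} {h s ν : ℝ} {y : E}
    (hUW : ∀ x y, ⟪U x, y⟫ = ⟪x, W y⟫) (hW : ∀ x, ‖W x‖ ≤ √2 * ‖x‖)
    (hPP : ∀ x, P (P x) = P x) (hPs : ∀ x y, ⟪P x, y⟫ = ⟪x, P y⟫)
    (hlow : ∀ x, s * ‖P x‖ ≤ ‖W (P x)‖) (hs0 : 0 ≤ s) (hs1 : s ≤ 1)
    (h0 : 0 ≤ h) (h1 : h ≤ 1 / 100) (hν0 : 0 ≤ ν) (hν1 : ν ≤ 1) (hy : P y = y)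
    (hcompl : ‖U (W y) - P (U (W y))‖ ^ 2 ≤ ν * ‖W y‖ ^ 2) :
    s * ‖y‖ * (1 - 6 / 5 * (h * (ν + s ^ 2))) ≤ ‖W y - h • W (U (W y))‖ := by
  have hlow2 : ∀ x, s ^ 2 * ‖P x‖ ^ 2 ≤ ‖W (P x)‖ ^ 2 := fun x => by
    rw [← mul_pow]; exact pow_le_pow_left₀ (by positivity) (hlow x) 2
  have k1 := norm_sq_compression_le hUW hW hPP hPs (sq_nonneg s) hlow2 hy
  have k2 := norm_sq_eq_proj hPP hPs (U (W y))
  have k3 : ‖W y‖ ^ 2 - 2 * h * ‖U (W y)‖ ^ 2 ≤ ‖W y - h • W (U (W y))‖ ^ 2 := by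
    rw [norm_sub_sq_real, inner_smul_right, ← hUW, real_inner_self_eq_norm_sq]
    nlinarith [sq_nonneg ‖h • W (U (W y))‖]
  have k4 := hlow2 y
  rw [hy] at k4
  have hs2 : s ^ 2 ≤ 1 := by nlinarith
  refine abs_le_of_sq_le_sq' ?_ (norm_nonneg _) |>.2
  refine le_trans ?_ k3
  set l := s ^ 2 with hl
  have hl0 : 0 ≤ l := sq_nonneg s
  set τ := ‖W y‖ ^ 2 - l * ‖y‖ ^ 2 with hτ
  have hτ0 : 0 ≤ τ := by linarith
  have e : ‖W y‖ ^ 2 = τ + l * ‖y‖ ^ 2 := by rw [hτ]; ring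
  rw [e] at hcompl ⊢
  have m1 : (s * ‖y‖ * (1 - 6 / 5 * (h * (ν + l)))) ^ 2 =
      l * ‖y‖ ^ 2 * (1 - 6 / 5 * (h * (ν + l))) ^ 2 := by rw [hl]; ring
  have m2 : (1 - 6 / 5 * (h * (ν + l))) ^ 2 ≤ 1 - 2 * (h * (ν + l)) := by
    have : 0 ≤ h * (ν + l) := by positivity
    have : h * (ν + l) ≤ 1 / 50 := by nlinarith
    nlinarith
  have m3 : l * ‖y‖ ^ 2 * (1 - 6 / 5 * (h * (ν + l))) ^ 2 ≤
      l * ‖y‖ ^ 2 * (1 - 2 * (h * (ν + l))) := by gcongr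
  have m4 : 0 ≤ τ * (1 - 2 * (h * (ν + (2 + 2 * l)))) := by
    refine mul_nonneg hτ0 ?_
    nlinarith
  have m5 : h * ‖U (W y)‖ ^ 2 ≤
      h * ((2 + 2 * l) * τ + l ^ 2 * ‖y‖ ^ 2 + ν * (τ + l * ‖y‖ ^ 2)) :=
    mul_le_mul_of_nonneg_left (by linarith) h0
  rw [m1]
  linarith

/-- Here 0.312 = (6/5)(1/100 + 1/4), from ν ≤ σ/100 and s² ≤ σ/4. The remaining 0.688hσ leaves room
for the μ-terms and for products of order h². -/
theorem growth_factor_ge {h σ μ C a : ℝ} (h0 : 0 < h) (h1 : h ≤ 1 / 100) (hσ0 : 0 < σ)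
    (hσ1 : σ ≤ 1) (hμ0 : 0 ≤ μ) (hC0 : 0 ≤ C) (hμ : μ * (1 + C) ≤ σ / 200)
    (ha0 : 0 ≤ a) (ha : a ≤ 312 / 1000 * σ) :
    1 + 13 / 20 * (h * σ) ≤ (1 - h * a) * (1 + h * σ - 2 * (h * μ)) - 2 * h * C * μ := by
  have hCμ : 0 ≤ C * μ := by positivity
  have b1 : h * a * (h * (σ - 2 * μ)) ≤ h * a * (1 / 100) := by
    have : h * (σ - 2 * μ) ≤ 1 / 100 := by nlinarith
    gcongr
  have b2 : h * a ≤ h * (312 / 1000 * σ) := by gcongr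
  have b3 : h * (μ * (1 + C)) ≤ h * (σ / 200) := by gcongr
  nlinarith [mul_pos h0 hσ0]

/-- The signal part grows by the factor `1 + 0.65 h σ` in one gradient step as long as it is below
`√σ / 2`. -/
theorem signal_step [FiniteDimensional ℝ E] {U W X Δ P : E →L[ℝ] E} {h σ ε ρ D s C : ℝ}
    (hUW : ∀ x y, ⟪U x, y⟫ = ⟪x, W y⟫) (hW : ∀ x, ‖W x‖ ≤ √2 * ‖x‖)
    (hPP : ∀ x, P (P x) = P x) (hPs : ∀ x y, ⟪P x, y⟫ = ⟪x, P y⟫)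
    (hPX : ∀ x, P (X x) = X x) (hX1 : ∀ x, ‖X x‖ ≤ ‖x‖)
    (hXσ : ∀ x, σ * ‖P x‖ ^ 2 ≤ ⟪P x, X (P x)⟫) (hΔ : ∀ x, ‖Δ x‖ ≤ D * ‖x‖)
    (h0 : 0 < h) (h1 : h ≤ 1 / 100) (hσ0 : 0 < σ) (hσ : σ ≤ 1) (hρ0 : 0 ≤ ρ) (hρ1 : ρ ≤ 1 / 2)
    (hε0 : 0 ≤ ε) (hD0 : 0 ≤ D) (hD1 : D ≤ 1 / 2)
    (hS : ∀ v, P v = 0 → ∃ w, w - P w = v ∧ ‖P w‖ ≤ 2 * ρ * ‖v‖ ∧ ‖W w‖ ≤ 2 * ε * ‖v‖)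
    (hs0 : 0 < s) (hs : s ^ 2 ≤ σ / 4) (hlow : ∀ x, s * ‖P x‖ ≤ ‖W (P x)‖)
    (hC0 : 0 ≤ C) (hC : ε ≤ C * s) (hν : (2 * ε + 3 * ρ) ^ 2 ≤ σ / 100)
    (hμ : (D + 4 * h) * (1 + C) ≤ σ / 200) (x : E) :
    s * (1 + 13 / 20 * (h * σ)) * ‖P x‖ ≤
      ‖W (P x - h • (U (W (P x)) - X (P x) + Δ (P x)))‖ := by
  have h2s : √2 ≤ 3 / 2 := by rw [Real.sqrt_le_left (by norm_num)]; norm_num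
  obtain ⟨x', hx', rfl⟩ : ∃ x', P x' = x' ∧ P x = x' := ⟨P x, hPP x, rfl⟩
  set x' := P x with hx'def
  have hPle := norm_proj_le hPP hPs
  have hUWb : ∀ n, ‖U (W n)‖ ≤ 2 * ‖n‖ := fun n => by
    have a1 := (norm_apply_le_of_adjoint hUW hW (W n)).trans
      (mul_le_mul_of_nonneg_left (hW n) (Real.sqrt_nonneg 2))
    rwa [← mul_assoc, Real.mul_self_sqrt (by norm_num)] at a1
  -- Choice of n for which x' − hMx' = (1 − hUW)(x' + hn) exactly; n differs from Xx' by m, of size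
  -- D + 4h.
  obtain ⟨n, hn⟩ := exists_sub_apply_eq (h • (U ∘L W)) (fun n => by
    simp only [smul_apply, ContinuousLinearMap.comp_apply, norm_smul,
      Real.norm_of_nonneg h0.le]
    nlinarith [hUWb n, norm_nonneg n]) (X x' - Δ x')
  simp only [smul_apply, ContinuousLinearMap.comp_apply] at hn
  set m := n - X x' with hm
  have hxn0 := norm_nonneg x'
  have hnle : ‖n‖ ≤ 8 / 5 * ‖x'‖ := by
    have e : n = (X x' - Δ x') + h • U (W n) := by rw [← hn]; abel
    have a1 : ‖n‖ ≤ ‖X x'‖ + ‖Δ x'‖ + h * ‖U (W n)‖ := by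
      conv_lhs => rw [e]
      refine (norm_add_le _ _).trans (add_le_add (norm_sub_le _ _) ?_)
      rw [norm_smul, Real.norm_of_nonneg h0.le]
    have a2 : h * ‖U (W n)‖ ≤ 1 / 100 * (2 * ‖n‖) := by gcongr; exact hUWb n
    have a3 : D * ‖x'‖ ≤ 1 / 2 * ‖x'‖ := by gcongr
    linarith [hX1 x', hΔ x']
  set μ := D + 4 * h with hμdef
  have hmle : ‖m‖ ≤ μ * ‖x'‖ := by
    have e : m = h • U (W n) - Δ x' := by
      rw [hm, ← sub_eq_zero, ← sub_eq_zero.2 hn]; abel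
    rw [e]
    refine (norm_sub_le _ _).trans ?_
    rw [norm_smul, Real.norm_of_nonneg h0.le]
    have a2 : h * ‖U (W n)‖ ≤ h * (2 * (8 / 5 * ‖x'‖)) := by
      gcongr; exact (hUWb n).trans (by gcongr)
    have : 0 ≤ h * ‖x'‖ := by positivity
    linarith [hΔ x']
  obtain ⟨w, hw, hw1, hw2⟩ := hS (m - P m) (by rw [map_sub, hPP, sub_self])
  have hmP : ‖m - P m‖ ≤ ‖m‖ := by
    have := norm_sq_eq_proj hPP hPs m
    exact abs_le_of_sq_le_sq' (by nlinarith [sq_nonneg ‖P m‖]) (norm_nonneg _) |>.2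
  have hmP' := hmP.trans hmle
  -- The part of m outside the range of P is replaced by a vector w of the noise subspace, where W
  -- is small; the correction −Pw goes into y.
  set y := x' + h • (X x' + P m - P w) with hy
  have hPy : P y = y := by
    rw [hy]; simp only [map_add, map_sub, map_smul, hPP, hPX, hx']
  have hyw : x' + h • n = y + h • w := by
    have : w = m - P m + P w := by rw [← hw]; abel
    rw [hy, eq_comm]
    nth_rewrite 2 [this]
    rw [hm]; module
  have hstep : W (x' - h • (U (W x') - X x' + Δ x')) =
      (W y - h • W (U (W y))) + h • (W w - h • W (U (W w))) := by
    have e : x' - h • (U (W x') - X x' + Δ x') = (y + h • w) - h • U (W (y + h • w)) := by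
      rw [← hyw]
      simp only [map_add, map_smul]
      have : X x' = n - h • U (W n) + Δ x' := by rw [hn]; abel
      rw [this]; module
    rw [e]; simp only [map_add, map_sub, map_smul]; module
  have hynorm : (1 + h * σ - 2 * (h * μ)) * ‖x'‖ ≤ ‖y‖ := by
    have b1 : (1 + h * σ) * ‖x'‖ ≤ ‖x' + h • X x'‖ := by
      rcases (norm_nonneg x').eq_or_lt with h | hp
      · rw [← h]; simp
      refine le_of_mul_le_mul_left ?_ hp
      refine le_trans ?_ (real_inner_le_norm x' (x' + h • X x'))
      rw [inner_add_right, inner_smul_right, real_inner_self_eq_norm_sq]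
      have := hXσ x'
      rw [hx'] at this
      nlinarith
    have b2 : x' + h • X x' = y - h • (P m - P w) := by rw [hy]; module
    have b3 : ‖h • (P m - P w)‖ ≤ h * (2 * (μ * ‖x'‖)) := by
      rw [norm_smul, Real.norm_of_nonneg h0.le]
      gcongr
      have a1 := norm_sub_le (P m) (P w)
      have a2 := (hPle m).trans hmle
      have a3 : 2 * ρ * ‖m - P m‖ ≤ 1 * (μ * ‖x'‖) := by
        gcongr; linarith
      linarith
    have b4 := norm_sub_le y (h • (P m - P w))
    rw [← b2] at b4
    linarith
  have hWw : ‖W w - h • W (U (W w))‖ ≤ 2 * (C * s) * (μ * ‖x'‖) := by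
    refine (norm_sub_smul_gram_le hUW hW h0.le (by linarith) _).trans (hw2.trans ?_)
    gcongr
  have hcompl := norm_compl_compression_le (y := y) hρ0 hε0 hUW hW hPP hPs hS
  have hcompl2 := pow_le_pow_left₀ (norm_nonneg _) hcompl 2
  rw [mul_pow] at hcompl2
  have hs1 : s ≤ 1 := abs_le_of_sq_le_sq' (by linarith) one_pos.le |>.2
  have hmain := norm_gram_contraction_ge hUW hW hPP hPs hlow hs0.le hs1 h0.le h1
    (sq_nonneg (2 * ε + 3 * ρ)) (by linarith) hPy hcompl2
  set ν := (2 * ε + 3 * ρ) ^ 2 with hνdef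
  have hν0 : 0 ≤ ν := sq_nonneg _
  have hfac := growth_factor_ge (a := 6 / 5 * (ν + s ^ 2)) h0 h1 hσ0 hσ (by positivity) hC0 hμ
    (by positivity) (by linarith)
  have hpos : 0 ≤ 1 - h * (6 / 5 * (ν + s ^ 2)) := by
    have : h * (6 / 5 * (ν + s ^ 2)) ≤ h * 1 := by gcongr; linarith
    linarith
  have t1 : s * ((1 + h * σ - 2 * (h * μ)) * ‖x'‖) * (1 - h * (6 / 5 * (ν + s ^ 2))) ≤
      ‖W y - h • W (U (W y))‖ := by
    refine le_trans (mul_le_mul_of_nonneg_right (mul_le_mul_of_nonneg_left hynorm hs0.le) hpos) ?_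
    refine le_of_eq_of_le ?_ hmain
    ring
  have t2 := norm_sub_le ((W y - h • W (U (W y))) + h • (W w - h • W (U (W w))))
    (h • (W w - h • W (U (W w))))
  rw [add_sub_cancel_right, norm_smul, Real.norm_of_nonneg h0.le] at t2
  rw [hstep]
  have t3 : h * ‖W w - h • W (U (W w))‖ ≤ h * (2 * (C * s) * (μ * ‖x'‖)) := by gcongr
  have t4 : s * ‖x'‖ * (1 + 13 / 20 * (h * σ)) ≤ s * ‖x'‖ *
      ((1 - h * (6 / 5 * (ν + s ^ 2))) * (1 + h * σ - 2 * (h * μ)) - 2 * h * C * μ) := by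
    gcongr
  linarith

end InnerProduct
end MatrixSensing

/-! ### Matrices as operators, and the Frobenius norm. -/

noncomputable section

namespace MatrixSensing

open scoped RealInnerProductSpace

variable {d : ℕ}

/-- The continuous linear map of a square matrix. -/
abbrev op (A : Matrix (Fin d) (Fin d) ℝ) :
    EuclideanSpace ℝ (Fin d) →L[ℝ] EuclideanSpace ℝ (Fin d) :=
  Matrix.toEuclideanCLM (n := Fin d) (𝕜 := ℝ) A

theorem op_mul_apply (A B : Matrix (Fin d) (Fin d) ℝ) (x : EuclideanSpace ℝ (Fin d)) :
    op (A * B) x = op A (op B x) := by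
  simp [op, map_mul]

theorem inner_op_left (A : Matrix (Fin d) (Fin d) ℝ) (x y : EuclideanSpace ℝ (Fin d)) :
    ⟪op A x, y⟫ = ⟪x, op Aᵀ y⟫ := by
  have : op Aᵀ = ContinuousLinearMap.adjoint (op A) := by
    rw [← ContinuousLinearMap.star_eq_adjoint, op, op, ← map_star]; rfl
  rw [this, ContinuousLinearMap.adjoint_inner_right]

/-- A matrix as a vector of the Euclidean space of its entries. -/
def vec (A : Matrix (Fin d) (Fin d) ℝ) : EuclideanSpace ℝ (Fin d × Fin d) :=
  WithLp.toLp 2 fun p => A p.1 p.2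

theorem frobInner_eq_sum (A B : Matrix (Fin d) (Fin d) ℝ) :
    frobInner A B = ∑ i, ∑ j, A i j * B i j := by
  simp only [frobInner, Matrix.trace, Matrix.diag, Matrix.mul_apply, Matrix.transpose_apply]
  exact Finset.sum_comm

theorem frobInner_eq_inner (A B : Matrix (Fin d) (Fin d) ℝ) :
    frobInner A B = ⟪vec A, vec B⟫ := by
  rw [frobInner_eq_sum, vec, vec, PiLp.inner_apply, Fintype.sum_prod_type]
  simp [mul_comm]

theorem vec_add (A B : Matrix (Fin d) (Fin d) ℝ) : vec (A + B) = vec A + vec B := rfl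

theorem vec_sub (A B : Matrix (Fin d) (Fin d) ℝ) : vec (A - B) = vec A - vec B := rfl

theorem vec_smul (a : ℝ) (A : Matrix (Fin d) (Fin d) ℝ) : vec (a • A) = a • vec A := rfl

/-- The Frobenius norm. -/
def fro (A : Matrix (Fin d) (Fin d) ℝ) : ℝ := ‖vec A‖

theorem fro_nonneg (A : Matrix (Fin d) (Fin d) ℝ) : 0 ≤ fro A := norm_nonneg _

theorem fro_sq (A : Matrix (Fin d) (Fin d) ℝ) : fro A ^ 2 = frobSq A := by
  rw [fro, frobSq, frobInner_eq_inner, real_inner_self_eq_norm_sq]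

theorem fro_add_le (A B : Matrix (Fin d) (Fin d) ℝ) : fro (A + B) ≤ fro A + fro B := by
  rw [fro, vec_add]; exact norm_add_le _ _

theorem fro_sub_le (A B : Matrix (Fin d) (Fin d) ℝ) : fro (A - B) ≤ fro A + fro B := by
  rw [fro, vec_sub]; exact norm_sub_le _ _

theorem fro_smul (a : ℝ) (A : Matrix (Fin d) (Fin d) ℝ) : fro (a • A) = |a| * fro A := by
  rw [fro, vec_smul, norm_smul, Real.norm_eq_abs]; rfl

theorem abs_frobInner_le (A B : Matrix (Fin d) (Fin d) ℝ) :
    |frobInner A B| ≤ fro A * fro B := by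
  rw [frobInner_eq_inner]; exact abs_real_inner_le_norm _ _

theorem frobInner_comm (A B : Matrix (Fin d) (Fin d) ℝ) : frobInner A B = frobInner B A := by
  rw [frobInner_eq_inner, frobInner_eq_inner, real_inner_comm]

theorem frobInner_add_left (A B C : Matrix (Fin d) (Fin d) ℝ) :
    frobInner (A + B) C = frobInner A C + frobInner B C := by
  simp only [frobInner_eq_inner, vec_add, inner_add_left]

theorem frobInner_add_right (A B C : Matrix (Fin d) (Fin d) ℝ) :
    frobInner A (B + C) = frobInner A B + frobInner A C := by
  simp only [frobInner_eq_inner, vec_add, inner_add_right]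

theorem frobInner_sub_left (A B C : Matrix (Fin d) (Fin d) ℝ) :
    frobInner (A - B) C = frobInner A C - frobInner B C := by
  simp only [frobInner_eq_inner, vec_sub, inner_sub_left]

theorem frobInner_sub_right (A B C : Matrix (Fin d) (Fin d) ℝ) :
    frobInner A (B - C) = frobInner A B - frobInner A C := by
  simp only [frobInner_eq_inner, vec_sub, inner_sub_right]

theorem frobInner_smul_left (a : ℝ) (B C : Matrix (Fin d) (Fin d) ℝ) :
    frobInner (a • B) C = a * frobInner B C := by
  simp [frobInner_eq_inner, vec_smul, inner_smul_left]

theorem frobInner_smul_right (a : ℝ) (B C : Matrix (Fin d) (Fin d) ℝ) :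
    frobInner B (a • C) = a * frobInner B C := by
  simp [frobInner_eq_inner, vec_smul, inner_smul_right]

theorem frobInner_transpose (A B : Matrix (Fin d) (Fin d) ℝ) :
    frobInner Aᵀ Bᵀ = frobInner A B := by
  rw [frobInner_eq_sum, frobInner_eq_sum, Finset.sum_comm]; rfl

theorem fro_transpose (A : Matrix (Fin d) (Fin d) ℝ) : fro Aᵀ = fro A := by
  have : fro Aᵀ ^ 2 = fro A ^ 2 := by rw [fro_sq, fro_sq, frobSq, frobSq, frobInner_transpose]
  exact (pow_left_inj₀ (fro_nonneg _) (fro_nonneg _) two_ne_zero).1 this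

theorem frobInner_mul_left (A B C : Matrix (Fin d) (Fin d) ℝ) :
    frobInner (A * B) C = frobInner B (Aᵀ * C) := by
  simp only [frobInner, Matrix.transpose_mul, Matrix.mul_assoc]

theorem frobInner_mul_right (A B C : Matrix (Fin d) (Fin d) ℝ) :
    frobInner (A * B) C = frobInner A (C * Bᵀ) := by
  rw [← frobInner_transpose, Matrix.transpose_mul, frobInner_mul_left, ← frobInner_transpose]
  simp [Matrix.transpose_mul]

/-- The `j`-th column of a matrix. -/
def colVec (A : Matrix (Fin d) (Fin d) ℝ) (j : Fin d) : EuclideanSpace ℝ (Fin d) :=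
  WithLp.toLp 2 fun i => A i j

theorem fro_sq_eq_sum_col (A : Matrix (Fin d) (Fin d) ℝ) :
    fro A ^ 2 = ∑ j, ‖colVec A j‖ ^ 2 := by
  rw [fro_sq, frobSq, frobInner_eq_sum, Finset.sum_comm]
  refine Finset.sum_congr rfl fun j _ => ?_
  rw [EuclideanSpace.norm_sq_eq]
  simp [colVec, sq]

theorem colVec_mul (A B : Matrix (Fin d) (Fin d) ℝ) (j : Fin d) :
    colVec (A * B) j = op A (colVec B j) := by
  ext i
  simp [colVec, op, Matrix.mul_apply, Matrix.mulVec, dotProduct]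

/-- Summation over the columns of C. Besides submultiplicativity it also transfers lower bounds on
operators to the Frobenius norm, when B is the larger operator. -/
theorem fro_mul_le_fro_mul {A B C : Matrix (Fin d) (Fin d) ℝ} {b : ℝ} (hb : 0 ≤ b)
    (h : ∀ x, ‖op A x‖ ≤ b * ‖op B x‖) : fro (A * C) ≤ b * fro (B * C) := by
  refine abs_le_of_sq_le_sq' ?_ (mul_nonneg hb (fro_nonneg _)) |>.2
  rw [mul_pow, fro_sq_eq_sum_col, fro_sq_eq_sum_col, Finset.mul_sum]
  refine Finset.sum_le_sum fun j _ => ?_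
  rw [colVec_mul, colVec_mul, ← mul_pow]
  exact pow_le_pow_left₀ (norm_nonneg _) (h _) 2

theorem fro_mul_le {A : Matrix (Fin d) (Fin d) ℝ} {b : ℝ} (hb : 0 ≤ b)
    (h : ∀ x, ‖op A x‖ ≤ b * ‖x‖) (C : Matrix (Fin d) (Fin d) ℝ) :
    fro (A * C) ≤ b * fro C := by
  have := fro_mul_le_fro_mul (A := A) (B := 1) (C := C) hb (by simpa using h)
  rwa [one_mul] at this

theorem norm_op_transpose_le {A : Matrix (Fin d) (Fin d) ℝ} {b : ℝ}
    (h : ∀ x, ‖op A x‖ ≤ b * ‖x‖) (x : EuclideanSpace ℝ (Fin d)) : ‖op Aᵀ x‖ ≤ b * ‖x‖ :=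
  norm_apply_le_of_adjoint (U := op Aᵀ) (W := op A)
    (fun x y => by rw [inner_op_left, Matrix.transpose_transpose]) h x

theorem fro_mul_le' {A : Matrix (Fin d) (Fin d) ℝ} {b : ℝ} (hb : 0 ≤ b)
    (h : ∀ x, ‖op A x‖ ≤ b * ‖x‖) (C : Matrix (Fin d) (Fin d) ℝ) :
    fro (C * A) ≤ b * fro C := by
  rw [← fro_transpose, Matrix.transpose_mul, ← fro_transpose C]
  exact fro_mul_le hb (norm_op_transpose_le h) _

theorem norm_op_le_fro (A : Matrix (Fin d) (Fin d) ℝ) (x : EuclideanSpace ℝ (Fin d)) :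
    ‖op A x‖ ≤ fro A * ‖x‖ := by
  refine abs_le_of_sq_le_sq' ?_ (mul_nonneg (fro_nonneg _) (norm_nonneg _)) |>.2
  rw [mul_pow, fro_sq, frobSq, frobInner_eq_sum, EuclideanSpace.norm_sq_eq,
    EuclideanSpace.norm_sq_eq, Finset.sum_mul]
  refine Finset.sum_le_sum fun i _ => ?_
  simp only [op, Matrix.ofLp_toEuclideanCLM, Matrix.mulVec, dotProduct, Real.norm_eq_abs, sq_abs]
  simpa only [← sq] using Finset.sum_mul_sq_le_sq_mul_sq Finset.univ (fun j => A i j) x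

theorem fro_le_sqrt_dim {A : Matrix (Fin d) (Fin d) ℝ} {b : ℝ} (hb : 0 ≤ b)
    (h : ∀ x, ‖op A x‖ ≤ b * ‖x‖) : fro A ≤ b * √d := by
  have h1 := fro_mul_le hb h 1
  have h2 : fro (1 : Matrix (Fin d) (Fin d) ℝ) = √d := by
    rw [← Real.sqrt_sq (fro_nonneg _), fro_sq]
    simp [frobSq, frobInner, Matrix.trace_one]
  rwa [mul_one, h2] at h1

end MatrixSensing
end

/-! ### The restricted isometry error as a bilinear form. -/

noncomputable section

namespace MatrixSensing

open scoped RealInnerProductSpace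

variable {d : ℕ}

theorem rank_add_le (A B : Matrix (Fin d) (Fin d) ℝ) : (A + B).rank ≤ A.rank + B.rank := by
  rw [Matrix.rank, Matrix.rank, Matrix.rank, Matrix.mulVecLin_add]
  refine (Submodule.finrank_mono (LinearMap.range_add_le _ _)).trans ?_
  exact Submodule.finrank_add_le_finrank_add_finrank _ _

theorem rank_neg_le (A : Matrix (Fin d) (Fin d) ℝ) : (-A).rank ≤ A.rank := by
  have := Matrix.rank_mul_le_right (-1 : Matrix (Fin d) (Fin d) ℝ) A
  rwa [neg_one_mul] at this

theorem rank_smul_le (a : ℝ) (A : Matrix (Fin d) (Fin d) ℝ) : (a • A).rank ≤ A.rank := by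
  have := Matrix.rank_mul_le_right (a • (1 : Matrix (Fin d) (Fin d) ℝ)) A
  rwa [smul_mul_assoc, one_mul] at this

theorem exists_orthogonal_diagonalization {Y : Matrix (Fin d) (Fin d) ℝ} (hY : Y.IsSymm) :
    ∃ (O : Matrix (Fin d) (Fin d) ℝ) (l : Fin d → ℝ), Oᵀ * O = 1 ∧ O * Oᵀ = 1 ∧
      Y = O * Matrix.diagonal l * Oᵀ := by
  have hH : Y.IsHermitian := by
    rw [Matrix.IsHermitian, Matrix.conjTranspose_eq_transpose_of_trivial]; exact hY
  have h1 := Unitary.coe_star_mul_self hH.eigenvectorUnitary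
  have h2 := Unitary.coe_mul_star_self hH.eigenvectorUnitary
  refine ⟨hH.eigenvectorUnitary, hH.eigenvalues, h1, h2, ?_⟩
  conv_lhs => rw [hH.spectral_theorem, Unitary.conjStarAlgAut_apply]
  rfl

theorem rank_conj_diagonal {O : Matrix (Fin d) (Fin d) ℝ} (h1 : Oᵀ * O = 1)
    (l : Fin d → ℝ) :
    (O * Matrix.diagonal l * Oᵀ).rank = (Finset.univ.filter fun i => l i ≠ 0).card := by
  have hdet : IsUnit O.det := by
    rw [isUnit_iff_ne_zero]
    intro h
    have := congrArg Matrix.det h1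
    simp [h] at this
  rw [Matrix.rank_mul_eq_left_of_isUnit_det _ _ (by rwa [Matrix.det_transpose]),
    Matrix.rank_mul_eq_right_of_isUnit_det _ _ hdet, Matrix.rank_diagonal, Fintype.card_subtype]

theorem fro_sq_conj_diagonal {O : Matrix (Fin d) (Fin d) ℝ} (h1 : Oᵀ * O = 1)
    (l : Fin d → ℝ) : fro (O * Matrix.diagonal l * Oᵀ) ^ 2 = ∑ i, l i ^ 2 := by
  rw [fro_sq, frobSq, frobInner_mul_right, Matrix.mul_assoc, Matrix.transpose_transpose, h1,
    mul_one, frobInner_mul_left, ← Matrix.mul_assoc, h1, one_mul, frobInner,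
    Matrix.diagonal_transpose, Matrix.diagonal_mul_diagonal, Matrix.trace_diagonal]
  simp [sq]

theorem isSymm_conj_diagonal (O : Matrix (Fin d) (Fin d) ℝ) (l : Fin d → ℝ) :
    (O * Matrix.diagonal l * Oᵀ).IsSymm := by
  simp [Matrix.IsSymm, Matrix.transpose_mul, Matrix.mul_assoc]

/-- The nonzero eigenvalues are distributed over two diagonal matrices in the same eigenbasis, which
keeps both pieces symmetric and no larger in Frobenius norm. -/
theorem exists_rank_split {Y : Matrix (Fin d) (Fin d) ℝ} (hY : Y.IsSymm) {a b : ℕ}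
    (hr : Y.rank ≤ a + b) : ∃ Y₁ Y₂ : Matrix (Fin d) (Fin d) ℝ, Y = Y₁ + Y₂ ∧ Y₁.IsSymm ∧
      Y₂.IsSymm ∧ Y₁.rank ≤ a ∧ Y₂.rank ≤ b ∧ fro Y₁ ≤ fro Y ∧ fro Y₂ ≤ fro Y := by
  obtain ⟨O, l, h1, -, rfl⟩ := exists_orthogonal_diagonalization hY
  rw [rank_conj_diagonal h1] at hr
  set T := Finset.univ.filter fun i => l i ≠ 0
  obtain ⟨S, hST, hS⟩ := Finset.exists_subset_card_eq (min_le_right a T.card)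
  have hfro : ∀ k : Fin d → ℝ, (∀ i, k i ^ 2 ≤ l i ^ 2) →
      fro (O * Matrix.diagonal k * Oᵀ) ≤ fro (O * Matrix.diagonal l * Oᵀ) := fun k hk => by
    refine abs_le_of_sq_le_sq' ?_ (fro_nonneg _) |>.2
    rw [fro_sq_conj_diagonal h1, fro_sq_conj_diagonal h1]
    exact Finset.sum_le_sum fun i _ => hk i
  refine ⟨O * Matrix.diagonal (fun i => if i ∈ S then l i else 0) * Oᵀ,
    O * Matrix.diagonal (fun i => if i ∈ S then 0 else l i) * Oᵀ, ?_, isSymm_conj_diagonal _ _,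
    isSymm_conj_diagonal _ _, ?_, ?_, hfro _ ?_, hfro _ ?_⟩
  · rw [← Matrix.add_mul, ← Matrix.mul_add, Matrix.diagonal_add]
    congr 3
    ext i
    split_ifs <;> simp
  · rw [rank_conj_diagonal h1]
    refine (Finset.card_le_card (t := S) fun i hi => ?_).trans (by omega)
    by_contra hiS
    simp [hiS] at hi
  · rw [rank_conj_diagonal h1]
    refine (Finset.card_le_card (t := T \ S) fun i hi => ?_).trans ?_
    · by_cases hiS : i ∈ S <;> simp_all [T]
    · rw [Finset.card_sdiff_of_subset hST]; omega
  · intro i; split_ifs <;> simp [sq_nonneg]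
  · intro i; split_ifs <;> simp [sq_nonneg]

/-- The symmetrised operator `Y ↦ (1/m) ∑ᵢ ⟨Aᵢ, Y⟩ Aᵢ` minus the identity. -/
def ripErr {m : ℕ} (A : Fin m → Matrix (Fin d) (Fin d) ℝ) :
    Matrix (Fin d) (Fin d) ℝ →ₗ[ℝ] Matrix (Fin d) (Fin d) ℝ where
  toFun Y := (1 / (m : ℝ)) • ∑ i, frobInner (A i) Y • ((1 / 2 : ℝ) • (A i + (A i)ᵀ)) - Y
  map_add' Y Z := by
    simp only [frobInner_add_right, add_smul, Finset.sum_add_distrib, smul_add]; abel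
  map_smul' a Y := by
    simp only [frobInner_smul_right, mul_smul, ← Finset.smul_sum, smul_sub, RingHom.id_apply]
    rw [smul_comm]

variable {m : ℕ} {A : Fin m → Matrix (Fin d) (Fin d) ℝ} {k : ℕ} {δ : ℝ}

theorem frobInner_sum_left {ι : Type*} (s : Finset ι) (F : ι → Matrix (Fin d) (Fin d) ℝ)
    (Z : Matrix (Fin d) (Fin d) ℝ) :
    frobInner (∑ i ∈ s, F i) Z = ∑ i ∈ s, frobInner (F i) Z := by
  simp [frobInner, Matrix.transpose_sum, Finset.sum_mul, Matrix.trace_sum]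

theorem ripErr_apply (Y : Matrix (Fin d) (Fin d) ℝ) : ripErr A Y =
    (1 / (m : ℝ)) • ∑ i, frobInner (A i) Y • ((1 / 2 : ℝ) • (A i + (A i)ᵀ)) - Y := rfl

theorem frobInner_ripErr (Y : Matrix (Fin d) (Fin d) ℝ) {Z : Matrix (Fin d) (Fin d) ℝ}
    (hZ : Z.IsSymm) : frobInner (ripErr A Y) Z =
      1 / (m : ℝ) * ∑ i, frobInner (A i) Y * frobInner (A i) Z - frobInner Y Z := by
  rw [ripErr_apply, frobInner_sub_left, frobInner_smul_left, frobInner_sum_left]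
  congr 2
  refine Finset.sum_congr rfl fun i _ => ?_
  have : frobInner (A i)ᵀ Z = frobInner (A i) Z := by
    conv_lhs => rw [← hZ, frobInner_transpose]
  rw [frobInner_smul_left, frobInner_smul_left, frobInner_add_left, this]; ring

theorem isSymm_ripErr {Y : Matrix (Fin d) (Fin d) ℝ} (hY : Y.IsSymm) : (ripErr A Y).IsSymm := by
  rw [ripErr_apply, Matrix.IsSymm, Matrix.transpose_sub, hY]
  simp [Matrix.transpose_sum, add_comm]

/-- Polarisation: compare the isometry bounds at Y + Z and Y − Z. -/
theorem RIP.abs_frobInner_ripErr_le_add (hA : RIP A k δ) {Y Z : Matrix (Fin d) (Fin d) ℝ}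
    (hY : Y.IsSymm) (hZ : Z.IsSymm) (hr : Y.rank + Z.rank ≤ k) :
    |frobInner (ripErr A Y) Z| ≤ δ / 2 * (fro Y ^ 2 + fro Z ^ 2) := by
  obtain ⟨p1, p2⟩ := hA (Y + Z) (by simp [Matrix.IsSymm, hY.eq, hZ.eq]) ((rank_add_le _ _).trans hr)
  obtain ⟨q1, q2⟩ := hA (Y - Z) (by simp [Matrix.IsSymm, hY.eq, hZ.eq]) (by
    rw [sub_eq_add_neg]
    exact (rank_add_le _ _).trans ((add_le_add_right (rank_neg_le Z) _).trans hr))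
  have e1 : frobSq (Y + Z) = fro Y ^ 2 + 2 * frobInner Y Z + fro Z ^ 2 := by
    rw [fro_sq, fro_sq, frobSq, frobSq, frobSq, frobInner_add_left, frobInner_add_right,
      frobInner_add_right, frobInner_comm Z Y]; ring
  have e2 : frobSq (Y - Z) = fro Y ^ 2 - 2 * frobInner Y Z + fro Z ^ 2 := by
    rw [fro_sq, fro_sq, frobSq, frobSq, frobSq, frobInner_sub_left, frobInner_sub_right,
      frobInner_sub_right, frobInner_comm Z Y]; ring
  have e3 : ∑ i, frobInner (A i) (Y + Z) ^ 2 - ∑ i, frobInner (A i) (Y - Z) ^ 2 =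
      4 * ∑ i, frobInner (A i) Y * frobInner (A i) Z := by
    rw [← Finset.sum_sub_distrib, Finset.mul_sum]
    refine Finset.sum_congr rfl fun i _ => ?_
    rw [frobInner_add_right, frobInner_sub_right]; ring
  rw [frobInner_ripErr Y hZ, abs_le]
  rw [e1] at p1 p2
  rw [e2] at q1 q2
  have e4 : 1 / (m : ℝ) * ∑ i, frobInner (A i) (Y + Z) ^ 2 -
      1 / (m : ℝ) * ∑ i, frobInner (A i) (Y - Z) ^ 2 =
      4 * (1 / (m : ℝ) * ∑ i, frobInner (A i) Y * frobInner (A i) Z) := by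
    rw [← mul_sub, e3]; ring
  constructor <;> linarith

theorem fro_eq_zero {Y : Matrix (Fin d) (Fin d) ℝ} (h : fro Y = 0) : Y = 0 := by
  have : vec Y = 0 := norm_eq_zero.1 h
  ext i j
  exact congrArg (fun v : EuclideanSpace ℝ (Fin d × Fin d) => v (i, j)) this

theorem RIP.abs_frobInner_ripErr_le (hA : RIP A k δ) {Y Z : Matrix (Fin d) (Fin d) ℝ}
    (hY : Y.IsSymm) (hZ : Z.IsSymm) (hr : Y.rank + Z.rank ≤ k) :
    |frobInner (ripErr A Y) Z| ≤ δ * fro Y * fro Z := by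
  rcases (fro_nonneg Y).eq_or_lt with h | hy
  · rw [← h, fro_eq_zero h.symm]; simp [frobInner]
  rcases (fro_nonneg Z).eq_or_lt with h | hz
  · rw [← h, fro_eq_zero h.symm]; simp [frobInner]
  have h1 := hA.abs_frobInner_ripErr_le_add (Y := (fro Y)⁻¹ • Y) (Z := (fro Z)⁻¹ • Z)
    (hY.smul _) (hZ.smul _) ((add_le_add (rank_smul_le _ _) (rank_smul_le _ _)).trans hr)
  rw [map_smul, frobInner_smul_left, frobInner_smul_right, fro_smul, fro_smul, abs_mul, abs_mul,
    abs_of_pos (inv_pos.2 hy), abs_of_pos (inv_pos.2 hz), inv_mul_cancel₀ hy.ne',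
    inv_mul_cancel₀ hz.ne'] at h1
  rw [← mul_assoc, ← mul_inv, inv_mul_le_iff₀ (by positivity)] at h1
  linarith

theorem fro_vecMulVec (x : EuclideanSpace ℝ (Fin d)) :
    fro (Matrix.vecMulVec x x) = ‖x‖ ^ 2 := by
  refine (pow_left_inj₀ (fro_nonneg _) (sq_nonneg _) two_ne_zero).1 ?_
  rw [fro_sq, frobSq, frobInner_eq_sum, EuclideanSpace.norm_sq_eq, sq, Finset.sum_mul_sum]
  refine Finset.sum_congr rfl fun i _ => Finset.sum_congr rfl fun j _ => ?_
  simp [Matrix.vecMulVec]; ring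

theorem isSymm_vecMulVec (x : EuclideanSpace ℝ (Fin d)) :
    (Matrix.vecMulVec x x : Matrix (Fin d) (Fin d) ℝ).IsSymm := by
  ext i j; simp [Matrix.vecMulVec, mul_comm]

theorem frobInner_vecMulVec (D : Matrix (Fin d) (Fin d) ℝ) (x : EuclideanSpace ℝ (Fin d)) :
    frobInner D (Matrix.vecMulVec x x) = ⟪x, op D x⟫ := by
  rw [frobInner_eq_sum, PiLp.inner_apply]
  refine Finset.sum_congr rfl fun i _ => ?_
  simp [op, Matrix.mulVec, dotProduct, Matrix.vecMulVec, Finset.sum_mul]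
  exact Finset.sum_congr rfl fun j _ => by ring

/-- Pieces of rank p are peeled off one at a time. Testing one of them against xxᵀ needs the
isometry only at rank p + 1, so a low order suffices at the price of the factor n. -/
theorem RIP.abs_ripErr_quadratic_le (hA : RIP A k δ) (hδ : 0 ≤ δ) {p : ℕ} (hp : p + 1 ≤ k)
    (x : EuclideanSpace ℝ (Fin d)) (n : ℕ) :
    ∀ {Y : Matrix (Fin d) (Fin d) ℝ}, Y.IsSymm → Y.rank ≤ n * p →
      |frobInner (ripErr A Y) (Matrix.vecMulVec x x)| ≤ n * δ * fro Y * ‖x‖ ^ 2 := by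
  induction n with
  | zero =>
    intro Y hY hr
    obtain ⟨O, l, h1, -, rfl⟩ := exists_orthogonal_diagonalization hY
    rw [rank_conj_diagonal h1, zero_mul, Nat.le_zero, Finset.card_eq_zero] at hr
    have hl : l = 0 := by
      ext i
      by_contra hi
      exact Finset.notMem_empty i (hr ▸ Finset.mem_filter.2 ⟨Finset.mem_univ i, hi⟩)
    subst hl
    simp [frobInner]
  | succ n ih =>
    intro Y hY hr
    obtain ⟨Y₁, Y₂, rfl, s1, s2, r1, r2, f1, f2⟩ :=
      exists_rank_split hY (a := p) (b := n * p) (by rw [add_mul, one_mul] at hr; omega)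
    have h1 := hA.abs_frobInner_ripErr_le s1 (isSymm_vecMulVec x)
      (le_trans (add_le_add r1 (Matrix.rank_vecMulVec_le _ _)) hp)
    have h2 := ih s2 r2
    rw [fro_vecMulVec] at h1
    rw [map_add, frobInner_add_left]
    refine (abs_add_le _ _).trans ?_
    have g1 : δ * fro Y₁ * ‖x‖ ^ 2 ≤ δ * fro (Y₁ + Y₂) * ‖x‖ ^ 2 := by gcongr
    have g2 : n * δ * fro Y₂ * ‖x‖ ^ 2 ≤ n * δ * fro (Y₁ + Y₂) * ‖x‖ ^ 2 := by gcongr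
    push_cast
    linarith

theorem mul_transpose_eq_sum_vecMulVec (N : Matrix (Fin d) (Fin d) ℝ) :
    N * Nᵀ = ∑ j, Matrix.vecMulVec (colVec N j) (colVec N j) := by
  ext a b
  simp [Matrix.mul_apply, Matrix.sum_apply, Matrix.vecMulVec, colVec]

/-- NNᵀ may have full rank, but it is the sum of the rank one matrices of its columns, whose
Frobenius norms add up to exactly ‖N‖². Order 2 is enough. -/
theorem RIP.abs_ripErr_gram_le (hA : RIP A k δ) (hk : 2 ≤ k)
    (x : EuclideanSpace ℝ (Fin d)) (N : Matrix (Fin d) (Fin d) ℝ) :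
    |frobInner (ripErr A (N * Nᵀ)) (Matrix.vecMulVec x x)| ≤ δ * fro N ^ 2 * ‖x‖ ^ 2 := by
  rw [mul_transpose_eq_sum_vecMulVec, map_sum, frobInner_sum_left, fro_sq_eq_sum_col,
    Finset.mul_sum, Finset.sum_mul]
  refine (Finset.abs_sum_le_sum_abs _ _).trans (Finset.sum_le_sum fun j _ => ?_)
  have := hA.abs_frobInner_ripErr_le (isSymm_vecMulVec (colVec N j)) (isSymm_vecMulVec x)
    (le_trans (add_le_add (Matrix.rank_vecMulVec_le _ _) (Matrix.rank_vecMulVec_le _ _)) hk)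
  rwa [fro_vecMulVec, fro_vecMulVec] at this

theorem norm_op_le_of_quadratic {D : Matrix (Fin d) (Fin d) ℝ} (hD : D.IsSymm) {q : ℝ}
    (h : ∀ x, |⟪x, op D x⟫| ≤ q * ‖x‖ ^ 2) (x : EuclideanSpace ℝ (Fin d)) :
    ‖op D x‖ ≤ q * ‖x‖ := by
  have hsym : ∀ x y, ⟪op D x, y⟫ = ⟪x, op D y⟫ := fun x y => by rw [inner_op_left, hD]
  have hpol : ∀ x y, ⟪x, op D y⟫ ≤ q / 2 * (‖x‖ ^ 2 + ‖y‖ ^ 2) := fun x y => by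
    have a1 := (abs_le.1 (h (x + y))).2
    have a2 := (abs_le.1 (h (x - y))).1
    rw [norm_add_sq_real, map_add, inner_add_left, inner_add_right, inner_add_right] at a1
    rw [norm_sub_sq_real, map_sub, inner_sub_left, inner_sub_right, inner_sub_right] at a2
    have : ⟪y, op D x⟫ = ⟪x, op D y⟫ := by rw [← hsym, real_inner_comm]
    linarith
  rcases eq_or_ne x 0 with rfl | hx
  · simp
  rcases eq_or_ne (op D x) 0 with h0 | h0
  · rw [h0, norm_zero]
    have := (abs_nonneg _).trans (h x)
    have hx' : 0 < ‖x‖ := norm_pos_iff.2 hx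
    nlinarith [this, hx']
  have hx' : 0 < ‖x‖ := norm_pos_iff.2 hx
  have h0' : 0 < ‖op D x‖ := norm_pos_iff.2 h0
  have := hpol ((‖x‖ / ‖op D x‖) • op D x) x
  rw [inner_smul_left, real_inner_self_eq_norm_sq, norm_smul, Real.norm_of_nonneg (by positivity),
    div_mul_cancel₀ _ h0'.ne'] at this
  simp only [conj_trivial] at this
  rw [sq, ← mul_assoc, div_mul_cancel₀ _ h0'.ne'] at this
  nlinarith

end MatrixSensing
end

/-! ### The signal projection and the gradient. -/

noncomputable section

namespace MatrixSensing

open scoped RealInnerProductSpace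

variable {d : ℕ}

/-- `P` is the orthogonal projection onto the range of the symmetric matrix `X` of rank `r`,
on which `X` is at least `σ`. -/
structure IsSignalProj (X P : Matrix (Fin d) (Fin d) ℝ) (σ : ℝ) (r : ℕ) : Prop where
  symm : P.IsSymm
  idem : P * P = P
  symm_signal : X.IsSymm
  signal_mul : X * P = X
  mul_signal : P * X = X
  norm_signal_le : ∀ x, ‖op X x‖ ≤ ‖x‖
  signal_ge : ∀ x, σ * ‖op P x‖ ^ 2 ≤ ⟪op P x, op X (op P x)⟫
  fro_sq_proj : fro P ^ 2 = r
  rank_signal : X.rank = r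
  rank_proj : P.rank = r
  pos : 0 < σ
  le_one : σ ≤ 1
  rank_pos : 0 < r

theorem norm_op_of_orthogonal {O : Matrix (Fin d) (Fin d) ℝ} (h : Oᵀ * O = 1)
    (x : EuclideanSpace ℝ (Fin d)) : ‖op O x‖ = ‖x‖ := by
  refine (pow_left_inj₀ (norm_nonneg _) (norm_nonneg _) two_ne_zero).1 ?_
  rw [← real_inner_self_eq_norm_sq, inner_op_left, ← op_mul_apply, h, ← real_inner_self_eq_norm_sq]
  simp

theorem op_diagonal_apply (l : Fin d → ℝ) (x : EuclideanSpace ℝ (Fin d)) (i : Fin d) :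
    op (Matrix.diagonal l) x i = l i * x i := by
  simp [op, Matrix.mulVec_diagonal]

theorem finrank_range_toEuclideanLin (X : Matrix (Fin d) (Fin d) ℝ) :
    Module.finrank ℝ (LinearMap.range (Matrix.toEuclideanLin X)) = X.rank := by
  rw [Matrix.rank_eq_finrank_range_toLin X (PiLp.basisFun 2 ℝ _) (PiLp.basisFun 2 ℝ _)]
  rfl

/-- A positive eigenvalue l is itself a singular value, as l² is an eigenvalue of XᵀX. Being
positive, it has index below the rank, and singular values decrease. -/
theorem singularValue_le_of_eigenvector {X : Matrix (Fin d) (Fin d) ℝ} (hX : X.IsSymm)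
    {v : EuclideanSpace ℝ (Fin d)} (hv : v ≠ 0) {l : ℝ} (hl : 0 < l) (h : op X v = l • v) :
    (Matrix.toEuclideanLin X).singularValues (X.rank - 1) ≤ l := by
  set T := Matrix.toEuclideanLin X with hT
  have hTv : ∀ x, T x = op X x := fun x => rfl
  have hadj : LinearMap.adjoint T = T := by
    refine (LinearMap.IsSymmetric.adjoint_eq ?_)
    intro x y
    rw [hTv, hTv, inner_op_left, hX]
  have heig : Module.End.HasEigenvalue (LinearMap.adjoint T ∘ₗ T) (l ^ 2) := by
    refine Module.End.hasEigenvalue_of_hasEigenvector (x := v) ⟨?_, hv⟩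
    rw [Module.End.mem_eigenspace_iff, hadj, LinearMap.comp_apply, hTv v, h, map_smul, hTv v, h,
      smul_smul, sq]
  obtain ⟨j, hj⟩ := T.isSymmetric_adjoint_comp_self.exists_eigenvalues_eq rfl heig
  have hj2 : T.singularValues j ^ 2 = l ^ 2 := by
    rw [T.sq_singularValues_fin rfl]; exact_mod_cast hj
  have hj3 : T.singularValues j = l :=
    (pow_left_inj₀ (T.singularValues_nonneg _) hl.le two_ne_zero).1 hj2
  have hlt : (j : ℕ) < X.rank := by
    rw [← finrank_range_toEuclideanLin, ← hT, ← T.singularValues_pos_iff_lt_finrank_range, hj3]; exact hl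
  rw [← hj3]
  exact T.singularValues_antitone (by omega)

theorem exists_isSignalProj {X : Matrix (Fin d) (Fin d) ℝ} {r : ℕ} (hX : X.PosSemidef)
    (hr : X.rank = r) (hnorm : spectralNorm X = 1) :
    ∃ P, IsSignalProj X P (1 / condNumber X r) r := by
  have hsymm : X.IsSymm := by
    have := hX.isHermitian
    rwa [Matrix.IsHermitian, Matrix.conjTranspose_eq_transpose_of_trivial] at this
  have hle : ∀ x, ‖op X x‖ ≤ ‖x‖ := fun x => by
    have := (op X).le_opNorm x
    rwa [show ‖op X‖ = 1 from hnorm, one_mul] at this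
  obtain ⟨O, l, h1, h2, hXO⟩ := exists_orthogonal_diagonalization hsymm
  have hcol : ∀ i, op X (colVec O i) = l i • colVec O i := fun i => by
    rw [← colVec_mul, hXO, Matrix.mul_assoc, h1, mul_one]
    ext j
    simp [colVec, Matrix.mul_diagonal, mul_comm]
  have hcoln : ∀ i, ‖colVec O i‖ = 1 := fun i => by
    have hi : colVec O i = op O (EuclideanSpace.single i 1) := by
      ext j; simp [colVec, op]
    rw [hi, norm_op_of_orthogonal h1]; simp
  have hl0 : ∀ i, 0 ≤ l i := fun i => by
    have a1 : 0 ≤ ⟪colVec O i, op X (colVec O i)⟫ := by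
      rw [Matrix.inner_toEuclideanCLM]
      simpa using hX.dotProduct_mulVec_nonneg (colVec O i)
    rw [hcol, inner_smul_right, real_inner_self_eq_norm_sq, hcoln] at a1
    simpa using a1
  set σ := (Matrix.toEuclideanLin X).singularValues (r - 1) with hσ
  have hσl : ∀ i, l i ≠ 0 → σ ≤ l i := fun i hi => by
    rw [hσ, ← hr]
    refine singularValue_le_of_eigenvector hsymm ?_ (lt_of_le_of_ne (hl0 i) hi.symm) (hcol i)
    rw [← norm_pos_iff, hcoln]; exact one_pos
  have hcard : (Finset.univ.filter fun i => l i ≠ 0).card = r := by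
    rw [← hr, hXO, rank_conj_diagonal h1]
  have hrpos : 0 < r := by
    rw [← hcard, Finset.card_pos]
    by_contra hne
    have hl : l = 0 := by
      ext i
      by_contra hi
      exact hne ⟨i, Finset.mem_filter.2 ⟨Finset.mem_univ i, hi⟩⟩
    rw [hXO, hl] at hnorm
    simp [spectralNorm] at hnorm
  have hσpos : 0 < σ := by
    rw [hσ, LinearMap.singularValues_pos_iff_lt_finrank_range, finrank_range_toEuclideanLin, hr]
    omega
  have hinv : 1 / condNumber X r = σ := by rw [condNumber, one_div_one_div]
  rw [hinv]
  set k : Fin d → ℝ := fun i => if l i ≠ 0 then 1 else 0 with hk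
  have hkk : (fun i => k i * k i) = k := by ext i; simp [hk]
  have hlk : (fun i => l i * k i) = l := by ext i; by_cases h : l i = 0 <;> simp [hk, h]
  have hkl : (fun i => k i * l i) = l := by ext i; by_cases h : l i = 0 <;> simp [hk, h]
  have hXO' : X * O = O * Matrix.diagonal l := by rw [hXO, Matrix.mul_assoc, h1, mul_one]
  have hcomp : ∀ a b : Fin d → ℝ, (O * Matrix.diagonal a * Oᵀ) * (O * Matrix.diagonal b * Oᵀ) =
      O * Matrix.diagonal (fun i => a i * b i) * Oᵀ := fun a b => by
    rw [← Matrix.diagonal_mul_diagonal]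
    calc _ = O * Matrix.diagonal a * (Oᵀ * O) * Matrix.diagonal b * Oᵀ := by
          simp only [Matrix.mul_assoc]
      _ = _ := by rw [h1, mul_one]; simp only [Matrix.mul_assoc]
  have hkcard : (Finset.univ.filter fun i => k i ≠ 0).card = r := by
    rw [← hcard]; congr 1; ext i; simp [hk]
  refine ⟨O * Matrix.diagonal k * Oᵀ, isSymm_conj_diagonal _ _, by rw [hcomp, hkk], hsymm,
    by rw [hXO, hcomp, hlk], by rw [hXO, hcomp, hkl], hle, ?_, ?_, hr,
    by rw [rank_conj_diagonal h1, hkcard], hσpos, ?_, hrpos⟩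
  · intro x
    set z := op (Matrix.diagonal k) (op Oᵀ x) with hz
    have e1 : op (O * Matrix.diagonal k * Oᵀ) x = op O z := by
      rw [op_mul_apply, op_mul_apply]
    have e2 : op X (op O z) = op O (op (Matrix.diagonal l) z) := by
      rw [← op_mul_apply X O, hXO', op_mul_apply]
    have hzi : ∀ i, z i = k i * op Oᵀ x i := fun i => by rw [hz, op_diagonal_apply]
    clear_value z
    rw [e1, e2, norm_op_of_orthogonal h1, inner_op_left, ← op_mul_apply, h1,
      EuclideanSpace.norm_sq_eq, Finset.mul_sum, PiLp.inner_apply]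
    refine Finset.sum_le_sum fun i _ => ?_
    rw [show op 1 (op (Matrix.diagonal l) z) = op (Matrix.diagonal l) z by simp [op],
      op_diagonal_apply, hzi]
    by_cases hi : l i = 0
    · simp [hk, hi]
    · have := hσl i hi
      simp only [hk, hi, ne_eq, not_false_eq_true, if_true, one_mul, Real.norm_eq_abs, sq_abs,
        RCLike.inner_apply, conj_trivial]
      nlinarith [sq_nonneg (op Oᵀ x i)]
  · rw [fro_sq_conj_diagonal h1, ← hcard]
    simp [hk, Finset.sum_ite]
  · obtain ⟨i, hi⟩ := Finset.card_pos.1 (hcard ▸ hrpos)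
    have hi' := (Finset.mem_filter.1 hi).2
    refine (hσl i hi').trans ?_
    have := hle (colVec O i)
    rwa [hcol, norm_smul, hcoln, mul_one, Real.norm_of_nonneg (hl0 i)] at this

theorem frobInner_single (N : Matrix (Fin d) (Fin d) ℝ) (i j : Fin d) :
    frobInner N (Matrix.single i j 1) = N i j := by
  simp [frobInner_eq_sum, Matrix.single_apply, ite_and]

/-- Along U + tS each term of the loss is the square of a quadratic polynomial in t. The linear
coefficient contains Aᵢ + Aᵢᵀ, which is why `ripErr` is built from symmetrised measurements. -/
theorem grad_loss {m : ℕ} (A : Fin m → Matrix (Fin d) (Fin d) ℝ)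
    (X U : Matrix (Fin d) (Fin d) ℝ) :
    grad (loss A fun i => frobInner (A i) X) U =
      (2 : ℝ) • ((U * Uᵀ - X + ripErr A (U * Uᵀ - X)) * U) := by
  set R := U * Uᵀ - X with hR
  ext a b
  set S := Matrix.single a b (1 : ℝ) with hS
  have hfun : (fun t : ℝ => loss A (fun i => frobInner (A i) X) (U + t • S)) = fun t =>
      1 / (2 * (m : ℝ)) * ∑ i, (-(frobInner (A i) R) - t * frobInner ((A i + (A i)ᵀ) * U) S -
        t ^ 2 * frobInner (A i) (S * Sᵀ)) ^ 2 := by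
    ext t
    simp only [loss]
    congr 1
    refine Finset.sum_congr rfl fun i _ => ?_
    congr 1
    have e1 : (U + t • S) * (U + t • S)ᵀ = R + X + t • (S * Uᵀ) + t • (U * Sᵀ) +
        t ^ 2 • (S * Sᵀ) := by
      rw [hR, Matrix.transpose_add, Matrix.transpose_smul, Matrix.add_mul, Matrix.mul_add,
        Matrix.mul_add, Matrix.smul_mul, Matrix.mul_smul, Matrix.mul_smul, Matrix.smul_mul,
        smul_smul, sq]
      abel
    have e2 : frobInner (A i) (S * Uᵀ) = frobInner (A i * U) S := by
      rw [frobInner_mul_right]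
    have e3 : frobInner (A i) (U * Sᵀ) = frobInner ((A i)ᵀ * U) S := by
      rw [← frobInner_transpose, Matrix.transpose_mul, Matrix.transpose_transpose,
        frobInner_mul_right]
    rw [e1, frobInner_add_right, frobInner_add_right, frobInner_add_right, frobInner_add_right,
      frobInner_smul_right, frobInner_smul_right, frobInner_smul_right, e2, e3, Matrix.add_mul,
      frobInner_add_left]
    ring
  have hder : lineDeriv ℝ (loss A fun i => frobInner (A i) X) U S =
      1 / (2 * (m : ℝ)) * ∑ i, 2 * (frobInner (A i) R * frobInner ((A i + (A i)ᵀ) * U) S) := by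
    rw [lineDeriv, hfun]
    refine HasDerivAt.deriv ?_
    refine HasDerivAt.const_mul _ (HasDerivAt.fun_sum fun i _ => ?_)
    have h1 : HasDerivAt (fun t : ℝ => -(frobInner (A i) R) -
        t * frobInner ((A i + (A i)ᵀ) * U) S - t ^ 2 * frobInner (A i) (S * Sᵀ))
        (-(1 * frobInner ((A i + (A i)ᵀ) * U) S) - (2 * 0 * frobInner (A i) (S * Sᵀ))) 0 := by
      have := (((hasDerivAt_id (0 : ℝ)).mul_const (frobInner ((A i + (A i)ᵀ) * U) S)).const_sub
        (-(frobInner (A i) R))).fun_sub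
        (((hasDerivAt_pow 2 (0 : ℝ)).mul_const (frobInner (A i) (S * Sᵀ))))
      simpa using this
    refine (h1.pow 2).congr_deriv ?_
    simp; ring
  rw [grad, Matrix.of_apply, hder]
  have hM : R + ripErr A R =
      (1 / (m : ℝ)) • ∑ i, frobInner (A i) R • ((1 / 2 : ℝ) • (A i + (A i)ᵀ)) := by
    rw [ripErr_apply]; abel
  rw [hM, ← frobInner_single ((2 : ℝ) • _) a b, ← hS, frobInner_smul_left, Matrix.smul_mul, frobInner_smul_left,
    Matrix.sum_mul, frobInner_sum_left, Finset.mul_sum, Finset.mul_sum, Finset.mul_sum]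
  refine Finset.sum_congr rfl fun i _ => ?_
  rw [Matrix.smul_mul, Matrix.smul_mul, frobInner_smul_left, frobInner_smul_left]
  rcases eq_or_ne (m : ℝ) 0 with h | h
  · simp [h]
  · field_simp

end MatrixSensing
end

/-! ### From the noise subspace to a decomposition of the iterate. -/

noncomputable section

namespace MatrixSensing

open scoped RealInnerProductSpace

variable {d : ℕ}

/-- On S the projection P at least halves norms, so 1 − P is injective from S into ker P, and
bijective by dimension. -/
theorem exists_linear_lift {E : Type*} [NormedAddCommGroup E] [InnerProductSpace ℝ E]
    [FiniteDimensional ℝ E] (P : E →ₗ[ℝ] E) (hPP : ∀ x, P (P x) = P x) (S : Submodule ℝ E)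
    (hdim : Module.finrank ℝ S = Module.finrank ℝ (LinearMap.ker P)) {ρ : ℝ} (hρ : ρ ≤ 1 / 2)
    (hS : ∀ x ∈ S, ‖P x‖ ≤ ρ * ‖x‖) :
    ∃ g : E →ₗ[ℝ] E, ∀ x, g x ∈ S ∧ g x - P (g x) = x - P x := by
  have hker : ∀ x : E, ((LinearMap.id : E →ₗ[ℝ] E) - P) x ∈ LinearMap.ker P := fun x => by simp [hPP]
  have hinj : Function.Injective
      ((LinearMap.codRestrict (LinearMap.ker P) ((LinearMap.id : E →ₗ[ℝ] E) - P) hker) ∘ₗ S.subtype) := by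
    rw [← LinearMap.ker_eq_bot, LinearMap.ker_eq_bot']
    intro s hs
    have h1 : (s : E) - P s = 0 := congrArg Subtype.val hs
    have h2 := hS s s.2
    rw [← sub_eq_zero.1 h1] at h2
    have h3 : ‖(s : E)‖ = 0 := by nlinarith [norm_nonneg (s : E)]
    exact Subtype.ext (norm_eq_zero.1 h3)
  have hsurj := (LinearMap.injective_iff_surjective_of_finrank_eq_finrank hdim).1 hinj
  obtain ⟨g, hg⟩ := LinearMap.exists_rightInverse_of_surjective _ (LinearMap.range_eq_top.2 hsurj)
  refine ⟨S.subtype ∘ₗ g ∘ₗ LinearMap.codRestrict (LinearMap.ker P) ((LinearMap.id : E →ₗ[ℝ] E) - P) hker,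
    fun x => ⟨(g _).2, ?_⟩⟩
  exact congrArg Subtype.val
    (LinearMap.congr_fun hg (LinearMap.codRestrict (LinearMap.ker P) ((LinearMap.id : E →ₗ[ℝ] E) - P) hker x))

/-- A subspace of the dimension of `ker P` that is almost orthogonal to the range of `P` and on
which `Uᵀ` is at most `ε`. -/
def NoiseBound (P U : Matrix (Fin d) (Fin d) ℝ) (ρ ε : ℝ) : Prop :=
  ∃ S : Submodule ℝ (EuclideanSpace ℝ (Fin d)),
    Module.finrank ℝ S = Module.finrank ℝ (LinearMap.ker (op P).toLinearMap) ∧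
      ∀ x ∈ S, ‖op P x‖ ≤ ρ * ‖x‖ ∧ ‖op Uᵀ x‖ ≤ ε * ‖x‖

theorem IsSignalProj.op_idem {X P : Matrix (Fin d) (Fin d) ℝ} {σ : ℝ} {r : ℕ}
    (hP : IsSignalProj X P σ r) (x : EuclideanSpace ℝ (Fin d)) : op P (op P x) = op P x := by
  rw [← op_mul_apply, hP.idem]

theorem IsSignalProj.op_symm {X P : Matrix (Fin d) (Fin d) ℝ} {σ : ℝ} {r : ℕ}
    (hP : IsSignalProj X P σ r) (x y : EuclideanSpace ℝ (Fin d)) :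
    ⟪op P x, y⟫ = ⟪x, op P y⟫ := by
  rw [inner_op_left, hP.symm]

theorem exists_toEuclideanCLM_eq (f : EuclideanSpace ℝ (Fin d) →ₗ[ℝ] EuclideanSpace ℝ (Fin d)) :
    ∃ G : Matrix (Fin d) (Fin d) ℝ, ∀ x, op G x = f x := by
  refine ⟨(Matrix.toEuclideanCLM (n := Fin d) (𝕜 := ℝ)).symm (LinearMap.toContinuousLinearMap f),
    fun x => ?_⟩
  rw [op, StarAlgEquiv.apply_symm_apply]; rfl

section

variable {X P U : Matrix (Fin d) (Fin d) ℝ} {σ ρ ε : ℝ} {r : ℕ}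

theorem NoiseBound.exists_lift (hP : IsSignalProj X P σ r) (hN : NoiseBound P U ρ ε)
    (hρ0 : 0 ≤ ρ) (hε0 : 0 ≤ ε) (hρ : ρ ≤ 1 / 2) :
    ∃ G : Matrix (Fin d) (Fin d) ℝ, ∀ x, op G x - op P (op G x) = x - op P x ∧
      ‖op P (op G x)‖ ≤ 2 * ρ * ‖x - op P x‖ ∧ ‖op Uᵀ (op G x)‖ ≤ 2 * ε * ‖x - op P x‖ := by
  obtain ⟨S, hdim, hS⟩ := hN
  obtain ⟨g, hg⟩ := exists_linear_lift (op P).toLinearMap hP.op_idem S hdim hρ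
    fun x hx => (hS x hx).1
  obtain ⟨G, hG⟩ := exists_toEuclideanCLM_eq g
  refine ⟨G, fun x => ?_⟩
  obtain ⟨hgS, h1⟩ := hg x
  rw [← hG x] at h1 hgS
  obtain ⟨b1, b2⟩ := hS _ hgS
  have hle : ‖op G x‖ ≤ 2 * ‖x - op P x‖ := by
    have h2 := norm_sub_norm_le (op G x) (op P (op G x))
    rw [show op G x - op P (op G x) = x - op P x from h1] at h2
    have : ρ * ‖op G x‖ ≤ 1 / 2 * ‖op G x‖ := by gcongr
    linarith
  refine ⟨h1, b1.trans ?_, b2.trans ?_⟩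
  · calc ρ * ‖op G x‖ ≤ ρ * (2 * ‖x - op P x‖) := by gcongr
      _ = _ := by ring
  · calc ε * ‖op G x‖ ≤ ε * (2 * ‖x - op P x‖) := by gcongr
      _ = _ := by ring

theorem norm_op_compl_le (hP : IsSignalProj X P σ r) (x : EuclideanSpace ℝ (Fin d)) :
    ‖x - op P x‖ ≤ ‖x‖ := by
  have := norm_sq_eq_proj hP.op_idem hP.op_symm x
  exact abs_le_of_sq_le_sq' (by nlinarith [sq_nonneg ‖op P x‖]) (norm_nonneg _) |>.2

theorem norm_op_proj_le (hP : IsSignalProj X P σ r) (x : EuclideanSpace ℝ (Fin d)) :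
    ‖op P x‖ ≤ 1 * ‖x‖ := by
  rw [one_mul]; exact norm_proj_le hP.op_idem hP.op_symm x

theorem matrix_ext_op {M N : Matrix (Fin d) (Fin d) ℝ} (h : ∀ x, op M x = op N x) : M = N :=
  (Matrix.toEuclideanCLM (n := Fin d) (𝕜 := ℝ)).injective (ContinuousLinearMap.ext h)

theorem op_sub_apply (M N : Matrix (Fin d) (Fin d) ℝ) (x : EuclideanSpace ℝ (Fin d)) :
    op (M - N) x = op M x - op N x := by simp [op]

theorem op_add_apply (M N : Matrix (Fin d) (Fin d) ℝ) (x : EuclideanSpace ℝ (Fin d)) :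
    op (M + N) x = op M x + op N x := by simp [op]

theorem op_smul_apply (a : ℝ) (M : Matrix (Fin d) (Fin d) ℝ) (x : EuclideanSpace ℝ (Fin d)) :
    op (a • M) x = a • op M x := by simp [op]

/-- The noise part of `U` is a small multiple of the signal part plus a small matrix. -/
theorem NoiseBound.exists_decomposition (hP : IsSignalProj X P σ r) (hN : NoiseBound P U ρ ε)
    (hρ0 : 0 ≤ ρ) (hε0 : 0 ≤ ε) (hρ : ρ ≤ 1 / 2) :
    ∃ Θ e : Matrix (Fin d) (Fin d) ℝ, U - P * U = Θ * (P * U) + e ∧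
      (∀ x, ‖op Θ x‖ ≤ 2 * ρ * ‖x‖) ∧ ∀ x, ‖op e x‖ ≤ 2 * ε * ‖x‖ := by
  obtain ⟨G, hG⟩ := hN.exists_lift hP hρ0 hε0 hρ
  have h1 : G - P * G = 1 - P := matrix_ext_op fun x => by
    rw [op_sub_apply, op_mul_apply, (hG x).1, op_sub_apply]; simp [op]
  have h2 : Gᵀ - Gᵀ * P = 1 - P := by
    have := congrArg Matrix.transpose h1
    simpa [hP.symm.eq] using this
  have hPG : ∀ x, ‖op (P * G) x‖ ≤ 2 * ρ * ‖x‖ := fun x => by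
    rw [op_mul_apply]
    exact (hG x).2.1.trans (mul_le_mul_of_nonneg_left (norm_op_compl_le hP x) (by positivity))
  have hUG : ∀ x, ‖op (Uᵀ * G) x‖ ≤ 2 * ε * ‖x‖ := fun x => by
    rw [op_mul_apply]
    exact (hG x).2.2.trans (mul_le_mul_of_nonneg_left (norm_op_compl_le hP x) (by positivity))
  -- Transposing (1 − P)G = 1 − P gives (1 − P)U = GᵀU − GᵀPU. The first term is small because UᵀG
  -- is (noise), the factor GᵀP because PG is (angle).
  refine ⟨-(Gᵀ * P), Gᵀ * U, ?_, fun x => ?_, fun x => ?_⟩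
  · have : (1 - P) * U = (Gᵀ - Gᵀ * P) * U := by rw [h2]
    rw [Matrix.sub_mul, one_mul, Matrix.sub_mul] at this
    rw [this, Matrix.neg_mul, Matrix.mul_assoc Gᵀ P (P * U), ← Matrix.mul_assoc P P U, hP.idem,
      ← Matrix.mul_assoc Gᵀ P U]
    abel
  · have := norm_op_transpose_le hPG x
    rw [Matrix.transpose_mul, hP.symm.eq] at this
    simpa [op, map_neg] using this
  · have := norm_op_transpose_le hUG x
    rwa [Matrix.transpose_mul, Matrix.transpose_transpose] at this

end

/-! ### Estimates for the residual at a fixed iterate. -/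

section Static

variable {X P U Θ e : Matrix (Fin d) (Fin d) ℝ} {σ ρ ε : ℝ} {r : ℕ}

theorem fro_signal_le (hP : IsSignalProj X P σ r) : fro X ≤ √r := by
  have h1 : fro P = √r := by rw [← hP.fro_sq_proj, Real.sqrt_sq (fro_nonneg _)]
  have := fro_mul_le zero_le_one (fun x => by rw [one_mul]; exact hP.norm_signal_le x) P
  rwa [hP.signal_mul, h1, one_mul] at this

theorem norm_op_le_sqrt_two (hU : ∀ x, ‖op Uᵀ x‖ ≤ √2 * ‖x‖) (x : EuclideanSpace ℝ (Fin d)) :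
    ‖op U x‖ ≤ √2 * ‖x‖ := by
  have := norm_op_transpose_le hU x
  rwa [Matrix.transpose_transpose] at this

theorem fro_proj_mul_le (hP : IsSignalProj X P σ r) (hU : ∀ x, ‖op Uᵀ x‖ ≤ √2 * ‖x‖) :
    fro (P * U) ≤ √2 * √r := by
  have h1 : fro P = √r := by rw [← hP.fro_sq_proj, Real.sqrt_sq (fro_nonneg _)]
  rw [← h1]
  exact fro_mul_le' (Real.sqrt_nonneg _) (norm_op_le_sqrt_two hU) P

theorem one_le_sqrt_rank (hP : IsSignalProj X P σ r) : 1 ≤ √r :=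
  Real.one_le_sqrt.2 (by exact_mod_cast hP.rank_pos)

/-- The point is a bound in √r rather than √d: PU and ΘPU live on rank r, and only the tiny e pays
for the full dimension. -/
theorem fro_factor_le (hP : IsSignalProj X P σ r) (hU : ∀ x, ‖op Uᵀ x‖ ≤ √2 * ‖x‖)
    (hdec : U - P * U = Θ * (P * U) + e) (hΘ : ∀ x, ‖op Θ x‖ ≤ ρ * ‖x‖)
    (he : ∀ x, ‖op e x‖ ≤ ε * ‖x‖) (hρ0 : 0 ≤ ρ) (hε0 : 0 ≤ ε) (hρ : ρ ≤ 1 / 10)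
    (hε : ε * √d ≤ 1 / 10) : fro U ≤ 2 * √r := by
  have h2 : √2 ≤ 3 / 2 := by rw [Real.sqrt_le_left (by norm_num)]; norm_num
  have e1 : U = P * U + (Θ * (P * U) + e) := by rw [← hdec]; abel
  have a1 := fro_proj_mul_le hP hU
  have a2 := fro_mul_le hρ0 hΘ (P * U)
  have a3 := (fro_le_sqrt_dim hε0 he).trans hε
  have a4 := fro_add_le (P * U) (Θ * (P * U) + e)
  have a5 := fro_add_le (Θ * (P * U)) e
  rw [← e1] at a4
  have h3 : √2 ≤ 71 / 50 := by rw [Real.sqrt_le_left (by norm_num)]; norm_num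
  have a6 : ρ * fro (P * U) ≤ 1 / 10 * (√2 * √r) := by
    gcongr
    exact fro_nonneg _
  have a7 : √2 * √r ≤ 71 / 50 * √r := by gcongr
  have := one_le_sqrt_rank hP
  linarith

theorem fro_residual_le (hP : IsSignalProj X P σ r) (hU : ∀ x, ‖op Uᵀ x‖ ≤ √2 * ‖x‖)
    (hF : fro U ≤ 2 * √r) : fro (U * Uᵀ - X) ≤ 4 * √r := by
  have h2 : √2 ≤ 3 / 2 := by rw [Real.sqrt_le_left (by norm_num)]; norm_num
  have a1 := fro_sub_le (U * Uᵀ) X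
  have a2 := fro_mul_le' (Real.sqrt_nonneg _) hU U
  have a3 : √2 * fro U ≤ 3 / 2 * (2 * √r) := by gcongr; exact fro_nonneg _
  linarith [fro_signal_le hP]

theorem isSymm_residual (hP : IsSignalProj X P σ r) : (U * Uᵀ - X).IsSymm := by
  simp [Matrix.IsSymm, Matrix.transpose_sub, Matrix.transpose_mul, hP.symm_signal.eq]

/-- The restricted isometry error of the residual in operator norm. -/
theorem norm_ripErr_residual_le {m : ℕ} {A : Fin m → Matrix (Fin d) (Fin d) ℝ} {δ : ℝ}
    (hA : RIP A (max r 2) δ) (hδ : 0 ≤ δ) (hP : IsSignalProj X P σ r)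
    (hdec : U - P * U = Θ * (P * U) + e) (x : EuclideanSpace ℝ (Fin d)) :
    ‖op (ripErr A (U * Uᵀ - X)) x‖ ≤ δ * (6 * fro (U * Uᵀ - X) + 7 * fro e ^ 2) * ‖x‖ := by
  refine norm_op_le_of_quadratic (isSymm_ripErr (isSymm_residual hP)) (fun x => ?_) x
  rw [← frobInner_vecMulVec]
  set Z := (1 + Θ) * (P * U) with hZ
  have hUZ : U = Z + e := by
    rw [hZ, Matrix.add_mul, one_mul, add_assoc, ← hdec]; abel
  have hsplit : U * Uᵀ - X = (U * Uᵀ - X - e * eᵀ) + e * eᵀ := by abel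
  have hfe : fro (e * eᵀ) ≤ fro e ^ 2 := by
    rw [sq]
    have := fro_mul_le (fro_nonneg e) (norm_op_le_fro e) eᵀ
    rwa [fro_transpose] at this
  -- After removal of eeᵀ three terms of rank at most r remain. Pieces of rank max(r, 2) − 1 leave
  -- one rank for the test matrix, and 3r ≤ 6(max(r, 2) − 1), with equality at r = 2.
  have hrank : (U * Uᵀ - X - e * eᵀ).rank ≤ 6 * (max r 2 - 1) := by
    have h1 : U * Uᵀ - X - e * eᵀ = Z * Uᵀ + e * Zᵀ + -X := by
      have : U * Uᵀ = Z * Uᵀ + e * Zᵀ + e * eᵀ := by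
        have h3 : U * Uᵀ = (Z + e) * Uᵀ := by rw [← hUZ]
        have h4 : e * Uᵀ = e * (Z + e)ᵀ := by rw [← hUZ]
        rw [h3, Matrix.add_mul, h4, Matrix.transpose_add, Matrix.mul_add, add_assoc]
      rw [this]; abel
    have hZr : Z.rank ≤ r := by
      rw [hZ, ← hP.rank_proj]
      exact (Matrix.rank_mul_le_right _ _).trans (Matrix.rank_mul_le_left _ _)
    have r1 := (Matrix.rank_mul_le_left Z Uᵀ).trans hZr
    have r2 : (e * Zᵀ).rank ≤ r :=
      (Matrix.rank_mul_le_right _ _).trans (by rw [Matrix.rank_transpose]; exact hZr)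
    have r3 := (rank_neg_le X).trans hP.rank_signal.le
    have r4 := rank_add_le (Z * Uᵀ + e * Zᵀ) (-X)
    have r5 := rank_add_le (Z * Uᵀ) (e * Zᵀ)
    rw [h1]
    have := hP.rank_pos
    omega
  have hsymm : (U * Uᵀ - X - e * eᵀ).IsSymm := by
    simp [Matrix.IsSymm, Matrix.transpose_sub, Matrix.transpose_mul, hP.symm_signal.eq]
  have k1 := hA.abs_ripErr_quadratic_le hδ (p := max r 2 - 1) (by omega) x 6 hsymm hrank
  have k2 := hA.abs_ripErr_gram_le (le_max_right _ _) x e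
  have k3 := fro_sub_le (U * Uᵀ - X) (e * eᵀ)
  have k4 : (6 : ℕ) * δ * fro (U * Uᵀ - X - e * eᵀ) * ‖x‖ ^ 2 ≤
      (6 : ℕ) * δ * (fro (U * Uᵀ - X) + fro e ^ 2) * ‖x‖ ^ 2 := by
    gcongr; linarith
  rw [hsplit, map_add, frobInner_add_left, ← hsplit]
  refine (abs_add_le _ _).trans ?_
  push_cast at *
  linarith

theorem fro_sq_split (hP : IsSignalProj X P σ r) (N : Matrix (Fin d) (Fin d) ℝ) :
    fro N ^ 2 = fro (P * N) ^ 2 + fro (N - P * N) ^ 2 := by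
  rw [fro_sq_eq_sum_col, fro_sq_eq_sum_col, fro_sq_eq_sum_col, ← Finset.sum_add_distrib]
  refine Finset.sum_congr rfl fun j _ => ?_
  rw [colVec_mul, show colVec (N - P * N) j = colVec N j - op P (colVec N j) by
    rw [← colVec_mul]; rfl]
  exact norm_sq_eq_proj hP.op_idem hP.op_symm _

/-- Block decomposition by P and 1 − P: by symmetry the block (1 − P)RP has the norm of PR(1 − P),
which is at most that of PR. -/
theorem fro_sq_residual_le (hP : IsSignalProj X P σ r) {R : Matrix (Fin d) (Fin d) ℝ}
    (hR : R.IsSymm) :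
    fro R ^ 2 ≤ 2 * fro (P * R) ^ 2 + fro ((1 - P) * R * (1 - P)) ^ 2 := by
  have h1 := fro_sq_split hP R
  have h2 := fro_sq_split hP (R - P * R)ᵀ
  have e1 : P * (R - P * R)ᵀ = P * R - P * R * P := by
    simp [Matrix.transpose_sub, Matrix.transpose_mul, hP.symm.eq, hR.eq, Matrix.mul_sub,
      Matrix.mul_assoc]
  have e2 : (R - P * R)ᵀ - P * (R - P * R)ᵀ = ((1 - P) * R * (1 - P))ᵀ := by
    simp only [Matrix.transpose_sub, Matrix.transpose_mul, hP.symm.eq, hR.eq, Matrix.transpose_one]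
    noncomm_ring
  have h3 : fro (P * R - P * R * P) ≤ fro (P * R) := by
    have := fro_sq_split hP (P * R)ᵀ
    have e3 : (P * R)ᵀ - P * (P * R)ᵀ = (P * R - P * R * P)ᵀ := by
      simp [Matrix.transpose_sub, Matrix.transpose_mul, hP.symm.eq]
    rw [e3, fro_transpose, fro_transpose] at this
    exact abs_le_of_sq_le_sq' (by nlinarith [sq_nonneg (fro (P * (P * R)ᵀ))]) (fro_nonneg _) |>.2
  rw [e2, e1, fro_transpose, fro_transpose] at h2
  have h4 := pow_le_pow_left₀ (fro_nonneg _) h3 2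
  linarith

/-- X is absent from this block, which is (1 − P)UUᵀ(1 − P). Substituting the decomposition in the
left factor and using PX(1 − P) = 0 turns the main term into ΘPR(1 − P): an error proportional to
the residual, as contraction requires. -/
theorem fro_compl_residual_le (hP : IsSignalProj X P σ r) (hU : ∀ x, ‖op Uᵀ x‖ ≤ √2 * ‖x‖)
    (hdec : U - P * U = Θ * (P * U) + e) (hΘ : ∀ x, ‖op Θ x‖ ≤ ρ * ‖x‖)
    (he : ∀ x, ‖op e x‖ ≤ ε * ‖x‖) (hρ0 : 0 ≤ ρ) (hε0 : 0 ≤ ε) :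
    fro ((1 - P) * (U * Uᵀ - X) * (1 - P)) ≤
      ρ * fro (U * Uᵀ - X) + 2 * ε * ρ * √r + ε ^ 2 * √d := by
  have h2 : √2 ≤ 2 := by rw [Real.sqrt_le_left (by norm_num)]; norm_num
  set R := U * Uᵀ - X with hR
  have hb : (1 - P) * U = Θ * (P * U) + e := by rw [Matrix.sub_mul, one_mul, hdec]
  have hQX : (1 - P) * X = 0 := by rw [Matrix.sub_mul, one_mul, hP.mul_signal, sub_self]
  have hXQ : X * (1 - P) = 0 := by rw [Matrix.mul_sub, mul_one, hP.signal_mul, sub_self]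
  have hQt : (1 - P)ᵀ = 1 - P := by simp [hP.symm.eq]
  have hbt : Uᵀ * (1 - P) = (Θ * (P * U) + e)ᵀ := by
    rw [← hb, Matrix.transpose_mul, hQt]
  have hmain : (1 - P) * R * (1 - P) = Θ * (P * R * (1 - P)) +
      (e * (P * U)ᵀ * Θᵀ + e * eᵀ) := by
    have e1 : (1 - P) * R * (1 - P) = ((1 - P) * U) * (Uᵀ * (1 - P)) := by
      rw [hR, Matrix.mul_sub _ (U * Uᵀ) X, hQX, sub_zero]; simp only [Matrix.mul_assoc]
    have e2 : P * R * (1 - P) = (P * U) * (Uᵀ * (1 - P)) := by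
      rw [hR, Matrix.mul_sub _ (U * Uᵀ) X, Matrix.sub_mul, Matrix.mul_assoc P X, hXQ, mul_zero, sub_zero]
      simp only [Matrix.mul_assoc]
    rw [e1, e2, hb, Matrix.add_mul, hbt, Matrix.transpose_add, Matrix.transpose_mul,
      Matrix.mul_add e]
    simp only [Matrix.mul_assoc]
  have b1 : fro (Θ * (P * R * (1 - P))) ≤ ρ * fro R := by
    refine (fro_mul_le hρ0 hΘ _).trans (mul_le_mul_of_nonneg_left ?_ hρ0)
    have c1 := fro_mul_le' (A := 1 - P) zero_le_one (fun x => by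
      rw [one_mul, op_sub_apply]; simpa [op] using norm_op_compl_le hP x) (P * R)
    have c2 := fro_mul_le zero_le_one (norm_op_proj_le hP) R
    linarith
  have b2 : fro (e * (P * U)ᵀ * Θᵀ) ≤ 2 * ε * ρ * √r := by
    refine (fro_mul_le' hρ0 (norm_op_transpose_le hΘ) _).trans ?_
    have c1 := fro_mul_le hε0 he (P * U)ᵀ
    rw [fro_transpose] at c1
    have c2 : ε * fro (P * U) ≤ ε * (2 * √r) := by
      gcongr; exact (fro_proj_mul_le hP hU).trans (by gcongr)
    have c3 : ρ * fro (e * (P * U)ᵀ) ≤ ρ * (ε * (2 * √r)) := by gcongr; linarith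
    linarith
  have b3 : fro (e * eᵀ) ≤ ε ^ 2 * √d := by
    have c1 := fro_mul_le hε0 he eᵀ
    rw [fro_transpose] at c1
    have c2 : ε * fro e ≤ ε * (ε * √d) := by gcongr; exact fro_le_sqrt_dim hε0 he
    linarith
  rw [hmain]
  have d1 := fro_add_le (Θ * (P * R * (1 - P))) (e * (P * U)ᵀ * Θᵀ + e * eᵀ)
  have d2 := fro_add_le (e * (P * U)ᵀ * Θᵀ) (e * eᵀ)
  linarith

/-- The lower bound on UᵀP gives s‖PR‖ ≤ ‖UᵀPR‖ = ‖RPU‖, and PU = U − ΘPU − e. -/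
theorem mul_fro_proj_residual_le (hP : IsSignalProj X P σ r)
    (hU : ∀ x, ‖op Uᵀ x‖ ≤ √2 * ‖x‖)
    (hdec : U - P * U = Θ * (P * U) + e) (hΘ : ∀ x, ‖op Θ x‖ ≤ ρ * ‖x‖)
    (he : ∀ x, ‖op e x‖ ≤ ε * ‖x‖) (hρ0 : 0 ≤ ρ) (hε0 : 0 ≤ ε) {s : ℝ} (hs : 0 < s)
    (hlow : ∀ x, s * ‖op P x‖ ≤ ‖op Uᵀ (op P x)‖) {R : Matrix (Fin d) (Fin d) ℝ}
    (hR : R.IsSymm) : s * fro (P * R) ≤ fro (R * U) + (2 * ρ + ε) * fro R := by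
  have h2 : √2 ≤ 2 := by rw [Real.sqrt_le_left (by norm_num)]; norm_num
  have h1 : fro (P * R) ≤ s⁻¹ * fro (Uᵀ * P * R) := by
    refine fro_mul_le_fro_mul (by positivity) fun x => ?_
    rw [le_inv_mul_iff₀ hs, op_mul_apply]
    exact hlow x
  rw [le_inv_mul_iff₀ hs] at h1
  have e1 : fro (Uᵀ * P * R) = fro (R * (P * U)) := by
    rw [← fro_transpose]
    simp [Matrix.transpose_mul, hR.eq, hP.symm.eq]
  have e2 : R * (P * U) = R * U - (R * (Θ * (P * U)) + R * e) := by
    rw [← Matrix.mul_add, ← hdec, Matrix.mul_sub]; abel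
  have hTPU : ∀ x, ‖op (Θ * (P * U)) x‖ ≤ 2 * ρ * ‖x‖ := fun x => by
    rw [op_mul_apply, op_mul_apply]
    have c1 := (norm_op_proj_le hP (op U x)).trans
      (mul_le_mul_of_nonneg_left (norm_op_le_sqrt_two hU x) zero_le_one)
    calc ‖op Θ (op P (op U x))‖ ≤ ρ * (1 * (√2 * ‖x‖)) := (hΘ _).trans (by gcongr)
      _ ≤ ρ * (1 * (2 * ‖x‖)) := by gcongr
      _ = _ := by ring
  have b1 := fro_mul_le' (by positivity) hTPU R
  have b2 := fro_mul_le' hε0 he R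
  have b3 := fro_sub_le (R * U) (R * (Θ * (P * U)) + R * e)
  have b4 := fro_add_le (R * (Θ * (P * U))) (R * e)
  rw [← e2] at b3
  linarith

end Static

/-! ### Decrease of the residual in one step. -/

theorem fro_sub_smul_sq (R Q : Matrix (Fin d) (Fin d) ℝ) (h : ℝ) :
    fro (R - h • Q) ^ 2 = fro R ^ 2 - 2 * h * frobInner R Q + h ^ 2 * fro Q ^ 2 := by
  rw [fro_sq, fro_sq, fro_sq, frobSq, frobSq, frobSq, frobInner_sub_left, frobInner_sub_right,
    frobInner_sub_right, frobInner_smul_left, frobInner_smul_left, frobInner_smul_right,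
    frobInner_smul_right, frobInner_comm Q R]
  ring

/-- Decrease of the squared residual in one gradient step. -/
theorem fro_sq_residual_step {X U Δ : Matrix (Fin d) (Fin d) ℝ} {h D ρ : ℝ}
    (hX : X.IsSymm) (hΔs : Δ.IsSymm) (hX1 : ∀ x, ‖op X x‖ ≤ ‖x‖)
    (hU : ∀ x, ‖op Uᵀ x‖ ≤ √2 * ‖x‖) (hΔ : ∀ x, ‖op Δ x‖ ≤ D * ‖x‖) (hD0 : 0 ≤ D)
    (hD1 : D ≤ 1) (h0 : 0 < h) (h1 : h ≤ 1 / 100) (hF : fro U ≤ 2 * ρ) :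
    fro ((U - h • ((U * Uᵀ - X + Δ) * U)) * (U - h • ((U * Uᵀ - X + Δ) * U))ᵀ - X) ^ 2 ≤
      fro (U * Uᵀ - X) ^ 2 - 2 * h * fro ((U * Uᵀ - X) * U) ^ 2 + 20 * h * ρ ^ 2 * D ^ 2 := by
  set R := U * Uᵀ - X with hR
  set M := R + Δ with hM
  have hRs : Rᵀ = R := by rw [hR]; simp [Matrix.transpose_sub, Matrix.transpose_mul, hX.eq]
  have hMs : Mᵀ = M := by rw [hM, Matrix.transpose_add, hRs, hΔs]
  have h2 : √2 ≤ 3 / 2 := by rw [Real.sqrt_le_left (by norm_num)]; norm_num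
  have hU' : ∀ x, ‖op Uᵀ x‖ ≤ 3 / 2 * ‖x‖ := fun x => (hU x).trans (by gcongr)
  have hUU : ∀ x, ‖op (U * Uᵀ) x‖ ≤ 2 * ‖x‖ := fun x => by
    rw [op_mul_apply]
    have a1 := (norm_op_le_sqrt_two hU (op Uᵀ x)).trans
      (mul_le_mul_of_nonneg_left (hU x) (Real.sqrt_nonneg 2))
    rwa [← mul_assoc, Real.mul_self_sqrt (by norm_num)] at a1
  have hRop : ∀ x, ‖op R x‖ ≤ 3 * ‖x‖ := fun x => by
    rw [hR, op_sub_apply]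
    linarith [norm_sub_le (op (U * Uᵀ) x) (op X x), hUU x, hX1 x]
  have hMop : ∀ x, ‖op M x‖ ≤ 4 * ‖x‖ := fun x => by
    rw [hM, op_add_apply]
    have : D * ‖x‖ ≤ 1 * ‖x‖ := by gcongr
    linarith [norm_add_le (op R x) (op Δ x), hRop x, hΔ x]
  set Q := M * U * Uᵀ + U * (M * U)ᵀ - h • (M * U * (M * U)ᵀ) with hQ
  have hexp : (U - h • (M * U)) * (U - h • (M * U))ᵀ - X = R - h • Q := by
    rw [hQ, hR, Matrix.transpose_sub, Matrix.transpose_smul, Matrix.sub_mul, Matrix.mul_sub,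
      Matrix.mul_sub, Matrix.smul_mul, Matrix.mul_smul, Matrix.smul_mul, Matrix.mul_smul, smul_sub,
      smul_add]
    abel
  set p := fro (R * U) with hp
  set w := fro (M * U) with hw
  have hp0 : 0 ≤ p := fro_nonneg _
  have hw0 : 0 ≤ w := fro_nonneg _
  have hρ0 : 0 ≤ ρ := by linarith [fro_nonneg U]
  have hsq : fro (R - h • Q) ^ 2 = fro R ^ 2 - 2 * h * frobInner R Q + h ^ 2 * fro Q ^ 2 := by
    exact fro_sub_smul_sq R Q h
  have hDU : fro (Δ * U) ≤ D * (2 * ρ) :=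
    (fro_mul_le hD0 hΔ U).trans (by gcongr)
  have i1 : frobInner R (M * U * Uᵀ) = p ^ 2 + frobInner (R * U) (Δ * U) := by
    rw [← frobInner_mul_right, hM, Matrix.add_mul, frobInner_add_right, hp, fro_sq, frobSq]
  have i2 : frobInner R (U * (M * U)ᵀ) = frobInner R (M * U * Uᵀ) := by
    rw [← frobInner_transpose, hRs, Matrix.transpose_mul, Matrix.transpose_transpose]
  have i3 : frobInner R (M * U * (M * U)ᵀ) ≤ 3 * w ^ 2 := by
    rw [← frobInner_mul_right]
    refine (le_abs_self _).trans ((abs_frobInner_le _ _).trans ?_)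
    have := fro_mul_le (by norm_num) hRop (M * U)
    rw [show 3 * w ^ 2 = 3 * w * w by ring]
    exact mul_le_mul_of_nonneg_right this hw0
  have i4 : -(p * (D * (2 * ρ))) ≤ frobInner (R * U) (Δ * U) := by
    refine neg_le_of_abs_le ((abs_frobInner_le _ _).trans ?_)
    gcongr
  -- The two first-order terms of Q each contribute ‖RU‖². Half of the resulting decrease 4h‖RU‖² is
  -- spent on the Δ and second-order terms.
  have hRQ : 2 * (p ^ 2 - p * (D * (2 * ρ))) - h * (3 * w ^ 2) ≤ frobInner R Q := by
    rw [hQ, frobInner_sub_right, frobInner_add_right, frobInner_smul_right, i2, i1]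
    have := mul_le_mul_of_nonneg_left i3 h0.le
    linarith
  have hQle : fro Q ≤ 4 * w := by
    have a1 := fro_sub_le (M * U * Uᵀ + U * (M * U)ᵀ) (h • (M * U * (M * U)ᵀ))
    have a2 := fro_add_le (M * U * Uᵀ) (U * (M * U)ᵀ)
    have a3 := fro_mul_le' (by norm_num) hU' (M * U)
    have a4 : fro (U * (M * U)ᵀ) = fro (M * U * Uᵀ) := by
      rw [← fro_transpose, Matrix.transpose_mul, Matrix.transpose_transpose]
    have hMU : ∀ x, ‖op (M * U)ᵀ x‖ ≤ 6 * ‖x‖ := fun x => by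
      rw [Matrix.transpose_mul, hMs, op_mul_apply]
      linarith [hU' (op M x), hMop x]
    have a5 := fro_mul_le' (by norm_num) hMU (M * U)
    rw [fro_smul, abs_of_pos h0] at a1
    have a6 : h * fro (M * U * (M * U)ᵀ) ≤ 1 / 100 * (6 * w) := by
      gcongr
      exact fro_nonneg _
    linarith
  have hQsq : fro Q ^ 2 ≤ 16 * w ^ 2 := by nlinarith [fro_nonneg Q]
  have hwle : w ≤ p + D * (2 * ρ) := by
    rw [hw, hM, Matrix.add_mul]
    linarith [fro_add_le (R * U) (Δ * U)]
  set q := D * ρ with hq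
  have hq0 : 0 ≤ q := by positivity
  have hwsq : w ^ 2 ≤ 2 * p ^ 2 + 8 * q ^ 2 := by
    have : w ^ 2 ≤ (p + D * (2 * ρ)) ^ 2 := pow_le_pow_left₀ hw0 hwle 2
    nlinarith [sq_nonneg (p - 2 * q)]
  rw [hexp, hsq]
  have j1 : h ^ 2 * fro Q ^ 2 ≤ h ^ 2 * (16 * w ^ 2) := by gcongr
  have j2 : h * (h * w ^ 2) ≤ h * (1 / 100 * (2 * p ^ 2 + 8 * q ^ 2)) := by gcongr
  have j3 : h * (8 * p * q) ≤ h * (p ^ 2 + 16 * q ^ 2) := by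
    gcongr; nlinarith [sq_nonneg (p - 4 * q)]
  have j4 : 2 * h * (2 * (p ^ 2 - p * (D * (2 * ρ))) - h * (3 * w ^ 2)) ≤
      2 * h * frobInner R Q := by gcongr
  have j5 : 0 ≤ h * p ^ 2 := by positivity
  have j6 : 0 ≤ h * q ^ 2 := by positivity
  have j7 : 20 * h * ρ ^ 2 * D ^ 2 = 20 * (h * q ^ 2) := by rw [hq]; ring
  rw [j7]
  have j8 : p * (D * (2 * ρ)) = 2 * (p * q) := by rw [hq]; ring
  rw [j8] at j4
  linarith

end MatrixSensing
end

/-! ### One step of gradient descent on matrices. -/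

noncomputable section

namespace MatrixSensing

open scoped RealInnerProductSpace

variable {d m r : ℕ} {A : Fin m → Matrix (Fin d) (Fin d) ℝ} {X P U : Matrix (Fin d) (Fin d) ℝ}
  {h σ ρ ε δ : ℝ}

/-- The residual `U Uᵀ - X`. -/
def residual (X U : Matrix (Fin d) (Fin d) ℝ) : Matrix (Fin d) (Fin d) ℝ := U * Uᵀ - X

/-- One step `U - h M U` of gradient descent, where `2 M U` is the gradient at `U`. -/
def gdStep (A : Fin m → Matrix (Fin d) (Fin d) ℝ) (X : Matrix (Fin d) (Fin d) ℝ) (h : ℝ)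
    (U : Matrix (Fin d) (Fin d) ℝ) : Matrix (Fin d) (Fin d) ℝ :=
  U - h • ((residual X U + ripErr A (residual X U)) * U)

theorem gdIter_succ (η : ℝ) (U₀ : Matrix (Fin d) (Fin d) ℝ) (t : ℕ) :
    gdIter A X η U₀ (t + 1) = gdStep A X (2 * η) (gdIter A X η U₀ t) := by
  rw [gdIter, grad_loss, gdStep, residual, smul_smul, mul_comm η 2]

theorem op_residual_add_apply (Δ : Matrix (Fin d) (Fin d) ℝ) (x : EuclideanSpace ℝ (Fin d)) :
    op (residual X U + Δ) x = op U (op Uᵀ x) - op X x + op Δ x := by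
  rw [op_add_apply, residual, op_sub_apply, op_mul_apply]

theorem op_gdStep_transpose_apply (hP : IsSignalProj X P σ r) (x : EuclideanSpace ℝ (Fin d)) :
    op (gdStep A X h U)ᵀ x = op Uᵀ (x - h • (op U (op Uᵀ x) - op X x +
      op (ripErr A (residual X U)) x)) := by
  have hs : (residual X U + ripErr A (residual X U))ᵀ = residual X U + ripErr A (residual X U) := by
    have h1 : (residual X U).IsSymm := isSymm_residual hP
    rw [Matrix.transpose_add, h1, isSymm_ripErr h1]
  rw [gdStep, Matrix.transpose_sub, Matrix.transpose_smul, Matrix.transpose_mul, hs,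
    op_sub_apply, op_smul_apply, op_mul_apply, op_residual_add_apply, map_sub, map_smul]

theorem NoiseBound.mono {ε' : ℝ} (hN : NoiseBound P U ρ ε) (hε : ε ≤ ε') :
    NoiseBound P U ρ ε' := by
  obtain ⟨S, hdim, hS⟩ := hN
  exact ⟨S, hdim, fun x hx => ⟨(hS x hx).1, (hS x hx).2.trans (by gcongr)⟩⟩

/-- Consequences of the bound on the noise for the size of the iterate, of its residual and of the
restricted isometry error. -/
theorem NoiseBound.static_bounds (hA : RIP A (max r 2) δ) (hδ : 0 ≤ δ)
    (hP : IsSignalProj X P σ r) (hN : NoiseBound P U ρ ε) (hU : ∀ x, ‖op Uᵀ x‖ ≤ √2 * ‖x‖)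
    (hρ0 : 0 ≤ ρ) (hε0 : 0 ≤ ε) (hρ : ρ ≤ 1 / 20) (hε : 2 * ε * √d ≤ 1 / 10) :
    fro U ≤ 2 * √r ∧ fro (residual X U) ≤ 4 * √r ∧
      (∀ x, ‖op (ripErr A (residual X U)) x‖ ≤
        δ * (6 * fro (residual X U) + 28 * (ε ^ 2 * d)) * ‖x‖) ∧
      fro (residual X U) ^ 2 ≤ 2 * fro (P * residual X U) ^ 2 +
        (2 * ρ * fro (residual X U) + 8 * (ε * ρ * √r) + 4 * (ε ^ 2 * √d)) ^ 2 ∧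
      ∀ s, 0 < s → (∀ x, s * ‖op P x‖ ≤ ‖op Uᵀ (op P x)‖) → s * fro (P * residual X U) ≤
        fro (residual X U * U) + (4 * ρ + 2 * ε) * fro (residual X U) := by
  obtain ⟨Θ, e, hdec, hΘ, he⟩ := hN.exists_decomposition hP hρ0 hε0 (by linarith)
  have hF := fro_factor_le hP hU hdec hΘ he (by positivity) (by positivity) (by linarith) hε
  refine ⟨hF, fro_residual_le hP hU hF, fun x => ?_, ?_, fun s hs hlow => ?_⟩
  · refine (norm_ripErr_residual_le hA hδ hP hdec x).trans ?_
    have h1 := pow_le_pow_left₀ (fro_nonneg e) (fro_le_sqrt_dim (by positivity) he) 2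
    rw [mul_pow, Real.sq_sqrt (Nat.cast_nonneg d)] at h1
    rw [residual]
    gcongr ?_ * _
    refine mul_le_mul_of_nonneg_left ?_ hδ
    linarith
  · refine (fro_sq_residual_le hP (isSymm_residual hP)).trans ?_
    gcongr 2 * ?_ + ?_
    · exact le_rfl
    refine pow_le_pow_left₀ (fro_nonneg _) ?_ 2
    refine (fro_compl_residual_le hP hU hdec hΘ he (by positivity) (by positivity)).trans ?_
    rw [residual]
    apply le_of_eq
    ring
  · refine (mul_fro_proj_residual_le hP hU hdec hΘ he (by positivity) (by positivity) hs hlow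
      (isSymm_residual hP)).trans (le_of_eq ?_)
    rw [residual]; ring

theorem norm_transpose_gdStep_le (hP : IsSignalProj X P σ r) (hU : ∀ x, ‖op Uᵀ x‖ ≤ √2 * ‖x‖)
    (h0 : 0 ≤ h) (h1 : h ≤ 1 / 100) {D : ℝ} (hD : D ≤ 1 / 10)
    (hΔ : ∀ x, ‖op (ripErr A (residual X U)) x‖ ≤ D * ‖x‖) (x : EuclideanSpace ℝ (Fin d)) :
    ‖op (gdStep A X h U)ᵀ x‖ ≤ √2 * ‖x‖ := by
  rw [op_gdStep_transpose_apply hP]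
  have := norm_adjoint_step_le (U := op U) (W := op Uᵀ)
    (N := op (X - ripErr A (residual X U))) (inner_op_left U) h0 h1 (fun x => by
      rw [op_sub_apply]
      have a1 := norm_sub_le (op X x) (op (ripErr A (residual X U)) x)
      have a2 : D * ‖x‖ ≤ 1 / 10 * ‖x‖ := by gcongr
      linarith [hP.norm_signal_le x, hΔ x]) hU x
  rwa [op_sub_apply, ← sub_add] at this

/-- The new subspace is the preimage of S under 1 − hM, which is invertible because h‖M‖ < 1, so the
dimension is kept. The rate g comes either from the angle (early) or from a bound on ‖M‖ (late, once
the residual is small). -/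
theorem NoiseBound.step (hP : IsSignalProj X P σ r) (hN : NoiseBound P U ρ ε)
    (hU : ∀ x, ‖op Uᵀ x‖ ≤ √2 * ‖x‖) (h0 : 0 < h) (h1 : h ≤ 1 / 100) {D ζ g : ℝ}
    (hD0 : 0 ≤ D) (hD : D ≤ 1 / 2) (hΔ : ∀ x, ‖op (ripErr A (residual X U)) x‖ ≤ D * ‖x‖)
    (hρ0 : 0 ≤ ρ) (hρ1 : ρ ≤ 1) (hρσ : ρ * σ = 4 * ζ) (hρ : ρ ^ 2 ≤ σ / 16) (hε0 : 0 ≤ ε)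
    (hζ : 3 * ε + 9 * h + D ≤ ζ)
    (hg : ρ ^ 2 + ζ ≤ g ∨
      ∀ x, ‖op (residual X U + ripErr A (residual X U)) x‖ ≤ g * ‖x‖) :
    NoiseBound P (gdStep A X h U) ρ (ε * (1 + h * g)) := by
  obtain ⟨S, hdim, hS⟩ := hN
  set M := residual X U + ripErr A (residual X U) with hM
  set f : EuclideanSpace ℝ (Fin d) →ₗ[ℝ] EuclideanSpace ℝ (Fin d) :=
    LinearMap.id - h • (op M).toLinearMap with hf
  have hfx : ∀ z, f z = z - h • op M z := fun z => rfl
  have hMle : ∀ x, ‖op M x‖ ≤ 4 * ‖x‖ := fun x => by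
    rw [hM, op_residual_add_apply]
    have a1 := (norm_op_le_sqrt_two hU (op Uᵀ x)).trans
      (mul_le_mul_of_nonneg_left (hU x) (Real.sqrt_nonneg 2))
    rw [← mul_assoc, Real.mul_self_sqrt (by norm_num)] at a1
    have a2 : D * ‖x‖ ≤ 1 / 2 * ‖x‖ := by gcongr
    linarith [norm_add_le (op U (op Uᵀ x) - op X x) (op (ripErr A (residual X U)) x),
      norm_sub_le (op U (op Uᵀ x)) (op X x), hP.norm_signal_le x, hΔ x, norm_nonneg x]
  have hinj : Function.Injective f := by
    rw [← LinearMap.ker_eq_bot, LinearMap.ker_eq_bot']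
    intro z hz
    rw [hfx, sub_eq_zero] at hz
    have a1 : ‖z‖ ≤ 1 / 100 * (4 * ‖z‖) := by
      conv_lhs => rw [hz]
      rw [norm_smul, Real.norm_of_nonneg h0.le]
      gcongr
      exact hMle z
    exact norm_eq_zero.1 (by linarith [norm_nonneg z])
  refine ⟨S.comap f, ?_, fun z hz => ?_⟩
  · rw [← hdim]
    have := (LinearEquiv.ofInjectiveEndo f hinj).symm.finrank_map_eq S
    rw [← this, Submodule.map_equiv_eq_comap_symm]
    rfl
  · obtain ⟨b1, b2⟩ := hS _ hz
    rw [hfx] at b1 b2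
    have hx : z - h • op M z = z - h • (op U (op Uᵀ z) - op X z +
        op (ripErr A (residual X U)) z) := by rw [hM, op_residual_add_apply]
    obtain ⟨k1, k2⟩ := noise_subspace_step (Δ := op (ripErr A (residual X U))) (inner_op_left U) hU
      hP.op_idem hP.op_symm
      (fun x => by rw [← op_mul_apply, hP.signal_mul])
      (fun x => by rw [← op_mul_apply, hP.mul_signal]) hP.norm_signal_le hP.signal_ge hΔ h0 h1
      hP.pos hP.le_one hρ0 hρ1 hρσ hρ hε0 hD0 hD hζ hx b2 b1
    refine ⟨k1, ?_⟩
    rw [op_gdStep_transpose_apply hP, ← hx, mul_assoc]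
    refine b2.trans (mul_le_mul_of_nonneg_left ?_ hε0)
    rcases hg with hg | hg
    · exact k2.trans (by gcongr)
    · refine (norm_sub_le _ _).trans ?_
      rw [norm_smul, Real.norm_of_nonneg h0.le]
      have : h * ‖op M z‖ ≤ h * (g * ‖z‖) := by gcongr; exact hg z
      linarith

theorem signal_gdStep (hP : IsSignalProj X P σ r) (hN : NoiseBound P U ρ ε)
    (hU : ∀ x, ‖op Uᵀ x‖ ≤ √2 * ‖x‖) (h0 : 0 < h) (h1 : h ≤ 1 / 100) {D C s : ℝ}
    (hD0 : 0 ≤ D) (hD : D ≤ 1 / 2) (hΔ : ∀ x, ‖op (ripErr A (residual X U)) x‖ ≤ D * ‖x‖)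
    (hρ0 : 0 ≤ ρ) (hρ1 : ρ ≤ 1 / 2) (hε0 : 0 ≤ ε) (hs0 : 0 < s) (hs : s ^ 2 ≤ σ / 4)
    (hlow : ∀ x, s * ‖op P x‖ ≤ ‖op Uᵀ (op P x)‖) (hC0 : 0 ≤ C) (hC : ε ≤ C * s)
    (hν : (2 * ε + 3 * ρ) ^ 2 ≤ σ / 100) (hμ : (D + 4 * h) * (1 + C) ≤ σ / 200)
    (x : EuclideanSpace ℝ (Fin d)) :
    s * (1 + 13 / 20 * (h * σ)) * ‖op P x‖ ≤ ‖op (gdStep A X h U)ᵀ (op P x)‖ := by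
  rw [op_gdStep_transpose_apply hP]
  obtain ⟨G, hG⟩ := hN.exists_lift hP hρ0 hε0 hρ1
  exact signal_step (Δ := op (ripErr A (residual X U))) (inner_op_left U) hU hP.op_idem hP.op_symm
    (fun x => by rw [← op_mul_apply, hP.mul_signal]) hP.norm_signal_le hP.signal_ge hΔ h0 h1
    hP.pos hP.le_one hρ0 hρ1 hε0 hD0 hD
    (fun v hv => ⟨op G v, by simpa [hv] using (hG v).1, by simpa [hv] using (hG v).2.1,
      by simpa [hv] using (hG v).2.2⟩) hs0 hs hlow hC0 hC hν hμ x

theorem fro_sq_residual_gdStep_le (hP : IsSignalProj X P σ r)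
    (hU : ∀ x, ‖op Uᵀ x‖ ≤ √2 * ‖x‖) (h0 : 0 < h) (h1 : h ≤ 1 / 100) {D : ℝ}
    (hD0 : 0 ≤ D) (hD : D ≤ 1) (hΔ : ∀ x, ‖op (ripErr A (residual X U)) x‖ ≤ D * ‖x‖)
    (hF : fro U ≤ 2 * √r) :
    fro (residual X (gdStep A X h U)) ^ 2 ≤ fro (residual X U) ^ 2 -
      2 * h * fro (residual X U * U) ^ 2 + 20 * h * r * D ^ 2 := by
  have := fro_sq_residual_step hP.symm_signal (isSymm_ripErr (isSymm_residual hP))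
    hP.norm_signal_le hU hΔ hD0 hD h0 h1 hF
  rwa [Real.sq_sqrt (Nat.cast_nonneg r)] at this

end MatrixSensing
end

/-! ### The invariant and its induction step. -/

noncomputable section

namespace MatrixSensing

open scoped RealInnerProductSpace

/-- The relations between the parameters of gradient descent that make the analysis work. Here
`t₁` is the end of the growth phase, `T₂` the end of the contraction phase, `ρ` bounds the angle of
the noise subspace and `Ce * α` the size of the noise. -/
structure Regime (d r : ℕ) (δ α h σ ρ ζ Ce : ℝ) (t₁ T₂ : ℕ) (Tmax : ℝ) : Prop where
  h_pos : 0 < h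
  h_le : h ≤ 1 / 100
  δ_nonneg : 0 ≤ δ
  α_pos : 0 < α
  Ce_nonneg : 0 ≤ Ce
  ρ_nonneg : 0 ≤ ρ
  rip_le : 25 * (δ * √r) ≤ 1 / 10
  ζ_ge : 3 * (Ce * α) + 9 * h + 25 * (δ * √r) ≤ ζ
  angle : ρ * σ = 4 * ζ
  angle_le : ρ ≤ 1 / 20
  angle_sq_le : ρ ^ 2 ≤ σ / 1000
  noise_dim_le : 2 * (Ce * α) * √d ≤ 1 / 10
  noise_sq_le : 28 * ((Ce * α) ^ 2 * d) ≤ 1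
  noise_sq_le' : (Ce * α) ^ 2 * d ≤ √α * σ
  angle_noise_le : (4 * ρ + 2 * (Ce * α)) ^ 2 ≤ σ / 100
  drift_le : (25 * (δ * √r) + 4 * h) * (1 + Ce) ≤ σ / 200
  init_le : α ≤ √σ / 2
  rip_sq_le : 48000 * (δ * √r) ^ 2 ≤ σ
  floor_le : 24 * ((Ce * α) ^ 2 * ρ ^ 2 * r) + 6 * ((Ce * α) ^ 4 * d) + ((Ce * α) ^ 2 * d) ^ 2 ≤
    α * σ ^ 2 / 16
  growth_drift_le : t₁ * (12500 * h * (δ * √r) ^ 2) ≤ 1 / 2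
  residual_init_le : (α ^ 2 * √d + √r) ^ 2 ≤ 3 / 2 * r
  growth : √σ / 2 ≤ α * (1 + 13 / 20 * (h * σ)) ^ t₁
  phase_le : t₁ ≤ T₂
  noise_growth : ∀ t : ℕ, (t : ℝ) ≤ Tmax →
    Real.exp (h * ((ρ ^ 2 + ζ) * (min t T₂ : ℕ) + 4 * √α * σ * t)) ≤ Ce
  contraction : ∀ t : ℕ, T₂ ≤ t → 2 * r * (1 - h * σ / 16) ^ (t - t₁) ≤ α * σ ^ 2

/-- What is known about the iterate `U` after `t` steps. -/
structure Invariant {d : ℕ} (r : ℕ) (X P U : Matrix (Fin d) (Fin d) ℝ)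
    (δ α h σ ρ ζ : ℝ) (t₁ T₂ t : ℕ) : Prop where
  norm_le : ∀ x, ‖op Uᵀ x‖ ≤ √2 * ‖x‖
  noise : NoiseBound P U ρ
    (α * Real.exp (h * ((ρ ^ 2 + ζ) * (min t T₂ : ℕ) + 4 * √α * σ * t)))
  signal : ∀ x, min (α * (1 + 13 / 20 * (h * σ)) ^ t) (√σ / 2) * ‖op P x‖ ≤ ‖op Uᵀ (op P x)‖
  residual_growth : t ≤ t₁ →
    fro (residual X U) ^ 2 ≤ 3 / 2 * r + t * (12500 * h * (δ * √r) ^ 2) * r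
  residual_contraction : t₁ ≤ t →
    fro (residual X U) ^ 2 ≤ 2 * r * (1 - h * σ / 16) ^ (t - t₁) + α * σ ^ 2

variable {d r : ℕ} {δ α h σ ρ ζ Ce : ℝ} {t₁ T₂ : ℕ} {Tmax : ℝ}

theorem add_add_sq_le (a b c : ℝ) : (a + b + c) ^ 2 ≤ 3 * (a ^ 2 + b ^ 2 + c ^ 2) := by
  nlinarith [sq_nonneg (a - b), sq_nonneg (a - c), sq_nonneg (b - c)]

/-- Since the isometry error D is linear in F up to χ, its contribution is a small multiple of σF²
and is absorbed by the decrease, of order σF₁². Only terms without F survive, and they make up the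
floor ασ². -/
theorem residual_contraction_scalar {F F₁ p G χ ε D q b : ℝ} (h0 : 0 < h) (hσ0 : 0 < σ)
    (hσ1 : σ ≤ 1) (hF₁ : 0 ≤ F₁)
    (hsplit : F ^ 2 ≤ 2 * F₁ ^ 2 + G ^ 2) (hpF : √σ / 2 * F₁ ≤ p + b * F)
    (hb : b ^ 2 ≤ σ / 100) (hG : G ^ 2 ≤ 3 * (4 * ρ ^ 2 * F ^ 2 + 64 * (ε ^ 2 * ρ ^ 2 * r) +
      16 * (ε ^ 4 * d))) (hρ : ρ ^ 2 ≤ σ / 1000) (hq : 48000 * q ^ 2 ≤ σ)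
    (hD : r * D ^ 2 ≤ q ^ 2 * (72 * F ^ 2 + 1568 * χ ^ 2))
    (hfloor : 24 * (ε ^ 2 * ρ ^ 2 * r) + 6 * (ε ^ 4 * d) + χ ^ 2 ≤ α * σ ^ 2 / 16) :
    F ^ 2 - 2 * h * p ^ 2 + 20 * h * r * D ^ 2 ≤
      (1 - h * σ / 16) * F ^ 2 + h * σ / 16 * (α * σ ^ 2) := by
  have e1 : σ / 4 * F₁ ^ 2 ≤ 2 * p ^ 2 + 2 * b ^ 2 * F ^ 2 := by
    have a1 := pow_le_pow_left₀ (by positivity) hpF 2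
    have a2 : (√σ / 2 * F₁) ^ 2 = σ / 4 * F₁ ^ 2 := by
      rw [mul_pow, div_pow, Real.sq_sqrt hσ0.le]; ring
    rw [a2] at a1
    nlinarith [sq_nonneg (p - b * F)]
  have e2 : b ^ 2 * F ^ 2 ≤ σ / 100 * F ^ 2 := by gcongr
  have e3 : ρ ^ 2 * F ^ 2 ≤ 1 / 1000 * F ^ 2 := by gcongr; linarith
  have e4 : q ^ 2 * (72 * F ^ 2 + 1568 * χ ^ 2) ≤ σ / 48000 * (72 * F ^ 2 + 1568 * χ ^ 2) := by
    gcongr; linarith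
  have e5 : 20 * (r * D ^ 2) ≤ σ * (3 / 100 * F ^ 2 + χ ^ 2) := by
    have : 0 ≤ σ * χ ^ 2 := by positivity
    linarith
  have e6 : σ * G ^ 2 ≤ σ * (3 * (4 * (1 / 1000 * F ^ 2) + 64 * (ε ^ 2 * ρ ^ 2 * r) +
      16 * (ε ^ 4 * d))) := by gcongr; linarith
  have e7 : σ * F ^ 2 ≤ σ * (2 * F₁ ^ 2 + G ^ 2) := by gcongr
  have e8 := mul_le_mul_of_nonneg_left hfloor hσ0.le
  have e9 : -(2 * p ^ 2) + 20 * (r * D ^ 2) ≤ -(σ / 16 * F ^ 2) + σ / 16 * (α * σ ^ 2) := by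
    have : 0 ≤ σ * F ^ 2 := by positivity
    linarith
  have e10 := mul_le_mul_of_nonneg_left e9 h0.le
  linarith

theorem Invariant.residual_le {X P U : Matrix (Fin d) (Fin d) ℝ} {t : ℕ}
    (hR : Regime d r δ α h σ ρ ζ Ce t₁ T₂ Tmax)
    (hI : Invariant r X P U δ α h σ ρ ζ t₁ T₂ t) (ht : t ≤ t₁) :
    fro (residual X U) ^ 2 ≤ 2 * r := by
  refine (hI.residual_growth ht).trans ?_
  have h1 := hR.growth_drift_le
  have h0 := hR.h_pos
  have h2 : (t : ℝ) * (12500 * h * (δ * √r) ^ 2) ≤ t₁ * (12500 * h * (δ * √r) ^ 2) := by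
    gcongr
  have h3 : (t : ℝ) * (12500 * h * (δ * √r) ^ 2) * r ≤ 1 / 2 * r := by gcongr; linarith
  linarith

set_option maxHeartbeats 1000000 in
theorem Invariant.step {m : ℕ} {A : Fin m → Matrix (Fin d) (Fin d) ℝ}
    {X P U : Matrix (Fin d) (Fin d) ℝ} {t : ℕ}
    (hR : Regime d r δ α h σ ρ ζ Ce t₁ T₂ Tmax) (hA : RIP A (max r 2) δ)
    (hP : IsSignalProj X P σ r) (ht : (t : ℝ) ≤ Tmax)
    (hI : Invariant r X P U δ α h σ ρ ζ t₁ T₂ t) :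
    Invariant r X P (gdStep A X h U) δ α h σ ρ ζ t₁ T₂ (t + 1) := by
  have h0 := hR.h_pos
  have h1 := hR.h_le
  have hδ := hR.δ_nonneg
  have hα := hR.α_pos
  have hCe := hR.Ce_nonneg
  have hρ0 := hR.ρ_nonneg
  have hσ0 := hP.pos
  have hσ1 := hP.le_one
  have hrip := hR.rip_le
  have hr1 := one_le_sqrt_rank hP
  have hq0 : 0 ≤ δ * √r := by positivity
  have hδr : δ ≤ δ * √r := le_mul_of_one_le_right hδ hr1
  have hεb0 : 0 ≤ Ce * α := by positivity
  set ε := α * Real.exp (h * ((ρ ^ 2 + ζ) * (min t T₂ : ℕ) + 4 * √α * σ * t)) with hε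
  have hε0 : 0 ≤ ε := by positivity
  have hεle : ε ≤ Ce * α := by
    rw [hε, mul_comm]; exact mul_le_mul_of_nonneg_right (hR.noise_growth t ht) hα.le
  have hU := hI.norm_le
  obtain ⟨hF, hF4, hΔ, hsplit, hlow⟩ := (hI.noise.mono hεle).static_bounds hA hδ hP hU hρ0 hεb0
    hR.angle_le hR.noise_dim_le
  set F := fro (residual X U) with hFdef
  have hF0 : 0 ≤ F := fro_nonneg _
  set χ := (Ce * α) ^ 2 * d with hχ
  have hχ0 : 0 ≤ χ := by positivity
  have hχ1 : 28 * χ ≤ 1 := hR.noise_sq_le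
  have hDle : δ * (6 * F + 28 * χ) ≤ 25 * (δ * √r) := by
    have : δ * (6 * F + 28 * χ) ≤ δ * (25 * √r) := by gcongr; linarith
    linarith
  have hΔ' : ∀ x, ‖op (ripErr A (residual X U)) x‖ ≤ 25 * (δ * √r) * ‖x‖ := fun x =>
    (hΔ x).trans (by gcongr)
  have hζ : 3 * ε + 9 * h + 25 * (δ * √r) ≤ ζ := le_trans (by linarith) hR.ζ_ge
  have hζ0 : 0 ≤ ζ := le_trans (by positivity) hζ
  have hangle : ρ ^ 2 ≤ σ / 16 := hR.angle_sq_le.trans (by linarith)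
  set s := min (α * (1 + 13 / 20 * (h * σ)) ^ t) (√σ / 2) with hs
  have hfac : 1 ≤ 1 + 13 / 20 * (h * σ) := by
    have : 0 ≤ h * σ := by positivity
    linarith
  have hαs : α ≤ s :=
    le_min (le_mul_of_one_le_right hα.le (one_le_pow₀ hfac)) hR.init_le
  have hs0 : 0 < s := hα.trans_le hαs
  have hs2 : s ^ 2 ≤ σ / 4 := by
    have := pow_le_pow_left₀ hs0.le (min_le_right _ _ : s ≤ √σ / 2) 2
    rw [div_pow, Real.sq_sqrt hσ0.le] at this
    linarith
  -- 12500 = 20 · 25²: the crude isometry bound 25δ√r is used and the decrease is discarded.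
  have hgrow : fro (residual X (gdStep A X h U)) ^ 2 ≤ F ^ 2 + 12500 * h * (δ * √r) ^ 2 * r := by
    have := fro_sq_residual_gdStep_le hP hU h0 h1 (by positivity) (by linarith) hΔ' hF
    have h2 : 0 ≤ h * fro (residual X U * U) ^ 2 := by positivity
    linarith
  refine ⟨norm_transpose_gdStep_le hP hU h0.le h1 hrip hΔ', ?_, fun x => ?_, fun ht1 => ?_,
    fun ht1 => ?_⟩
  · have hexp : ∀ a b : ℝ, 0 ≤ 1 + b → ε * (1 + b) ≤
        α * Real.exp (a + b) ∨ ε ≠ α * Real.exp a := fun a b hb => by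
      by_cases he : ε = α * Real.exp a
      · left
        rw [he, Real.exp_add, mul_assoc]
        gcongr
        linarith [Real.add_one_le_exp b]
      · exact Or.inr he
    rcases lt_or_ge t T₂ with hlt | hge
    · have hN := hI.noise.step hP hU h0 h1 (by positivity) (by linarith) hΔ' hρ0
        (by linarith [hR.angle_le]) hR.angle hangle hε0 hζ (Or.inl le_rfl)
      refine hN.mono ?_
      have k := (hexp (h * ((ρ ^ 2 + ζ) * (min t T₂ : ℕ) + 4 * √α * σ * t)) (h * (ρ ^ 2 + ζ))
        (by positivity)).resolve_right (by simp [hε])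
      refine k.trans ?_
      gcongr
      rw [min_eq_left hlt.le, min_eq_left (by omega : t + 1 ≤ T₂)]
      push_cast
      have : 0 ≤ h * (4 * √α * σ) := by positivity
      linarith
    -- From T₂ on, F² ≤ 2ασ². Hence M itself has norm at most 4√α σ, a slower rate than the one
    -- given by the angle.
    · have hFs : F ≤ 3 / 2 * (√α * σ) := by
        refine abs_le_of_sq_le_sq' ?_ (by positivity) |>.2
        have a1 := hI.residual_contraction (hR.phase_le.trans hge)
        have a2 := hR.contraction t hge
        rw [mul_pow, mul_pow, Real.sq_sqrt hα.le]
        have : 0 ≤ α * σ ^ 2 := by positivity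
        linarith
      have hM : ∀ x, ‖op (residual X U + ripErr A (residual X U)) x‖ ≤ 4 * √α * σ * ‖x‖ :=
        fun x => by
        rw [op_add_apply]
        have a1 := norm_add_le (op (residual X U) x) (op (ripErr A (residual X U)) x)
        have a2 := norm_op_le_fro (residual X U) x
        have a3 : δ * (6 * F + 28 * χ) ≤ 1 / 250 * (6 * F + 28 * χ) := by
          gcongr; linarith
        have a4 : F + δ * (6 * F + 28 * χ) ≤ 4 * √α * σ := by
          have := hR.noise_sq_le'
          have : 0 ≤ √α * σ := by positivity
          linarith
        have a5 : (F + δ * (6 * F + 28 * χ)) * ‖x‖ ≤ 4 * √α * σ * ‖x‖ := by gcongr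
        linarith [hΔ x]
      have hN := hI.noise.step hP hU h0 h1 (by positivity) (by linarith) hΔ' hρ0
        (by linarith [hR.angle_le]) hR.angle hangle hε0 hζ (Or.inr hM)
      refine hN.mono ?_
      have k := (hexp (h * ((ρ ^ 2 + ζ) * (min t T₂ : ℕ) + 4 * √α * σ * t)) (h * (4 * √α * σ))
        (by positivity)).resolve_right (by simp [hε])
      refine k.trans ?_
      gcongr
      rw [min_eq_right hge, min_eq_right (by omega : T₂ ≤ t + 1)]
      push_cast
      linarith
  · have hν : (2 * ε + 3 * ρ) ^ 2 ≤ σ / 100 :=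
      (pow_le_pow_left₀ (by positivity) (by linarith) 2).trans hR.angle_noise_le
    -- The ratio C is Ce: the noise never exceeds Ce·α and the signal never falls below its initial
    -- value α.
    refine le_trans ?_ (signal_gdStep hP hI.noise hU h0 h1 (by positivity) (by linarith) hΔ' hρ0
      (by linarith [hR.angle_le]) hε0 hs0 hs2 hI.signal hCe
      (hεle.trans (mul_le_mul_of_nonneg_left hαs hCe)) hν hR.drift_le x)
    gcongr
    rw [hs]
    rcases min_choice (α * (1 + 13 / 20 * (h * σ)) ^ t) (√σ / 2) with hm | hm
    · rw [hm, mul_assoc, ← pow_succ]; exact min_le_left _ _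
    · rw [hm]
      exact (min_le_right _ _).trans (le_mul_of_one_le_right (by positivity) hfac)
  · have := hI.residual_growth (by omega)
    push_cast
    linarith
  · rcases Nat.lt_or_ge t t₁ with hlt | hge
    -- Handover at t₁: the contraction factor is 1, and the growth bound gives 3r/2 + r/2 = 2r.
    · obtain rfl : t₁ = t + 1 := by omega
      have a1 := hI.residual_growth (by omega)
      have a2 := mul_le_mul_of_nonneg_right hR.growth_drift_le (Nat.cast_nonneg (α := ℝ) r)
      push_cast at a2
      have : 0 ≤ α * σ ^ 2 := by positivity
      rw [Nat.sub_self, pow_zero]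
      linarith
    · have hs' : s = √σ / 2 := by
        refine min_eq_right (hR.growth.trans ?_)
        gcongr
      have hDle1 : δ * (6 * F + 28 * χ) ≤ 1 := by linarith
      -- Here the bound on the isometry error linear in F is needed; the constant 25δ√r would
      -- prevent geometric decay.
      have a1 := fro_sq_residual_gdStep_le hP hU h0 h1 (by positivity) hDle1 hΔ hF
      have a2 := hI.residual_contraction hge
      have a3 := residual_contraction_scalar (r := r) (d := d) (F := F)
        (F₁ := fro (P * residual X U))
        (p := fro (residual X U * U)) (b := 4 * ρ + 2 * (Ce * α)) (ε := Ce * α) (χ := χ)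
        (D := δ * (6 * F + 28 * χ)) (q := δ * √r) (ρ := ρ) (α := α)
        h0 hσ0 hσ1 (fro_nonneg _) hsplit
        (by rw [← hs']; exact hlow s hs0 hI.signal) hR.angle_noise_le ?_ hR.angle_sq_le
        hR.rip_sq_le ?_ hR.floor_le
      · refine a1.trans (a3.trans ?_)
        have hc : 0 ≤ 1 - h * σ / 16 := by
          have : h * σ ≤ 1 / 100 * 1 := by gcongr
          linarith
        have a4 := mul_le_mul_of_nonneg_left a2 hc
        rw [show t + 1 - t₁ = (t - t₁) + 1 by omega, pow_succ (1 - h * σ / 16) (t - t₁)]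
        linarith
      · refine (add_add_sq_le _ _ _).trans (le_of_eq ?_)
        rw [mul_pow 8, mul_pow 4, mul_pow (Ce * α * ρ), mul_pow ((Ce * α) ^ 2),
          Real.sq_sqrt (Nat.cast_nonneg _), Real.sq_sqrt (Nat.cast_nonneg _)]
        ring
      · rw [mul_pow, mul_pow, Real.sq_sqrt (Nat.cast_nonneg _)]
        have e1 : (6 * F + 28 * χ) ^ 2 ≤ 72 * F ^ 2 + 1568 * χ ^ 2 := by
          have := add_sq_le (a := 6 * F) (b := 28 * χ)
          rw [mul_pow, mul_pow] at this
          linarith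
        calc (r : ℝ) * (δ ^ 2 * (6 * F + 28 * χ) ^ 2) = δ ^ 2 * r * (6 * F + 28 * χ) ^ 2 := by ring
          _ ≤ _ := by gcongr

end MatrixSensing
end

/-! ### Choice of the parameters. -/

noncomputable section

namespace MatrixSensing

/-- The smallness assumptions on the parameters of gradient descent in terms of the scale `c`; here
`L` is the logarithm of `d / α` and `q` is `δ * √r`. -/
structure SmallParams (d r : ℕ) (δ α η σ L c Ce : ℝ) : Prop where
  c_pos : 0 < c
  one_le_Ce : 1 ≤ Ce
  c_small : c * Ce ^ 4 ≤ 1 / 10 ^ 10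
  rank_pos : 0 < r
  rank_le : r ≤ d
  σ_pos : 0 < σ
  σ_le : σ ≤ 1
  le_L : 50 ≤ L
  exp_L : α * Real.exp L = d
  δ_pos : 0 < δ
  rip_le : δ * √r * L ^ 2 ≤ c * σ ^ 3
  η_pos : 0 < η
  η_le : η ≤ c * (δ * √r)
  α_pos : 0 < α
  α_le : α * σ ≤ c * (δ * √r)
  dim_le : d * α ≤ c

namespace SmallParams

variable {d r : ℕ} {δ α η σ L c Ce : ℝ}

theorem c_le (hS : SmallParams d r δ α η σ L c Ce) : c ≤ 1 / 10 ^ 10 :=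
  (le_mul_of_one_le_right hS.c_pos.le (one_le_pow₀ hS.one_le_Ce)).trans hS.c_small

theorem c_mul_pow_le (hS : SmallParams d r δ α η σ L c Ce) {k : ℕ} (hk : k ≤ 4) :
    c * Ce ^ k ≤ 1 / 10 ^ 10 :=
  (mul_le_mul_of_nonneg_left (pow_le_pow_right₀ hS.one_le_Ce hk) hS.c_pos.le).trans hS.c_small

theorem one_le_sqrt_rank (hS : SmallParams d r δ α η σ L c Ce) : 1 ≤ √(r : ℝ) :=
  Real.one_le_sqrt.2 (by exact_mod_cast hS.rank_pos)

theorem one_le_dim (hS : SmallParams d r δ α η σ L c Ce) : (1 : ℝ) ≤ d := by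
  exact_mod_cast hS.rank_pos.trans_le hS.rank_le

theorem sqrt_dim_le (hS : SmallParams d r δ α η σ L c Ce) : √(d : ℝ) ≤ d :=
  Real.sqrt_le_iff.2 ⟨Nat.cast_nonneg d, le_self_pow₀ hS.one_le_dim two_ne_zero⟩

theorem q_pos (hS : SmallParams d r δ α η σ L c Ce) : 0 < δ * √r :=
  mul_pos hS.δ_pos (zero_lt_one.trans_le hS.one_le_sqrt_rank)

theorem q_le (hS : SmallParams d r δ α η σ L c Ce) : δ * √r ≤ c * σ ^ 3 := by
  refine le_trans ?_ hS.rip_le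
  exact le_mul_of_one_le_right hS.q_pos.le (one_le_pow₀ (by linarith [hS.le_L]))

theorem q_le_one (hS : SmallParams d r δ α η σ L c Ce) : δ * √r ≤ c := by
  refine hS.q_le.trans (mul_le_of_le_one_right hS.c_pos.le (pow_le_one₀ hS.σ_pos.le hS.σ_le))

/-- The bound on α in terms of δ, combined with the log² in the bound on δ, yields √α·L ≤ 1, needed
to control the late growth of the noise. -/
theorem α_mul_L_sq_le (hS : SmallParams d r δ α η σ L c Ce) : α * L ^ 2 ≤ c ^ 2 * σ ^ 2 := by
  have h1 := hS.σ_pos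
  refine le_of_mul_le_mul_right ?_ h1
  calc α * L ^ 2 * σ = α * σ * L ^ 2 := by ring
    _ ≤ c * (δ * √r) * L ^ 2 := mul_le_mul_of_nonneg_right hS.α_le (sq_nonneg L)
    _ = c * (δ * √r * L ^ 2) := by ring
    _ ≤ c * (c * σ ^ 3) := mul_le_mul_of_nonneg_left hS.rip_le hS.c_pos.le
    _ = c ^ 2 * σ ^ 2 * σ := by ring

theorem α_le_sq (hS : SmallParams d r δ α η σ L c Ce) : α ≤ c ^ 2 * σ ^ 2 :=
  (le_mul_of_one_le_right hS.α_pos.le (one_le_pow₀ (by linarith [hS.le_L]))).trans hS.α_mul_L_sq_le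

theorem σ_sq_le (hS : SmallParams d r δ α η σ L c Ce) : σ ^ 2 ≤ σ :=
  pow_le_of_le_one hS.σ_pos.le hS.σ_le two_ne_zero

theorem α_le_c (hS : SmallParams d r δ α η σ L c Ce) : α ≤ c := by
  refine le_trans ?_ hS.dim_le
  exact le_mul_of_one_le_left hS.α_pos.le hS.one_le_dim

theorem sqrt_α_le (hS : SmallParams d r δ α η σ L c Ce) : √α ≤ c * σ := by
  have := hS.c_pos; have := hS.σ_pos
  refine Real.sqrt_le_iff.2 ⟨by positivity, ?_⟩
  rw [mul_pow]; exact hS.α_le_sq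

theorem sqrt_α_mul_L_le (hS : SmallParams d r δ α η σ L c Ce) : √α * L ≤ 1 := by
  have := hS.c_pos; have := hS.σ_pos; have := hS.α_pos; have := hS.le_L
  have h1 : (√α * L) ^ 2 ≤ (c * σ) ^ 2 := by
    rw [mul_pow, Real.sq_sqrt hS.α_pos.le, mul_pow]
    exact hS.α_mul_L_sq_le
  have h2 := (abs_le_of_sq_le_sq' h1 (by positivity)).2
  have h3 : c * σ ≤ 1 * 1 := by
    gcongr
    · linarith [hS.c_le]
    · exact hS.σ_le
  linarith

theorem η_le_c (hS : SmallParams d r δ α η σ L c Ce) : η ≤ c := by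
  have h1 := hS.η_le
  have h2 : c * (δ * √r) ≤ c * 1 := by
    gcongr
    · exact hS.c_pos.le
    · linarith [hS.q_le_one, hS.c_le]
  linarith

theorem η_mul_σ_le (hS : SmallParams d r δ α η σ L c Ce) : η * σ ≤ c := by
  have h1 := hS.η_pos; have h2 := hS.σ_pos
  have h3 : η * σ ≤ η * 1 := by gcongr; exact hS.σ_le
  linarith [hS.η_le_c]

/-- The bound on the angle of the noise subspace. -/
theorem angle_le (hS : SmallParams d r δ α η σ L c Ce) :
    108 * (δ * √r) / σ ^ 2 ≤ 108 * c * σ := by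
  have h1 := hS.σ_pos
  rw [div_le_iff₀ (by positivity)]
  nlinarith [hS.q_le]

theorem angle_sq_le (hS : SmallParams d r δ α η σ L c Ce) :
    (108 * (δ * √r) / σ ^ 2) ^ 2 ≤ (108 * c * σ) ^ 2 := by
  have h1 := hS.σ_pos; have h2 := hS.q_pos
  exact pow_le_pow_left₀ (by positivity) hS.angle_le 2

theorem noise_dim_le (hS : SmallParams d r δ α η σ L c Ce) :
    2 * (Ce * α) * √d ≤ 1 / 10 := by
  have h1 := hS.one_le_Ce; have h2 := hS.α_pos
  have h3 : Ce * α * √d ≤ Ce * c := by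
    rw [mul_assoc]
    gcongr
    refine le_trans ?_ hS.dim_le
    rw [mul_comm]
    gcongr
    exact hS.sqrt_dim_le
  have h4 := hS.c_mul_pow_le (k := 1) (by norm_num)
  rw [pow_one] at h4
  linarith

/-- One factor dα is at most c by the assumption α < c/d; it absorbs Ce² and leaves a single power
of α. -/
theorem noise_sq_le (hS : SmallParams d r δ α η σ L c Ce) :
    (Ce * α) ^ 2 * d ≤ 1 / 10 ^ 10 * α := by
  have h1 := hS.one_le_Ce; have h2 := hS.α_pos
  calc (Ce * α) ^ 2 * d = Ce ^ 2 * (d * α) * α := by ring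
    _ ≤ Ce ^ 2 * c * α := by gcongr; exact hS.dim_le
    _ = c * Ce ^ 2 * α := by ring
    _ ≤ _ := by gcongr; exact hS.c_mul_pow_le (by norm_num)

theorem angle_noise_le (hS : SmallParams d r δ α η σ L c Ce) :
    (4 * (108 * (δ * √r) / σ ^ 2) + 2 * (Ce * α)) ^ 2 ≤ σ / 100 := by
  have h1 := hS.one_le_Ce; have h2 := hS.α_pos; have h3 := hS.σ_pos; have h4 := hS.q_pos
  have h5 := hS.c_pos
  have e1 : Ce * α ≤ 1 / 10 ^ 10 * σ := by
    calc Ce * α ≤ Ce * (c ^ 2 * σ ^ 2) := by gcongr; exact hS.α_le_sq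
      _ = c * Ce ^ 1 * (c * σ ^ 2) := by ring
      _ ≤ 1 / 10 ^ 10 * (1 * σ) := by
        gcongr
        · exact hS.c_mul_pow_le (by norm_num)
        · linarith [hS.c_le]
        · exact hS.σ_sq_le
      _ = _ := by ring
  have e2 : c * σ ≤ 1 / 10 ^ 10 * σ := by gcongr; exact hS.c_le
  have e3 : 4 * (108 * (δ * √r) / σ ^ 2) + 2 * (Ce * α) ≤ σ / 10 := by
    linarith [hS.angle_le]
  have e4 := pow_le_pow_left₀ (by positivity) e3 2
  rw [div_pow] at e4
  linarith [hS.σ_sq_le]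

theorem drift_le (hS : SmallParams d r δ α η σ L c Ce) :
    (25 * (δ * √r) + 4 * (2 * η)) * (1 + Ce) ≤ σ / 200 := by
  have h1 := hS.one_le_Ce; have h3 := hS.σ_pos; have h4 := hS.q_pos; have h5 := hS.c_pos
  have h6 := hS.η_pos
  have e1 : η ≤ δ * √r :=
    hS.η_le.trans (mul_le_of_le_one_left h4.le (by linarith [hS.c_le]))
  have e2 : δ * √r ≤ c * σ := by
    refine hS.q_le.trans ?_
    gcongr
    exact pow_le_of_le_one h3.le hS.σ_le three_ne_zero
  calc (25 * (δ * √r) + 4 * (2 * η)) * (1 + Ce) ≤ (33 * (c * σ)) * (2 * Ce) := by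
        gcongr <;> linarith
    _ = 66 * (c * Ce ^ 1) * σ := by ring
    _ ≤ 66 * (1 / 10 ^ 10) * σ := by gcongr; exact hS.c_mul_pow_le (by norm_num)
    _ ≤ _ := by linarith

theorem floor_le (hS : SmallParams d r δ α η σ L c Ce) :
    24 * ((Ce * α) ^ 2 * (108 * (δ * √r) / σ ^ 2) ^ 2 * r) + 6 * ((Ce * α) ^ 4 * d) +
      ((Ce * α) ^ 2 * d) ^ 2 ≤ α * σ ^ 2 / 16 := by
  have h1 := hS.one_le_Ce; have h2 := hS.α_pos; have h3 := hS.σ_pos; have h4 := hS.q_pos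
  have h5 := hS.c_pos
  have hc1 : c ^ 2 ≤ 1 / 10 ^ 20 :=
    (pow_le_pow_left₀ h5.le hS.c_le 2).trans (by norm_num)
  have e1 : (Ce * α) ^ 2 * (108 * (δ * √r) / σ ^ 2) ^ 2 * r ≤ 1 / 10 ^ 10 * (α * σ ^ 2) := by
    calc (Ce * α) ^ 2 * (108 * (δ * √r) / σ ^ 2) ^ 2 * r
        ≤ (Ce * α) ^ 2 * (108 * c * σ) ^ 2 * d := by
          gcongr
          · exact hS.angle_le
          · exact hS.rank_le
      _ = (Ce * α) ^ 2 * d * (11664 * c ^ 2 * σ ^ 2) := by ring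
      _ ≤ 1 / 10 ^ 10 * α * (11664 * (1 / 10 ^ 20) * σ ^ 2) :=
          mul_le_mul hS.noise_sq_le (by gcongr) (by positivity) (by positivity)
      _ ≤ _ := by
          have : 0 ≤ α * σ ^ 2 := by positivity
          linarith
  have e3 : α ≤ 1 / 10 ^ 10 * σ ^ 2 := by
    refine hS.α_le_sq.trans ?_
    gcongr
    linarith
  have e2 : ((Ce * α) ^ 2 * d) ^ 2 ≤ 1 / 10 ^ 10 * (α * σ ^ 2) := by
    calc ((Ce * α) ^ 2 * d) ^ 2 ≤ (1 / 10 ^ 10 * α) ^ 2 :=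
          pow_le_pow_left₀ (by positivity) hS.noise_sq_le 2
      _ = 1 / 10 ^ 20 * α * α := by ring
      _ ≤ 1 / 10 ^ 20 * α * (1 / 10 ^ 10 * σ ^ 2) := by gcongr
      _ ≤ _ := by
          have : 0 ≤ α * σ ^ 2 := by positivity
          linarith
  have e4 : (Ce * α) ^ 4 * d ≤ ((Ce * α) ^ 2 * d) ^ 2 := by
    have : (d : ℝ) ≤ d ^ 2 := le_self_pow₀ hS.one_le_dim two_ne_zero
    calc (Ce * α) ^ 4 * d ≤ (Ce * α) ^ 4 * d ^ 2 := by gcongr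
      _ = _ := by ring
  have : 0 ≤ α * σ ^ 2 := by positivity
  linarith

theorem residual_init_le (hS : SmallParams d r δ α η σ L c Ce) :
    (α ^ 2 * √d + √r) ^ 2 ≤ 3 / 2 * r := by
  have h2 := hS.α_pos
  have e1 : α ^ 2 * √d ≤ 1 / 10 * √r := by
    calc α ^ 2 * √d ≤ α ^ 2 * d := by gcongr; exact hS.sqrt_dim_le
      _ = d * α * α := by ring
      _ ≤ c * c := by
        gcongr
        · exact hS.c_pos.le
        · exact hS.dim_le
        · exact hS.α_le_c
      _ ≤ (1 / 10 ^ 10) * (1 / 10 ^ 10) := by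
        gcongr
        · exact hS.c_pos.le
        · exact hS.c_le
        · exact hS.c_le
      _ ≤ 1 / 10 * √r := by linarith [hS.one_le_sqrt_rank]
  have e2 := pow_le_pow_left₀ (by positivity) (add_le_add_left e1 (√r)) 2
  refine e2.trans ?_
  have : (1 / 10 * √r + √r) ^ 2 = 121 / 100 * r := by
    rw [show 1 / 10 * √(r : ℝ) + √r = 11 / 10 * √r by ring, mul_pow,
      Real.sq_sqrt (Nat.cast_nonneg _)]
    norm_num
  linarith [Nat.cast_nonneg (α := ℝ) r]

/-- The end of the growth phase. -/
def growthTime (σ L η : ℝ) : ℕ := ⌈5 / 6 * (L / (σ * η))⌉₊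

/-- The end of the contraction phase. -/
def contractionTime (σ L η : ℝ) : ℕ := ⌈25 * (L / (σ * η))⌉₊

theorem unit_nonneg (hS : SmallParams d r δ α η σ L c Ce) : 0 ≤ L / (σ * η) := by
  have := hS.le_L; have := hS.σ_pos; have := hS.η_pos
  positivity

theorem le_growthTime : 5 / 6 * (L / (σ * η)) ≤ growthTime σ L η := Nat.le_ceil _

theorem growthTime_le (hS : SmallParams d r δ α η σ L c Ce) :
    (growthTime σ L η : ℝ) ≤ 5 / 6 * (L / (σ * η)) + 1 :=
  (Nat.ceil_lt_add_one (by linarith [hS.unit_nonneg])).le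

theorem contractionTime_le (hS : SmallParams d r δ α η σ L c Ce) :
    (contractionTime σ L η : ℝ) ≤ 25 * (L / (σ * η)) + 1 :=
  (Nat.ceil_lt_add_one (by linarith [hS.unit_nonneg])).le

theorem growthTime_le_contractionTime (hS : SmallParams d r δ α η σ L c Ce) :
    growthTime σ L η ≤ contractionTime σ L η :=
  Nat.ceil_le_ceil (by linarith [hS.unit_nonneg])

theorem unit_mul (hS : SmallParams d r δ α η σ L c Ce) : L / (σ * η) * (η * σ) = L := by
  have := hS.σ_pos.ne'; have := hS.η_pos.ne'
  field_simp

theorem growth_drift_le (hS : SmallParams d r δ α η σ L c Ce) :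
    growthTime σ L η * (12500 * (2 * η) * (δ * √r) ^ 2) ≤ 1 / 2 := by
  have h2 := hS.η_pos; have h3 := hS.σ_pos; have h4 := hS.q_pos; have h5 := hS.le_L
  have e1 : growthTime σ L η * η * σ ≤ 2 * L := by
    have a1 := mul_le_mul_of_nonneg_right hS.growthTime_le (by positivity : 0 ≤ η * σ)
    rw [add_mul, mul_assoc (5 / 6), hS.unit_mul] at a1
    linarith [hS.η_mul_σ_le, hS.c_le]
  have e2 : (δ * √r) ≤ 1 / 10 ^ 10 := hS.q_le_one.trans hS.c_le
  have e4 : L * (δ * √r) ≤ c * σ ^ 3 := by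
    refine le_trans ?_ hS.rip_le
    have : L ≤ L ^ 2 := le_self_pow₀ (by linarith) two_ne_zero
    rw [mul_comm]
    gcongr
  have e5 : c * σ ^ 3 ≤ 1 / 10 ^ 10 * σ := by
    have := hS.c_pos
    gcongr
    · exact hS.c_le
    · exact pow_le_of_le_one h3.le hS.σ_le three_ne_zero
  refine le_of_mul_le_mul_right ?_ h3
  calc growthTime σ L η * (12500 * (2 * η) * (δ * √r) ^ 2) * σ
      = 25000 * (growthTime σ L η * η * σ) * (δ * √r) * (δ * √r) := by ring
    _ ≤ 25000 * (2 * L) * (δ * √r) * (1 / 10 ^ 10) := by gcongr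
    _ = 25000 * 2 / 10 ^ 10 * (L * (δ * √r)) := by ring
    _ ≤ 25000 * 2 / 10 ^ 10 * (1 / 10 ^ 10 * σ) := by linarith
    _ ≤ 1 / 2 * σ := by linarith

theorem growth (hS : SmallParams d r δ α η σ L c Ce) :
    √σ / 2 ≤ α * (1 + 13 / 20 * (2 * η * σ)) ^ growthTime σ L η := by
  have h2 := hS.η_pos; have h3 := hS.σ_pos; have h4 := hS.α_pos
  have e0 : η * σ ≤ 1 / 1000 := by linarith [hS.η_mul_σ_le, hS.c_le]
  have e1 : Real.exp (6 / 5 * (η * σ)) ≤ 1 + 13 / 20 * (2 * η * σ) := by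
    have hx : 0 ≤ η * σ := by positivity
    rw [← Real.le_log_iff_exp_le (by positivity)]
    refine le_trans ?_ (Real.one_sub_inv_le_log_of_pos (by positivity))
    rw [le_sub_iff_add_le, ← le_sub_iff_add_le', inv_le_iff_one_le_mul₀ (by positivity)]
    nlinarith
  have e2 : Real.exp L ≤ (1 + 13 / 20 * (2 * η * σ)) ^ growthTime σ L η := by
    refine le_trans ?_ (pow_le_pow_left₀ (Real.exp_pos _).le e1 _)
    -- The signal grows at least by exp(6ησ/5) per step, and (6/5)(5/6) = 1: after the growth time
    -- the total factor is exp L = d/α, which lifts α to d ≥ √σ/2.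
    rw [← Real.exp_nat_mul, Real.exp_le_exp]
    have a1 := mul_le_mul_of_nonneg_right (le_growthTime (σ := σ) (L := L) (η := η))
      (by positivity : 0 ≤ η * σ)
    rw [mul_assoc, hS.unit_mul] at a1
    linarith
  have e3 := mul_le_mul_of_nonneg_left e2 h4.le
  rw [hS.exp_L] at e3
  have e4 : √σ ≤ 1 := Real.sqrt_le_one.2 hS.σ_le
  linarith [hS.one_le_dim]

theorem contraction (hS : SmallParams d r δ α η σ L c Ce) {t : ℕ}
    (ht : contractionTime σ L η ≤ t) :
    2 * r * (1 - 2 * η * σ / 16) ^ (t - growthTime σ L η) ≤ α * σ ^ 2 := by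
  have h2 := hS.η_pos; have h3 := hS.σ_pos; have h4 := hS.α_pos; have h5 := hS.c_pos
  have e0 : η * σ ≤ 1 / 1000 := by linarith [hS.η_mul_σ_le, hS.c_le]
  have e1 : (1 - 2 * η * σ / 16) ^ (t - growthTime σ L η) ≤ Real.exp (-(3 * L)) := by
    refine (pow_le_pow_left₀ (by linarith) (Real.one_sub_le_exp_neg _) _).trans ?_
    rw [← Real.exp_nat_mul, Real.exp_le_exp,
      Nat.cast_sub (hS.growthTime_le_contractionTime.trans ht)]
    have a1 : 25 * (L / (σ * η)) ≤ t := (Nat.le_ceil _).trans (Nat.cast_le.2 ht)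
    -- 145/6 = 25 − 5/6. At rate ησ/8 this gives 145L/48, slightly more than 3L; L ≥ 50 absorbs the
    -- rounding. Then exp(−3L) = (α/d)³ overcomes 2r.
    have a2 : (145 / 6 * (L / (σ * η)) - 1) * (η * σ) ≤
        ((t : ℝ) - growthTime σ L η) * (η * σ) :=
      mul_le_mul_of_nonneg_right (by linarith [hS.growthTime_le]) (by positivity)
    rw [sub_mul, mul_assoc, hS.unit_mul] at a2
    linarith [hS.le_L]
  have e2 : Real.exp (-(3 * L)) * d ^ 3 = α ^ 3 := by
    rw [← hS.exp_L, mul_pow, ← Real.exp_nat_mul, mul_left_comm, ← Real.exp_add]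
    simp
  have e3 : Real.exp (-(3 * L)) * d ≤ α ^ 3 := by
    rw [← e2]
    gcongr
    exact le_self_pow₀ hS.one_le_dim three_ne_zero
  have e4 : α ≤ 1 / 2 := by linarith [hS.α_le_c, hS.c_le]
  have e5 : α ≤ σ ^ 2 := hS.α_le_sq.trans
    (mul_le_of_le_one_left (by positivity) (pow_le_one₀ h5.le (by linarith [hS.c_le])))
  calc 2 * r * (1 - 2 * η * σ / 16) ^ (t - growthTime σ L η)
      ≤ 2 * d * Real.exp (-(3 * L)) := by
        have : (r : ℝ) ≤ d := Nat.cast_le.2 hS.rank_le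
        refine mul_le_mul (by linarith) e1 (pow_nonneg (by linarith) _) (by positivity)
    _ = 2 * (Real.exp (-(3 * L)) * d) := by ring
    _ ≤ 2 * α ^ 3 := by gcongr
    _ = α * (2 * α * α) := by ring
    _ ≤ α * (1 * σ ^ 2) := by gcongr; linarith
    _ = _ := by ring

/-- Until the contraction time the exponent is of order qL/σ², at most 1. Afterwards the rate 4√α σ
over Tmax costs at most 400(√α·L + √α·σ/√(dκα)) ≤ 800; the second summand is why T₀ may contain
1/(η√(dκα)). -/
theorem noise_exponent_le (hS : SmallParams d r δ α η σ L c Ce) {t : ℕ}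
    (ht : (t : ℝ) ≤ 50 * (L / (σ * η) + 1 / (η * √(d * (1 / σ) * α)))) :
    2 * η * (((108 * (δ * √r) / σ ^ 2) ^ 2 + 27 * (δ * √r) / σ) *
      (min t (contractionTime σ L η) : ℕ) + 4 * √α * σ * t) ≤ 801 := by
  have h2 := hS.η_pos; have h3 := hS.σ_pos; have h4 := hS.α_pos; have h5 := hS.c_pos
  have h6 := hS.q_pos; have h7 := hS.le_L
  have hd := hS.one_le_dim
  set N := (min t (contractionTime σ L η) : ℕ) with hN
  have e1 : (N : ℝ) * η * σ ≤ 26 * L := by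
    have a0 : (N : ℝ) ≤ contractionTime σ L η := Nat.cast_le.2 (min_le_right _ _)
    have a1 := mul_le_mul_of_nonneg_right (a0.trans hS.contractionTime_le)
      (by positivity : 0 ≤ η * σ)
    rw [add_mul, mul_assoc 25, hS.unit_mul] at a1
    linarith [hS.η_mul_σ_le, hS.c_le]
  have e2 : (108 * (δ * √r) / σ ^ 2) ^ 2 + 27 * (δ * √r) / σ ≤ 28 * (δ * √r) / σ := by
    have a1 : (108 * (δ * √r) / σ ^ 2) ^ 2 ≤ 108 * (δ * √r) / σ ^ 2 * (108 * c * σ) := by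
      rw [sq]
      gcongr
      exact hS.angle_le
    have a2 : 108 * (δ * √r) / σ ^ 2 * (108 * c * σ) = 11664 * c * ((δ * √r) / σ) := by
      field_simp
      ring
    have a3 : 11664 * c * ((δ * √r) / σ) ≤ 1 * ((δ * √r) / σ) := by
      gcongr
      linarith [hS.c_le]
    have a4 : 28 * (δ * √r) / σ = 27 * (δ * √r) / σ + 1 * ((δ * √r) / σ) := by ring
    linarith
  have e3 : L * (δ * √r) ≤ 1 / 10 ^ 10 * σ ^ 2 := by
    calc L * (δ * √r) ≤ L ^ 2 * (δ * √r) := 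
          mul_le_mul_of_nonneg_right (le_self_pow₀ (by linarith) two_ne_zero) h6.le
      _ = δ * √r * L ^ 2 := by ring
      _ ≤ c * σ ^ 3 := hS.rip_le
      _ ≤ 1 / 10 ^ 10 * σ ^ 2 :=
          mul_le_mul hS.c_le (pow_le_pow_of_le_one h3.le hS.σ_le (by norm_num)) (by positivity)
            (by positivity)
  have e4 : 2 * η * (((108 * (δ * √r) / σ ^ 2) ^ 2 + 27 * (δ * √r) / σ) * N) ≤ 1 := by
    calc 2 * η * (((108 * (δ * √r) / σ ^ 2) ^ 2 + 27 * (δ * √r) / σ) * N)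
        ≤ 2 * η * ((28 * (δ * √r) / σ) * N) := by gcongr
      _ = 56 * (δ * √r) * (N * η * σ) / σ ^ 2 := by field_simp; ring
      _ ≤ 56 * (δ * √r) * (26 * L) / σ ^ 2 := by gcongr
      _ = 1456 * (L * (δ * √r)) / σ ^ 2 := by ring
      _ ≤ 1456 * (1 / 10 ^ 10 * σ ^ 2) / σ ^ 2 := by gcongr
      _ = 1456 / 10 ^ 10 := by field_simp
      _ ≤ 1 := by norm_num
  have e5 : √α * σ * (1 / √(d * (1 / σ) * α)) ≤ 1 := by
    rw [mul_one_div, div_le_one (by positivity)]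
    refine (mul_le_of_le_one_right (Real.sqrt_nonneg _) hS.σ_le).trans (Real.sqrt_le_sqrt ?_)
    refine le_mul_of_one_le_left h4.le ?_
    exact one_le_mul_of_one_le_of_one_le hd (one_le_one_div h3 hS.σ_le)
  have e6 : 2 * η * (4 * √α * σ * t) ≤ 800 := by
    calc 2 * η * (4 * √α * σ * t)
        ≤ 2 * η * (4 * √α * σ * (50 * (L / (σ * η) + 1 / (η * √(d * (1 / σ) * α))))) := by
          gcongr
      _ = 400 * (√α * (L / (σ * η) * (η * σ)) + √α * σ * (η * (1 / (η * √(d * (1 / σ) * α))))) := by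
          ring
      _ = 400 * (√α * L + √α * σ * (1 / √(d * (1 / σ) * α))) := by
          rw [hS.unit_mul, ← div_div, mul_div_assoc', mul_one_div_cancel h2.ne']
      _ ≤ 400 * (1 + 1) := by gcongr; exact hS.sqrt_α_mul_L_le
      _ = 800 := by norm_num
  linarith

/-- Only α·σ, not α, is bounded by a multiple of q = δ√r, so ζ must carry a factor 1/σ: 27q/σ
exceeds 25q with room for the noise and step size terms. Then ρσ = 4ζ forces ρ = 108q/σ². -/
theorem regime (hS : SmallParams d r δ α η σ L c (Real.exp 801)) :
    Regime d r δ α (2 * η) σ (108 * (δ * √r) / σ ^ 2) (27 * (δ * √r) / σ) (Real.exp 801)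
      (growthTime σ L η) (contractionTime σ L η)
      (50 * (L / (σ * η) + 1 / (η * √(d * (1 / σ) * α)))) := by
  have h2 := hS.η_pos; have h3 := hS.σ_pos; have h4 := hS.α_pos; have h5 := hS.c_pos
  have h6 := hS.q_pos; have h7 := hS.le_L; have h8 := hS.c_le; have h9 := hS.q_le_one
  have h10 := hS.one_le_Ce; have h11 := hS.σ_le
  have hcσ : c * σ ≤ 1 / 10 ^ 10 * σ := by gcongr
  exact
  { h_pos := by linarith
    h_le := by linarith [hS.η_le_c]
    δ_nonneg := hS.δ_pos.le
    α_pos := h4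
    Ce_nonneg := by linarith
    ρ_nonneg := by positivity
    rip_le := by linarith
    ζ_ge := by
      rw [le_div_iff₀ h3]
      have a1 : Real.exp 801 * (α * σ) ≤ 1 / 10 ^ 10 * (δ * √r) := by
        calc Real.exp 801 * (α * σ) ≤ Real.exp 801 * (c * (δ * √r)) :=
              mul_le_mul_of_nonneg_left hS.α_le (Real.exp_pos _).le
          _ = c * Real.exp 801 ^ 1 * (δ * √r) := by ring
          _ ≤ _ := by gcongr; exact hS.c_mul_pow_le (by norm_num)
      have a2 : η * σ ≤ 1 / 10 ^ 10 * (δ * √r) := by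
        calc η * σ ≤ η := mul_le_of_le_one_right h2.le h11
          _ ≤ c * (δ * √r) := hS.η_le
          _ ≤ _ := by gcongr
      have a3 : δ * √r * σ ≤ δ * √r := mul_le_of_le_one_right h6.le h11
      linarith
    angle := by field_simp; ring
    angle_le := by linarith [hS.angle_le]
    angle_sq_le := by
      refine hS.angle_sq_le.trans ?_
      have a1 : (108 * c * σ) ^ 2 ≤ (108 * (1 / 10 ^ 10) * σ) ^ 2 := by gcongr
      rw [mul_pow] at a1
      linarith [hS.σ_sq_le]
    noise_dim_le := hS.noise_dim_le
    noise_sq_le := by linarith [hS.noise_sq_le, hS.α_le_c]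
    noise_sq_le' := by
      refine hS.noise_sq_le.trans ?_
      have a1 : √α * √α = α := Real.mul_self_sqrt h4.le
      have a2 : √α * √α ≤ √α * (c * σ) := by gcongr; exact hS.sqrt_α_le
      have a3 : √α * (c * σ) ≤ √α * (1 * σ) := by gcongr; linarith
      linarith
    angle_noise_le := hS.angle_noise_le
    drift_le := hS.drift_le
    init_le := by
      have a1 : σ ≤ √σ := Real.le_sqrt_of_sq_le hS.σ_sq_le
      have a2 := hS.sqrt_α_le
      have a3 : c ^ 2 * σ ^ 2 ≤ (1 / 10 ^ 10) ^ 2 * σ := by gcongr; exact hS.σ_sq_le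
      linarith [hS.α_le_sq]
    rip_sq_le := by
      have a1 : (δ * √r) ^ 2 ≤ (c * σ ^ 3) ^ 2 := pow_le_pow_left₀ h6.le hS.q_le 2
      have a2 : (c * σ ^ 3) ^ 2 ≤ (1 / 10 ^ 10) ^ 2 * σ := by
        rw [mul_pow, ← pow_mul]
        gcongr
        exact pow_le_of_le_one h3.le h11 (by norm_num)
      linarith
    floor_le := hS.floor_le
    growth_drift_le := hS.growth_drift_le
    residual_init_le := hS.residual_init_le
    growth := hS.growth
    phase_le := hS.growthTime_le_contractionTime
    noise_growth := fun t ht => Real.exp_le_exp.2 (hS.noise_exponent_le ht)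
    contraction := fun t ht => hS.contraction ht }

end SmallParams

/-! ### Initialisation, induction and conclusion. -/

variable {d r m : ℕ} {δ α h σ ρ ζ Ce : ℝ} {t₁ T₂ : ℕ} {Tmax : ℝ}

theorem Invariant.init {X P B : Matrix (Fin d) (Fin d) ℝ}
    (hR : Regime d r δ α h σ ρ ζ Ce t₁ T₂ Tmax) (hP : IsSignalProj X P σ r)
    (hB : B ∈ Matrix.orthogonalGroup (Fin d) ℝ) :
    Invariant r X P (α • B) δ α h σ ρ ζ t₁ T₂ 0 := by
  have hα := hR.α_pos
  have hB1 : B * Bᵀ = 1 := (Matrix.mem_orthogonalGroup_iff (Fin d) ℝ).1 hB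
  have hU : ∀ x, ‖op (α • B)ᵀ x‖ = α * ‖x‖ := fun x => by
    rw [Matrix.transpose_smul, op_smul_apply, norm_smul, Real.norm_of_nonneg hα.le,
      norm_op_of_orthogonal (by rwa [Matrix.transpose_transpose])]
  have hα2 : α ≤ √2 := by
    have a1 : √σ ≤ 1 := Real.sqrt_le_one.2 hP.le_one
    have a2 : (1 : ℝ) ≤ √2 := Real.one_le_sqrt.2 (by norm_num)
    linarith [hR.init_le]
  have hres : fro (residual X (α • B)) ^ 2 ≤ 3 / 2 * r := by
    refine (pow_le_pow_left₀ (fro_nonneg _) ?_ 2).trans hR.residual_init_le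
    have a1 : residual X (α • B) = (α ^ 2) • (1 : Matrix (Fin d) (Fin d) ℝ) - X := by
      rw [residual, Matrix.transpose_smul, Matrix.smul_mul, Matrix.mul_smul, hB1, smul_smul, sq]
    rw [a1]
    refine (fro_sub_le _ _).trans (add_le_add ?_ (fro_signal_le hP))
    rw [fro_smul, abs_of_nonneg (by positivity)]
    gcongr
    have := fro_le_sqrt_dim (A := (1 : Matrix (Fin d) (Fin d) ℝ)) zero_le_one (fun x => by
      simp)
    simpa using this
  refine ⟨fun x => ?_, ⟨LinearMap.ker (op P).toLinearMap, rfl, fun x hx => ⟨?_, ?_⟩⟩, fun x => ?_,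
    fun _ => ?_, fun ht => ?_⟩
  · rw [hU]; gcongr
  · have : op P x = 0 := hx
    rw [this, norm_zero]
    exact mul_nonneg hR.ρ_nonneg (norm_nonneg _)
  · rw [hU]; simp
  · rw [hU]
    gcongr
    simp
  · simpa using hres
  · have : 0 ≤ α * σ ^ 2 := by positivity
    obtain rfl : t₁ = 0 := by omega
    rw [Nat.sub_self, pow_zero]
    have : (0 : ℝ) ≤ r := Nat.cast_nonneg r
    linarith

theorem invariant_gdIter {A : Fin m → Matrix (Fin d) (Fin d) ℝ} {X P B : Matrix (Fin d) (Fin d) ℝ}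
    {η : ℝ} (hR : Regime d r δ α (2 * η) σ ρ ζ Ce t₁ T₂ Tmax) (hA : RIP A (max r 2) δ)
    (hP : IsSignalProj X P σ r) (hB : B ∈ Matrix.orthogonalGroup (Fin d) ℝ) (t : ℕ)
    (ht : (t : ℝ) ≤ Tmax) :
    Invariant r X P (gdIter A X η (α • B) t) δ α (2 * η) σ ρ ζ t₁ T₂ t := by
  induction t with
  | zero => exact Invariant.init hR hP hB
  | succ t ih =>
    have ht' : (t : ℝ) ≤ Tmax := by push_cast at ht; linarith
    rw [gdIter_succ]
    exact Invariant.step hR hA hP ht' (ih ht')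

theorem exp_mul_le_one_sub_rpow {x y : ℝ} (hx1 : x < 1) (hy : 0 ≤ y) :
    Real.exp (x * y) ≤ (1 - x) ^ (-y) := by
  rw [Real.rpow_def_of_pos (by linarith), Real.exp_le_exp]
  have := mul_le_mul_of_nonneg_right (Real.log_le_sub_one_of_pos (by linarith : 0 < 1 - x)) hy
  linarith

/-- T₀ exceeds the growth time by about L/(6ση), so (1 − x)^(t − T₀) ≥ 2 for every t up to the
growth time. This absorbs the constant 2 in 2r, both in the growth phase and, after factoring at t₁,
in the contraction phase. -/
theorem gdIter_error {A : Fin m → Matrix (Fin d) (Fin d) ℝ} {X P B : Matrix (Fin d) (Fin d) ℝ}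
    {η L c T₀ : ℝ} (hS : SmallParams d r δ α η σ L c (Real.exp 801)) (hA : RIP A (max r 2) δ)
    (hP : IsSignalProj X P σ r) (hB : B ∈ Matrix.orthogonalGroup (Fin d) ℝ)
    (hT₀ : L / (σ * η) ≤ T₀) {t : ℕ}
    (ht : (t : ℝ) ≤ 50 * (L / (σ * η) + 1 / (η * √(d * (1 / σ) * α)))) :
    fro (residual X (gdIter A X η (α • B) t)) ^ 2 ≤
        r * (1 - 2 * η * σ / 16) ^ ((t : ℝ) - T₀) + α * σ ^ 2 ∧
      (25 * (L / (σ * η)) ≤ t →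
        fro (residual X (gdIter A X η (α • B) t)) ^ 2 ≤ 2 * (α * σ ^ 2)) := by
  have hI := invariant_gdIter hS.regime hA hP hB t ht
  have hη := hS.η_pos
  have hσ := hS.σ_pos
  have hα := hS.α_pos
  set x := 2 * η * σ / 16 with hx
  set t₁ := SmallParams.growthTime σ L η
  have hx0 : 0 < x := by positivity
  have hx1 : x < 1 / 1000 := by linarith [hS.η_mul_σ_le, hS.c_le]
  have htwo : ∀ s : ℝ, s ≤ t₁ → 2 ≤ (1 - x) ^ (s - T₀) := fun s hs => by
    have a1 : L / (6 * (σ * η)) - 1 ≤ T₀ - s := by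
      have := hS.growthTime_le
      have e : L / (6 * (σ * η)) = 1 / 6 * (L / (σ * η)) := by
        field_simp
      linarith
    have a2 : x * (L / (6 * (σ * η)) - 1) = L / 48 - x := by
      rw [hx]; field_simp; ring
    have a3 := mul_le_mul_of_nonneg_left a1 hx0.le
    have hL := hS.le_L
    have a4 : 0 ≤ T₀ - s := by
      by_contra! hneg
      have := mul_neg_of_pos_of_neg hx0 hneg
      linarith
    have a5 := exp_mul_le_one_sub_rpow (x := x) (by linarith) a4
    rw [neg_sub] at a5
    linarith [Real.add_one_le_exp (x * (T₀ - s))]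
  have hr0 : (0 : ℝ) ≤ r := Nat.cast_nonneg r
  refine ⟨?_, fun ht2 => ?_⟩
  · have : 0 ≤ α * σ ^ 2 := by positivity
    rcases le_total t t₁ with hle | hge
    · have a1 := hI.residual_le hS.regime hle
      have a2 := mul_le_mul_of_nonneg_left (htwo t (Nat.cast_le.2 hle)) hr0
      linarith
    · refine (hI.residual_contraction hge).trans ?_
      have a1 : (1 - x) ^ ((t : ℝ) - T₀) = (1 - x) ^ (t - t₁) * (1 - x) ^ ((t₁ : ℝ) - T₀) := by
        rw [← Real.rpow_natCast, Nat.cast_sub hge, ← Real.rpow_add (by linarith)]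
        congr 1; ring
      have a2 : 0 ≤ r * (1 - x) ^ (t - t₁) := mul_nonneg hr0 (pow_nonneg (by linarith) _)
      have a3 := mul_le_mul_of_nonneg_left (htwo t₁ le_rfl) a2
      rw [a1]
      linarith
  · have hT : SmallParams.contractionTime σ L η ≤ t := Nat.ceil_le.2 ht2
    have a1 := hI.residual_contraction (hS.growthTime_le_contractionTime.trans hT)
    have a2 := hS.contraction hT
    linarith

theorem smallParams_of_assumptions {η : ℝ} (hr : 0 < r) (hrd : r ≤ d) (hσ0 : 0 < σ) (hσ1 : σ ≤ 1)
    (hα : 0 < α) (hαd : α < Real.exp (-4000) / d)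
    (hαδ : α ≤ Real.exp (-4000) * (δ * √r * (1 / σ)))
    (hδ : δ ≤ Real.exp (-4000) / ((1 / σ) ^ 3 * √r * Real.log (d / α) ^ 2))
    (hη0 : 0 < η) (hη : η ≤ Real.exp (-4000) * δ) :
    SmallParams d r δ α η σ (Real.log (d / α)) (Real.exp (-4000)) (Real.exp 801) := by
  have hd1 : (1 : ℝ) ≤ d := by exact_mod_cast hr.trans_le hrd
  have hr1 : 1 ≤ √(r : ℝ) := Real.one_le_sqrt.2 (by exact_mod_cast hr)
  have hδ0 : 0 < δ := pos_of_mul_pos_right (hη0.trans_le hη) (Real.exp_pos _).le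
  have hdα : (d : ℝ) * α ≤ Real.exp (-4000) := by
    rw [lt_div_iff₀ (by linarith)] at hαd
    linarith
  have hL : 50 ≤ Real.log (d / α) := by
    rw [Real.le_log_iff_exp_le (by positivity), le_div_iff₀ hα]
    have a1 : α ≤ Real.exp (-4000) := (le_mul_of_one_le_left hα.le hd1).trans hdα
    have a2 : Real.exp 50 * α ≤ Real.exp 50 * Real.exp (-4000) := by gcongr
    rw [← Real.exp_add] at a2
    have a3 : Real.exp (50 + -4000) ≤ 1 := Real.exp_le_one_iff.2 (by norm_num)
    linarith
  refine ⟨Real.exp_pos _, Real.one_le_exp (by norm_num), ?_, hr, hrd, hσ0, hσ1, hL, ?_, hδ0, ?_, hη0,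
    ?_, hα, ?_, hdα⟩
  -- c·Ce⁴ = exp(−4000 + 3204), and exp 796 ≥ (exp 79)^10 ≥ 80^10 ≥ 10^10.
  · rw [← Real.exp_nat_mul, ← Real.exp_add, le_div_iff₀ (by positivity), ← le_div_iff₀' (Real.exp_pos _),
      one_div, ← Real.exp_neg]
    have a1 := pow_le_pow_left₀ (by norm_num) (Real.add_one_le_exp (79 : ℝ)) 10
    rw [← Real.exp_nat_mul] at a1
    have a2 : Real.exp ((10 : ℕ) * 79) ≤ Real.exp (-(-4000 + (4 : ℕ) * 801)) :=
      Real.exp_le_exp.2 (by norm_num)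
    exact le_trans (by norm_num) (a1.trans a2)
  · rw [Real.exp_log (by positivity)]
    field_simp
  · rw [le_div_iff₀ (by positivity)] at hδ
    have a1 := mul_le_mul_of_nonneg_right hδ (by positivity : 0 ≤ σ ^ 3)
    refine le_trans (le_of_eq ?_) a1
    field_simp
  · refine hη.trans ?_
    gcongr
    exact le_mul_of_one_le_right hδ0.le hr1
  · have a1 := mul_le_mul_of_nonneg_right hαδ hσ0.le
    refine a1.trans (le_of_eq ?_)
    field_simp

end MatrixSensing
end

theorem mainTheorem2 :
    ∃ c : ℝ, 0 < c ∧ ∃ K : ℝ, 1 ≤ K ∧ ∃ C : ℝ, 0 < C ∧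
      ∀ (d r m : ℕ) (Xs : Matrix (Fin d) (Fin d) ℝ) (A : Fin m → Matrix (Fin d) (Fin d) ℝ)
        (B : Matrix (Fin d) (Fin d) ℝ) (κ α δ η : ℝ),
        Xs.PosSemidef → Xs.rank = r → MatrixSensing.spectralNorm Xs = 1 →
        κ = MatrixSensing.condNumber Xs r →
        B ∈ Matrix.orthogonalGroup (Fin d) ℝ →
        0 < α → α < c / d → α ≤ c * (δ * √r * κ) →
        MatrixSensing.RIP A (max r 2) δ →
        δ ≤ c / (κ ^ 3 * √r * Real.log (d / α) ^ 2) →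
        0 < η → η ≤ c * δ →
        (∀ t : ℕ, (t : ℝ) ≤ 2 * K * MatrixSensing.timeT0 d κ α η →
          MatrixSensing.frobSq (MatrixSensing.gdIter A Xs η (α • B) t *
              (MatrixSensing.gdIter A Xs η (α • B) t)ᵀ - Xs) ≤
            r * (1 - η / (8 * κ)) ^ ((t : ℝ) - MatrixSensing.timeT0 d κ α η) +
              C * (α * √d / κ ^ 2)) ∧
        (∀ T₁ : ℕ, K * (κ * Real.log (d / α) / η) ≤ T₁ →
          (T₁ : ℝ) ≤ 2 * K * MatrixSensing.timeT0 d κ α η →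
          MatrixSensing.frobSq (MatrixSensing.gdIter A Xs η (α • B) T₁ *
              (MatrixSensing.gdIter A Xs η (α • B) T₁)ᵀ - Xs) ≤
            C * (α * √d / κ ^ 2)) := by
  -- K = 25 is the coefficient of the contraction time, so 2K = 50 matches the horizon of
  -- `noise_exponent_le`. C = 2 because decayed term and floor are each at most ασ².
  refine ⟨Real.exp (-4000), Real.exp_pos _, 25, by norm_num, 2, by norm_num, ?_⟩
  intro d r m Xs A B κ α δ η hX hrank hnorm hκ hB hα hαd hαδ hA hδ hη0 hη
  obtain ⟨P, hP⟩ := MatrixSensing.exists_isSignalProj hX hrank hnorm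
  rw [← hκ] at hP
  obtain ⟨σ, hσ⟩ : ∃ σ, σ = 1 / κ := ⟨_, rfl⟩
  rw [← hσ] at hP
  obtain rfl : κ = 1 / σ := by rw [hσ, one_div_one_div]
  have hσ0 := hP.pos
  have hrd : r ≤ d := by
    have := Xs.rank_le_width
    rwa [hrank] at this
  have hS := MatrixSensing.smallParams_of_assumptions hP.rank_pos hrd hσ0 hP.le_one hα hαd hαδ hδ
    hη0 hη
  have hunit : 1 / σ * Real.log (d / α) / η = Real.log (d / α) / (σ * η) := by
    field_simp
  have hT₀ : Real.log (d / α) / (σ * η) ≤ MatrixSensing.timeT0 d (1 / σ) α η := by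
    rw [← hunit]; exact le_max_left _ _
  have hT : ∀ t : ℕ, (t : ℝ) ≤ 2 * 25 * MatrixSensing.timeT0 d (1 / σ) α η →
      (t : ℝ) ≤ 50 * (Real.log (d / α) / (σ * η) + 1 / (η * √(d * (1 / σ) * α))) := fun t ht => by
    have h1 : MatrixSensing.timeT0 d (1 / σ) α η ≤
        Real.log (d / α) / (σ * η) + 1 / (η * √(d * (1 / σ) * α)) := by
      rw [MatrixSensing.timeT0, hunit]
      exact max_le_add_of_nonneg hS.unit_nonneg (by positivity)
    linarith
  -- The bound obtained, α/κ², is free of √d; the stated floor is weaker.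
  have hfloor : 2 * (α * σ ^ 2) ≤ 2 * (α * √d / (1 / σ) ^ 2) := by
    have h1 : 1 ≤ √(d : ℝ) := Real.one_le_sqrt.2 hS.one_le_dim
    have h2 : α * √d / (1 / σ) ^ 2 = α * σ ^ 2 * √d := by
      field_simp
    rw [h2]
    have h3 : 0 ≤ α * σ ^ 2 := by positivity
    linarith [le_mul_of_one_le_right h3 h1]
  have hrate : η / (8 * (1 / σ)) = 2 * η * σ / 16 := by
    field_simp
    norm_num
  refine ⟨fun t ht => ?_, fun t ht1 ht2 => ?_⟩
  · have h1 := (MatrixSensing.gdIter_error hS hA hP hB hT₀ (hT t ht)).1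
    rw [MatrixSensing.fro_sq, MatrixSensing.residual] at h1
    rw [hrate]
    have h3 : 0 ≤ α * σ ^ 2 := by positivity
    linarith
  · have h1 := (MatrixSensing.gdIter_error hS hA hP hB hT₀ (hT t ht2)).2 (by
      rwa [hunit] at ht1)
    rw [MatrixSensing.fro_sq, MatrixSensing.residual] at h1
    exact h1.trans hfloor
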